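/- Let $\theta\in(0,\pi)$, let $\Omega=\{(r\cos\varphi,r\sin\varphi): r>0,\ 0<\varphi<\theta\}$ and $\partial\Omega'=\partial\Omega\setminus\{0\}$. Vector fields are written $\mathbf u=u_r\mathbf e_r+u_\varphi\mathbf e_\varphi$ with $\mathbf e_r=(\cos\varphi,\sin\varphi)$, $\mathbf e_\varphi=(-\sin\varphi,\cos\varphi)$. Let $C^\infty_{c,\sigma}(\overline\Omega\setminus\{0\})$ be the set of all vector fields $\mathbf u\in C_c^\infty(\overline\Omega\setminus\{0\})$ with $\operatorname{div}\mathbf u=0$ in $\Omega$ and $u_\varphi=0$ on $\partial\Omega'$. For $\alpha\in\mathbb R$ and $k\in\mathbb N$ put $$|f|_\alpha^2=\sum_{\vartheta\in\{0,\theta\}}\int_0^\infty r^{-2\alpha}|f(r,\vartheta)|^2\,dr,\qquad \llbracket\mathbf u\rrbracket_{k,\alpha}^2=\sum_{j+\ell=k}\int_0^\theta\!\!\int_0^\infty r^{-2\alpha-2k}|(r\partial_r)^j\partial_\varphi^\ell\mathbf u|^2\,r\,dr\,d\varphi ,$$ $$\|\mathbf u\|^2_{\mathfrak X^2_{\alpha,\theta}}=|u_r|_\alpha^2+|\alpha|\theta^3|r\partial_ru_r|_\alpha^2+\llbracket\mathbf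 u\rrbracket_{1,\alpha}^2+|\alpha|\theta^3\llbracket\mathbf u\rrbracket_{2,\alpha-1}^2 ,$$ where $\partial_\varphi\mathbf u$ is the derivative of the $\mathbb R^2$-valued function $\mathbf u$. Helmholtz projection. For the Mellin transform $\widehat f(\lambda,\varphi)=\frac1{\sqrt{2\pi}}\int_0^\infty r^{-\lambda}f(r,\varphi)\frac{dr}r$ and $\mathbf w\in C_c^\infty(\overline\Omega\setminus\{0\})$ let $\widehat\Phi(\lambda,\cdot)$ be the solution of $(\lambda^2+\partial_\varphi^2)\widehat\Phi(\lambda,\varphi)=\lambda\widehat w_r(\lambda-1,\varphi)+\partial_\varphi\widehat w_\varphi(\lambda-1,\varphi)$ on $(0,\theta)$ with $\partial_\varphi\widehat\Phi(\lambda,\varphi)=\widehat w_\varphi(\lambda-1,\varphi)$ at $\varphi\in\{0,\theta\}$, given by Green's function. Then $\mathbb P\mathbf w=\mathbf w-\nabla\Phi$, where $$\nabla\Phi(r,\varphi)=\frac1{\sqrt{2\pi}}\int_{\operatorname{Re}\lambda=\gamma}r^\lambda\begin{pmatrix}(\lambda+1)\widehat\Phi(\lambda+1,\varphi)\\ \partial_\varphi\widehat\Phi(\lambda+1,\varphi)\end{pmatrix}d\operatorname{Im}\lambda$$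 and $\gamma\in\big(-\frac{\pi+\theta}\theta,\frac{\pi-\theta}\theta\big)$ is arbitrary (for each $\gamma$ the statement below holds, with the same constants). Write $[A_1,A_2]=A_1A_2-A_2A_1$. Bilinear forms. For $\mathbf u,\mathbf v\in C^\infty_{c,\sigma}(\overline\Omega\setminus\{0\})$ let $$\begin{aligned}B_1(\mathbf u,\mathbf v)=&\int_{\partial\Omega'}r^{-2\alpha}v_ru_r\,ds+\int_\Omega r^{-2\alpha}\nabla\mathbf v:\nabla\mathbf u\,dx-2\alpha\int_\Omega r^{-2\alpha-1}\mathbf v\cdot\partial_r\mathbf u\,dx\\&-\int_\Omega r^{-2}\partial_\varphi\big((\partial_\varphi u_r)([\mathbb P,r^{-2\alpha}]\mathbf v)_r\big)dx+\int_\Omega\nabla[\mathbb P,r^{-2\alpha}]\mathbf v:\nabla\mathbf u\,dx,\end{aligned}$$ $$\begin{aligned}B_2(\mathbf u,\mathbf v)=&\int_{\partial\Omega'}r^{-2\alpha}(r\partial_rv_r)\,(r\partial_r-2\alpha+1)u_r\,ds+\int_\Omega r^{-2\alpha}\nabla(r\partial_r\mathbf v):\nabla(r\partial_r\mathbf u)\,dx\\&-2\alpha\int_\Omega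 r^{-2\alpha}\nabla(r\partial_r\mathbf v):\nabla\mathbf u\,dx+2\alpha\int_\Omega r^{-2\alpha-1}((r\partial_r)^2\mathbf v)\cdot\partial_r\mathbf u\,dx\\&+\int_\Omega r^{-2}\partial_\varphi\big((\partial_\varphi u_r)([\mathbb P,r^{-2\alpha}](r\partial_r)^2\mathbf v)_r\big)dx-\int_\Omega\nabla[\mathbb P,r^{-2\alpha}](r\partial_r)^2\mathbf v:\nabla\mathbf u\,dx,\end{aligned}$$ $$B_3(\mathbf u,\mathbf v)=\int_\Omega r^{-2\alpha+2}\Delta\mathbf u\cdot\Delta\mathbf v\,dx+\int_\Omega r^{-2\alpha+2}[\mathbb P,\Delta]\mathbf u\cdot\Delta\mathbf v\,dx,$$ and, for $c_3>0$, $B=B_1+|\alpha|\theta^3B_2+c_3|\alpha|\theta^3B_3$. **Proposition (coercivity and boundedness).** Let $\varepsilon\in(0,1)$. There are constants $c,c_3,C_1,C_2>0$, depending only on $\varepsilon$, such that for all $\theta\in(0,(1-\varepsilon)\pi)$ and all $\alpha\in\big[-(1-\varepsilon)\tfrac\pi\theta+1,(1-\varepsilon)\tfrac\pi\theta-1\big]\setminus\mathbb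 Z$ with $|\alpha\theta|<c$, the form $B$ with this $c_3$ satisfies $$B(\mathbf u,\mathbf u)\ge C_1\|\mathbf u\|^2_{\mathfrak X^2_{\alpha,\theta}}\quad\text{for all }\mathbf u\in C^\infty_{c,\sigma}(\overline\Omega\setminus\{0\}),$$ $$|B(\mathbf u,\mathbf v)|\le C_2\|\mathbf u\|_{\mathfrak X^2_{\alpha,\theta}}\|\mathbf v\|_{\mathfrak X^2_{\alpha,\theta}}\quad\text{for all }\mathbf u,\mathbf v\in C^\infty_{c,\sigma}(\overline\Omega\setminus\{0\}).$$ -/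

import Mathlib

open Real Set MeasureTheory
open scoped ContDiff

noncomputable section

namespace Wedge

/-! Functions on the wedge are written in polar coordinates `(r, φ)`, `r > 0`, `0 ≤ φ ≤ θ`. -/

/-- A planar vector field `u = u_r e_r + u_φ e_φ`, given by its polar components as functions
of `(r, φ)`, where `e_r = (cos φ, sin φ)` and `e_φ = (-sin φ, cos φ)`. -/
@[ext]
structure PolarField where
  /-- the radial component `u_r` -/
  rad : ℝ → ℝ → ℝ
  /-- the angular component `u_φ` -/
  ang : ℝ → ℝ → ℝ

/-- `∂_r f` -/
def dr (f : ℝ → ℝ → ℝ) : ℝ → ℝ → ℝ := fun r φ => deriv (fun s => f s φ) r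

/-- `∂_φ f` -/
def dphi (f : ℝ → ℝ → ℝ) : ℝ → ℝ → ℝ := fun r φ => deriv (fun s => f r s) φ

/-- `r ∂_r f` -/
def rdr (f : ℝ → ℝ → ℝ) : ℝ → ℝ → ℝ := fun r φ => r * dr f r φ

namespace PolarField

instance : Sub PolarField :=
  ⟨fun u v => ⟨fun r φ => u.rad r φ - v.rad r φ, fun r φ => u.ang r φ - v.ang r φ⟩⟩

/-- The Euclidean inner product `u · v` at the point `(r, φ)`. -/
def dot (u v : PolarField) (r φ : ℝ) : ℝ := u.rad r φ * v.rad r φ + u.ang r φ * v.ang r φ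

/-- The field `r ^ β u`. -/
def powMul (β : ℝ) (u : PolarField) : PolarField :=
  ⟨fun r φ => r ^ β * u.rad r φ, fun r φ => r ^ β * u.ang r φ⟩

/-- `∂_r u` (the unit vectors `e_r`, `e_φ` do not depend on `r`). -/
def partialR (u : PolarField) : PolarField := ⟨dr u.rad, dr u.ang⟩

/-- `r ∂_r u` -/
def eulerR (u : PolarField) : PolarField := ⟨rdr u.rad, rdr u.ang⟩

/-- `∂_φ u`, the derivative of the vector-valued function `u_r e_r + u_φ e_φ`; here
`∂_φ e_r = e_φ` and `∂_φ e_φ = - e_r`. -/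
def partialPhi (u : PolarField) : PolarField :=
  ⟨fun r φ => dphi u.rad r φ - u.ang r φ, fun r φ => dphi u.ang r φ + u.rad r φ⟩

/-- `div u = r⁻¹ ((r ∂_r + 1) u_r + ∂_φ u_φ)` -/
def divergence (u : PolarField) (r φ : ℝ) : ℝ :=
  r⁻¹ * (rdr u.rad r φ + u.rad r φ + dphi u.ang r φ)

/-- `∇u : ∇v`, where
`∇u = r⁻¹ (r ∂_r u_r, ∂_φ u_r - u_φ; r ∂_r u_φ, ∂_φ u_φ + u_r)`. -/
def gradDot (u v : PolarField) (r φ : ℝ) : ℝ :=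
  (r⁻¹ * rdr u.rad r φ) * (r⁻¹ * rdr v.rad r φ)
    + (r⁻¹ * (dphi u.rad r φ - u.ang r φ)) * (r⁻¹ * (dphi v.rad r φ - v.ang r φ))
    + (r⁻¹ * rdr u.ang r φ) * (r⁻¹ * rdr v.ang r φ)
    + (r⁻¹ * (dphi u.ang r φ + u.rad r φ)) * (r⁻¹ * (dphi v.ang r φ + v.rad r φ))

/-- The vector Laplacian `Δu` in polar components. -/
def laplace (u : PolarField) : PolarField :=
  ⟨fun r φ => (r ^ 2)⁻¹ *
      (rdr (rdr u.rad) r φ + dphi (dphi u.rad) r φ - 2 * dphi u.ang r φ - u.rad r φ),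
   fun r φ => (r ^ 2)⁻¹ *
      (rdr (rdr u.ang) r φ + dphi (dphi u.ang) r φ + 2 * dphi u.rad r φ - u.ang r φ)⟩

end PolarField

open PolarField

/-- Divergence-free test fields on the closed wedge of angle `θ` without its tip: smooth up to the
two rays (that is, the restriction of a smooth field), supported in an annulus `a ≤ r ≤ b` with
`a > 0`, divergence free inside, with vanishing normal component on the two rays. -/
structure IsTestField (θ : ℝ) (u : PolarField) : Prop where
  smooth_rad : ContDiff ℝ ∞ (fun p : ℝ × ℝ => u.rad p.1 p.2)
  smooth_ang : ContDiff ℝ ∞ (fun p : ℝ × ℝ => u.ang p.1 p.2)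
  support : ∃ a b : ℝ, 0 < a ∧ a ≤ b ∧
    ∀ r φ : ℝ, r ∉ Icc a b → u.rad r φ = 0 ∧ u.ang r φ = 0
  div_eq_zero : ∀ r φ : ℝ, 0 < r → φ ∈ Ioo 0 θ → u.divergence r φ = 0
  tangential : ∀ r : ℝ, 0 < r → u.ang r 0 = 0 ∧ u.ang r θ = 0

/-- `∫_Ω f dx = ∫_0^θ ∫_0^∞ f r dr dφ` -/
def intWedge (θ : ℝ) (f : ℝ → ℝ → ℝ) : ℝ :=
  ∫ φ in (0 : ℝ)..θ, ∫ r in Ioi (0 : ℝ), f r φ * r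

/-- `∫_{∂Ω'} f ds`, the integral over the two boundary rays -/
def intRays (θ : ℝ) (f : ℝ → ℝ → ℝ) : ℝ :=
  (∫ r in Ioi (0 : ℝ), f r 0) + ∫ r in Ioi (0 : ℝ), f r θ

/-- `|f|_α²` for a function on the boundary rays -/
def rayNormSq (θ α : ℝ) (f : ℝ → ℝ → ℝ) : ℝ :=
  intRays θ fun r φ => r ^ (-2 * α) * |f r φ| ^ 2

/-- `⟦u⟧_{k,α}²`, the sum over `j + ℓ = k` of
`∫_0^θ ∫_0^∞ r^{-2α-2k} |(r ∂_r)^j ∂_φ^ℓ u|² r dr dφ` -/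
def seminormSq (θ : ℝ) (k : ℕ) (α : ℝ) (u : PolarField) : ℝ :=
  ∑ p ∈ Finset.HasAntidiagonal.antidiagonal k,
    intWedge θ fun r φ => r ^ (-2 * α - 2 * (k : ℝ)) *
      (eulerR^[p.1] (partialPhi^[p.2] u)).dot (eulerR^[p.1] (partialPhi^[p.2] u)) r φ

/-- The norm, the square root of `|u_r|_α² + |α|θ³ |r∂_r u_r|_α² + ⟦u⟧_{1,α}² + |α|θ³ ⟦u⟧_{2,α-1}²`. -/
def normX (α θ : ℝ) (u : PolarField) : ℝ :=
  √(rayNormSq θ α u.rad + |α| * θ ^ 3 * rayNormSq θ α (rdr u.rad)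
    + seminormSq θ 1 α u + |α| * θ ^ 3 * seminormSq θ 2 (α - 1) u)

/-! ### The Helmholtz projection -/

/-- The Mellin transform in the radius, `f̂(z, φ) = (2π)^{-1/2} ∫_0^∞ r^{-z} f(r, φ) dr / r`.
Mathlib's `mellin f s` is `∫_0^∞ r^{s-1} f(r) dr`. -/
def mellinHat (f : ℝ → ℝ → ℝ) (z : ℂ) (φ : ℝ) : ℂ :=
  (√(2 * π) : ℂ)⁻¹ * mellin (fun r => (f r φ : ℂ)) (-z)

/-- The inverse Mellin transform along the line `Re z = γ`,
`(2π)^{-1/2} ∫_{Re z = γ} r^z F(z, φ) d(Im z)`. -/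
def mellinHatInv (γ : ℝ) (F : ℂ → ℝ → ℂ) (r φ : ℝ) : ℂ :=
  (√(2 * π) : ℂ)⁻¹ *
    ∫ t : ℝ, (r : ℂ) ^ ((γ : ℂ) + (t : ℂ) * Complex.I) * F ((γ : ℂ) + (t : ℂ) * Complex.I) φ

/-- Green's function of `z² + ∂_φ²` on `(0, θ)` with Neumann boundary conditions. -/
def green (θ : ℝ) (φ s : ℝ) (z : ℂ) : ℂ :=
  if s < φ then
    Complex.cos (z * s) * Complex.cos (z * (θ - φ)) / (z * Complex.sin (z * θ))
  else
    Complex.cos (z * (θ - s)) * Complex.cos (z * φ) / (z * Complex.sin (z * θ))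

/-- The Mellin transform `Φ̂(z, φ)` of the potential of `w`, that is, the solution of
`(z² + ∂_φ²) Φ̂ = ĝ` on `(0, θ)` with `∂_φ Φ̂(z, φ) = ŵ_φ(z - 1, φ)` for `φ ∈ {0, θ}`, where
`ĝ(z, φ) = z ŵ_r(z - 1, φ) + ∂_φ ŵ_φ(z - 1, φ)`. -/
def potentialHat (θ : ℝ) (w : PolarField) (z : ℂ) (φ : ℝ) : ℂ :=
  mellinHat w.ang (z - 1) 0 / (z * Complex.sin (z * θ)) * Complex.cos (z * (θ - φ))
    - mellinHat w.ang (z - 1) θ / (z * Complex.sin (z * θ)) * Complex.cos (z * φ)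
    + ∫ s in (0 : ℝ)..θ, green θ φ s z *
        (z * mellinHat w.rad (z - 1) s + deriv (fun s' => mellinHat w.ang (z - 1) s') s)

/-- The gradient `∇Φ` of the potential of `w`: the inverse Mellin transform along `Re z = γ` of
`((z + 1) Φ̂(z + 1, φ), ∂_φ Φ̂(z + 1, φ))`. The two integrals are real, so that `.re` only
changes the type. -/
def potentialGrad (θ γ : ℝ) (w : PolarField) : PolarField :=
  ⟨fun r φ => (mellinHatInv γ (fun z s => (z + 1) * potentialHat θ w (z + 1) s) r φ).re,
   fun r φ => (mellinHatInv γ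
      (fun z s => deriv (fun s' => potentialHat θ w (z + 1) s') s) r φ).re⟩

/-- The Helmholtz projection `P w = w - ∇Φ`, computed along the line `Re z = γ`. -/
def helmholtz (θ γ : ℝ) (w : PolarField) : PolarField := w - potentialGrad θ γ w

/-- The commutator `[P, r^β] w = P (r^β w) - r^β P w`. -/
def commPow (θ γ β : ℝ) (w : PolarField) : PolarField :=
  helmholtz θ γ (powMul β w) - powMul β (helmholtz θ γ w)

/-- The commutator `[P, Δ] w = P Δ w - Δ P w`. -/
def commLaplace (θ γ : ℝ) (w : PolarField) : PolarField :=
  helmholtz θ γ (laplace w) - laplace (helmholtz θ γ w)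

/-! ### The bilinear forms -/

/-- The bilinear form `B₁(u, v)`. -/
def B1 (α θ γ : ℝ) (u v : PolarField) : ℝ :=
  intRays θ (fun r φ => r ^ (-2 * α) * v.rad r φ * u.rad r φ)
    + intWedge θ (fun r φ => r ^ (-2 * α) * v.gradDot u r φ)
    - 2 * α * intWedge θ (fun r φ => r ^ (-2 * α - 1) * v.dot u.partialR r φ)
    - intWedge θ (fun r φ => (r ^ 2)⁻¹ *
        dphi (fun r' φ' => dphi u.rad r' φ' * (commPow θ γ (-2 * α) v).rad r' φ') r φ)
    + intWedge θ (fun r φ => (commPow θ γ (-2 * α) v).gradDot u r φ)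

/-- The bilinear form `B₂(u, v)`. -/
def B2 (α θ γ : ℝ) (u v : PolarField) : ℝ :=
  intRays θ (fun r φ => r ^ (-2 * α) * rdr v.rad r φ *
      (rdr u.rad r φ + (-2 * α + 1) * u.rad r φ))
    + intWedge θ (fun r φ => r ^ (-2 * α) * v.eulerR.gradDot u.eulerR r φ)
    - 2 * α * intWedge θ (fun r φ => r ^ (-2 * α) * v.eulerR.gradDot u r φ)
    + 2 * α * intWedge θ (fun r φ => r ^ (-2 * α - 1) * v.eulerR.eulerR.dot u.partialR r φ)
    + intWedge θ (fun r φ => (r ^ 2)⁻¹ *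
        dphi (fun r' φ' => dphi u.rad r' φ' *
          (commPow θ γ (-2 * α) v.eulerR.eulerR).rad r' φ') r φ)
    - intWedge θ (fun r φ => (commPow θ γ (-2 * α) v.eulerR.eulerR).gradDot u r φ)

/-- The bilinear form `B₃(u, v)`. -/
def B3 (α θ γ : ℝ) (u v : PolarField) : ℝ :=
  intWedge θ (fun r φ => r ^ (-2 * α + 2) * u.laplace.dot v.laplace r φ)
    + intWedge θ (fun r φ => r ^ (-2 * α + 2) * (commLaplace θ γ u).dot v.laplace r φ)

/-- `B = B₁ + |α|θ³ B₂ + c₃|α|θ³ B₃` -/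
def B (c₃ α θ γ : ℝ) (u v : PolarField) : ℝ :=
  B1 α θ γ u v + |α| * θ ^ 3 * B2 α θ γ u v + c₃ * |α| * θ ^ 3 * B3 α θ γ u v

/-- The interval `I_ε = [-(1-ε)π/θ + 1, (1-ε)π/θ - 1]` of weights. -/
def weightInterval (ε θ : ℝ) : Set ℝ :=
  Icc (-((1 - ε) * (π / θ)) + 1) ((1 - ε) * (π / θ) - 1)

end Wedge

end

/-! ### Smooth functions with compact support away from the tip -/

noncomputable section

namespace Wedge

/-! For a test field the Helmholtz projection is the identity: solenoidality makes the source of its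
potential vanish (`IsTestField.mellinHat_dphi_ang`), tangentiality its Neumann data. Hence [P,
r^{-2α}]v is minus the gradient of the potential of r^{-2α}v, and [P, Δ]u is minus the gradient of
the potential of Δu. Integration by parts in the wedge combines the last two terms of B₁ and of B₂
to a pairing of such a gradient with Δu (`commPow_pairing`). By `B1_eq`, `B2_eq`, `B3_eq` the form B
is therefore a sum of weighted scalar products of derivatives of u and v, plus the error pairings
`powPair` and `lapPair`.

The errors are estimated on the Mellin side. The transformed potential solves Φ'' + z²Φ = g on (0,
θ) with Neumann data. Testing with the conjugate of Φ minus its mean, and using Wirtinger's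
inequality with the sharp constant (π/θ)², gives an energy estimate as long as |Re z| ≤ (1-δ)π/θ.
For r^{-2α}v the source collapses to -2α times the transform of v_r and has mean zero, so the
gradient has size |α|θ times v_r. For Δu the source vanishes and the Neumann data are -z times the
transform of ∂_φ u_r; a trace inequality with a free parameter bounds the gradient by a small
multiple of ∂_φ² u_r plus lower angular order. Cauchy's theorem (`integral_verticalLine_eq`) moves
the line of integration of P from γ to -α, respectively α - 2, where Plancherel's and Parseval's
identities convert these bounds into weighted norms. On both lines |Re z + 1| = |1 - α|, which the
weight interval bounds by (1-ε)π/θ, and α ∉ ℤ keeps the lines away from the singular point z = -1 of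
the symbols.

For coercivity put τ = |α|θ and μ = |α|θ³ = τθ². On the diagonal, B₁ provides u_r on the rays and
the first derivatives; μB₂ provides r∂_r u_r on the rays, (r∂_r)²u and r∂_r∂_φ u. Only ∂_φ² u is
missing, and B₃ supplies it because ∂_φ² u = r²Δu - (r∂_r)²u. Poincaré's inequality ‖u‖ ≤ (2/ε)θ‖∂_φ
u‖ turns the error in B₁ into √τ ‖∂_φ u‖ times √μ times second derivatives, and μθ⁻² = τ makes the
lower order part of `lapPair` small: this is why the weight is θ³. A small c₃ lets μB₂ absorb what
B₃ costs in (r∂_r)²u and r∂_r∂_φ u; then a small τ absorbs all other errors. Boundedness uses the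
same estimates together with the Cauchy-Schwarz inequality. -/

/-- Smooth functions of `(r, φ)` supported in an annulus `a ≤ r ≤ b` with `a > 0`. -/
structure Nice (f : ℝ → ℝ → ℝ) : Prop where
  smooth : ContDiff ℝ ∞ (fun p : ℝ × ℝ => f p.1 p.2)
  supp : ∃ a b : ℝ, 0 < a ∧ a ≤ b ∧ ∀ r φ : ℝ, r ∉ Icc a b → f r φ = 0

namespace Nice

variable {f g : ℝ → ℝ → ℝ}

theorem add (hf : Nice f) (hg : Nice g) : Nice (fun r φ => f r φ + g r φ) := by
  refine ⟨hf.smooth.add hg.smooth, ?_⟩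
  obtain ⟨a, b, ha, hab, h⟩ := hf.supp
  obtain ⟨c, d, hc, hcd, h'⟩ := hg.supp
  refine ⟨min a c, max b d, lt_min ha hc, ?_, fun r φ hr => ?_⟩
  · exact (min_le_left _ _).trans (hab.trans (le_max_left _ _))
  · rw [h r φ, h' r φ, add_zero]
    · exact fun hh => hr ⟨(min_le_right _ _).trans hh.1, hh.2.trans (le_max_right _ _)⟩
    · exact fun hh => hr ⟨(min_le_left _ _).trans hh.1, hh.2.trans (le_max_left _ _)⟩

/-- Multiplication by a function that is smooth on `r > 0`. -/
theorem smooth_mul (hf : Nice f) {m : ℝ → ℝ → ℝ}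
    (hm : ∀ p : ℝ × ℝ, 0 < p.1 → ContDiffAt ℝ ∞ (fun p : ℝ × ℝ => m p.1 p.2) p) :
    Nice (fun r φ => m r φ * f r φ) := by
  obtain ⟨a, b, ha, hab, h⟩ := hf.supp
  refine ⟨?_, a, b, ha, hab, fun r φ hr => by rw [h r φ hr, mul_zero]⟩
  rw [contDiff_iff_contDiffAt]
  intro p
  by_cases hp : 0 < p.1
  · exact (hm p hp).mul hf.smooth.contDiffAt
  -- For r ≤ 0 the product vanishes near p, so the factor m may be singular at r = 0, as negative
  -- powers and logarithms are.
  · have : (fun p : ℝ × ℝ => m p.1 p.2 * f p.1 p.2) =ᶠ[nhds p] fun _ => 0 := by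
      have : ∀ᶠ q : ℝ × ℝ in nhds p, q.1 < a :=
        continuous_fst.continuousAt.eventually_lt continuousAt_const (by linarith)
      filter_upwards [this] with q hq
      rw [h q.1 q.2 (fun hh => absurd hh.1 (not_le.2 hq)), mul_zero]
    exact contDiffAt_const.congr_of_eventuallyEq this

theorem const_mul (hf : Nice f) (c : ℝ) : Nice (fun r φ => c * f r φ) :=
  hf.smooth_mul (m := fun _ _ => c) fun _ _ => contDiffAt_const

theorem neg (hf : Nice f) : Nice (fun r φ => - f r φ) := by
  simpa using hf.const_mul (-1)

theorem sub (hf : Nice f) (hg : Nice g) : Nice (fun r φ => f r φ - g r φ) := by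
  simpa [sub_eq_add_neg] using hf.add hg.neg

theorem mul (hf : Nice f) (hg : Nice g) : Nice (fun r φ => f r φ * g r φ) :=
  hg.smooth_mul fun _ _ => hf.smooth.contDiffAt

theorem rpow_mul (hf : Nice f) (β : ℝ) : Nice (fun r φ => r ^ β * f r φ) :=
  hf.smooth_mul (m := fun r _ => r ^ β) fun _ hp =>
    contDiffAt_fst.rpow_const_of_ne hp.ne'

theorem inv_sq_mul (hf : Nice f) : Nice (fun r φ => (r ^ 2)⁻¹ * f r φ) :=
  hf.smooth_mul (m := fun r _ => (r ^ 2)⁻¹) fun _ hp =>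
    (contDiffAt_fst.pow 2).inv (pow_ne_zero 2 hp.ne')

theorem log_mul (hf : Nice f) : Nice (fun r φ => Real.log r * f r φ) :=
  hf.smooth_mul (m := fun r _ => Real.log r) fun _ hp => contDiffAt_fst.log hp.ne'

theorem differentiableAt (hf : Nice f) (p : ℝ × ℝ) :
    DifferentiableAt ℝ (fun p : ℝ × ℝ => f p.1 p.2) p :=
  hf.smooth.differentiable (by simp) p

theorem hasDerivAt_fst (hf : Nice f) (r φ : ℝ) : HasDerivAt (fun s => f s φ)
    (fderiv ℝ (fun p : ℝ × ℝ => f p.1 p.2) (r, φ) (1, 0)) r :=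
  (hf.differentiableAt (r, φ)).hasFDerivAt.comp_hasDerivAt (f := fun s : ℝ => (s, φ)) r
    ((hasDerivAt_id r).prodMk (hasDerivAt_const r φ))

theorem hasDerivAt_snd (hf : Nice f) (r φ : ℝ) : HasDerivAt (fun s => f r s)
    (fderiv ℝ (fun p : ℝ × ℝ => f p.1 p.2) (r, φ) (0, 1)) φ :=
  (hf.differentiableAt (r, φ)).hasFDerivAt.comp_hasDerivAt (f := fun s : ℝ => (r, s)) φ
    ((hasDerivAt_const φ r).prodMk (hasDerivAt_id φ))

theorem dr_eq (hf : Nice f) (r φ : ℝ) :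
    dr f r φ = fderiv ℝ (fun p : ℝ × ℝ => f p.1 p.2) (r, φ) (1, 0) :=
  (hf.hasDerivAt_fst r φ).deriv

theorem dphi_eq (hf : Nice f) (r φ : ℝ) :
    dphi f r φ = fderiv ℝ (fun p : ℝ × ℝ => f p.1 p.2) (r, φ) (0, 1) :=
  (hf.hasDerivAt_snd r φ).deriv

theorem hasDerivAt_dr (hf : Nice f) (r φ : ℝ) : HasDerivAt (fun s => f s φ) (dr f r φ) r :=
  hf.dr_eq r φ ▸ hf.hasDerivAt_fst r φ

theorem hasDerivAt_dphi (hf : Nice f) (r φ : ℝ) : HasDerivAt (fun s => f r s) (dphi f r φ) φ :=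
  hf.dphi_eq r φ ▸ hf.hasDerivAt_snd r φ

theorem dr (hf : Nice f) : Nice (Wedge.dr f) := by
  refine ⟨?_, ?_⟩
  · have : (fun p : ℝ × ℝ => Wedge.dr f p.1 p.2)
        = fun p => fderiv ℝ (fun p : ℝ × ℝ => f p.1 p.2) p (1, 0) := by
      ext p; exact hf.dr_eq p.1 p.2
    rw [this]
    exact (hf.smooth.fderiv_right (m := ∞) (by simp)).clm_apply contDiff_const
  · obtain ⟨a, b, ha, hab, h⟩ := hf.supp
    refine ⟨a, b, ha, hab, fun r φ hr => ?_⟩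
    have : (fun s => f s φ) =ᶠ[nhds r] fun _ => 0 := by
      filter_upwards [isClosed_Icc.isOpen_compl.mem_nhds hr] with s hs using h s φ hs
    simp [Wedge.dr, this.deriv_eq]

theorem dphi (hf : Nice f) : Nice (Wedge.dphi f) := by
  refine ⟨?_, ?_⟩
  · have : (fun p : ℝ × ℝ => Wedge.dphi f p.1 p.2)
        = fun p => fderiv ℝ (fun p : ℝ × ℝ => f p.1 p.2) p (0, 1) := by
      ext p; exact hf.dphi_eq p.1 p.2
    rw [this]
    exact (hf.smooth.fderiv_right (m := ∞) (by simp)).clm_apply contDiff_const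
  · obtain ⟨a, b, ha, hab, h⟩ := hf.supp
    refine ⟨a, b, ha, hab, fun r φ hr => ?_⟩
    have : (fun s => f r s) = fun _ => 0 := funext fun s => h r s hr
    simp [Wedge.dphi, this]

theorem rdr (hf : Nice f) : Nice (Wedge.rdr f) :=
  hf.dr.smooth_mul (m := fun r _ => r) fun _ _ => contDiffAt_fst

/-- The partial derivatives commute. -/
theorem dphi_rdr (hf : Nice f) : Wedge.dphi (Wedge.rdr f) = Wedge.rdr (Wedge.dphi f) := by
  ext r φ
  set F : ℝ × ℝ → ℝ := fun p => f p.1 p.2 with hF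
  have hD : DifferentiableAt ℝ (fderiv ℝ F) (r, φ) :=
    (hf.smooth.fderiv_right (m := ∞) (by simp)).differentiable (by simp) _
  have hsymm : fderiv ℝ (fderiv ℝ F) (r, φ) (0, 1) (1, 0)
      = fderiv ℝ (fderiv ℝ F) (r, φ) (1, 0) (0, 1) :=
    (hf.smooth.contDiffAt.isSymmSndFDerivAt (by simpa using WithTop.coe_le_coe.2 (le_top : (2 : ℕ∞) ≤ ⊤))) _ _
  have h1 : Wedge.dphi (Wedge.dr f) r φ = fderiv ℝ (fderiv ℝ F) (r, φ) (0, 1) (1, 0) := by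
    rw [hf.dr.dphi_eq]
    have : (fun p : ℝ × ℝ => Wedge.dr f p.1 p.2) = fun p => fderiv ℝ F p (1, 0) := by
      ext p; exact hf.dr_eq p.1 p.2
    rw [this, fderiv_clm_apply hD (differentiableAt_const _)]
    simp
  have h2 : Wedge.dr (Wedge.dphi f) r φ = fderiv ℝ (fderiv ℝ F) (r, φ) (1, 0) (0, 1) := by
    rw [hf.dphi.dr_eq]
    have : (fun p : ℝ × ℝ => Wedge.dphi f p.1 p.2) = fun p => fderiv ℝ F p (0, 1) := by
      ext p; exact hf.dphi_eq p.1 p.2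
    rw [this, fderiv_clm_apply hD (differentiableAt_const _)]
    simp
  have h3 : Wedge.dphi (Wedge.rdr f) r φ = r * Wedge.dphi (Wedge.dr f) r φ :=
    ((hf.dr.hasDerivAt_dphi r φ).const_mul r).deriv
  rw [h3, h1, hsymm, ← h2]; rfl

theorem continuous (hf : Nice f) : Continuous (fun p : ℝ × ℝ => f p.1 p.2) := hf.smooth.continuous

/-- In logarithmic coordinates the support is bounded. -/
theorem exists_log_support (hf : Nice f) :
    ∃ R : ℝ, 0 < R ∧ ∀ x φ : ℝ, R < |x| → f (Real.exp x) φ = 0 := by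
  obtain ⟨a, b, ha, hab, h⟩ := hf.supp
  refine ⟨|Real.log a| + |Real.log b| + 1, by positivity, fun x φ hx => h _ _ fun hh => ?_⟩
  have h1 : Real.log a ≤ x := (Real.log_le_iff_le_exp ha).2 hh.1
  have h2 : x ≤ Real.log b := (Real.le_log_iff_exp_le (ha.trans_le hab)).2 hh.2
  have := abs_le.2 ⟨(show -(|Real.log a| + |Real.log b| + 1) ≤ x by
    linarith [neg_abs_le (Real.log a), abs_nonneg (Real.log b)]),
    (show x ≤ |Real.log a| + |Real.log b| + 1 by
    linarith [le_abs_self (Real.log b), abs_nonneg (Real.log a)])⟩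
  linarith

end Nice

end Wedge

end

/-! ### The Mellin transform of smooth compactly supported functions -/

noncomputable section

namespace Wedge

/-- Differentiation under an integral over a compact interval. -/
theorem hasDerivAt_intervalIntegral_param {𝕜 : Type*} [RCLike 𝕜] {E : Type*}
    [NormedAddCommGroup E] [NormedSpace ℝ E] [NormedSpace 𝕜 E] [CompleteSpace E]
    {G G' : 𝕜 → ℝ → E} (a b : ℝ)
    (hG : Continuous fun p : 𝕜 × ℝ => G p.1 p.2) (hG' : Continuous fun p : 𝕜 × ℝ => G' p.1 p.2)
    (hd : ∀ z s, HasDerivAt (fun z => G z s) (G' z s) z) (z₀ : 𝕜) :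
    HasDerivAt (fun z => ∫ s in a..b, G z s) (∫ s in a..b, G' z₀ s) z₀ := by
  obtain ⟨C, hC⟩ := ((isCompact_closedBall z₀ (1 : ℝ)).prod
    (isCompact_uIcc (a := a) (b := b))).exists_bound_of_continuousOn hG'.continuousOn
  have hcont : ∀ z, Continuous fun s => G z s := fun z =>
    hG.comp (f := fun s : ℝ => (z, s)) (by fun_prop)
  have hcont' : ∀ z, Continuous fun s => G' z s := fun z =>
    hG'.comp (f := fun s : ℝ => (z, s)) (by fun_prop)
  refine (intervalIntegral.hasDerivAt_integral_of_dominated_loc_of_deriv_le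
    (F := G) (F' := G') (x₀ := z₀) (s := Metric.ball z₀ 1)
    (bound := fun _ => C) (Metric.ball_mem_nhds z₀ one_pos) ?_ ?_ ?_ ?_ ?_ ?_).2
  · exact Filter.Eventually.of_forall fun z => (hcont z).aestronglyMeasurable
  · exact (hcont z₀).intervalIntegrable _ _
  · exact (hcont' z₀).aestronglyMeasurable
  · refine Filter.Eventually.of_forall fun s hs z hz => hC (z, s) ⟨?_, uIoc_subset_uIcc hs⟩
    exact Metric.ball_subset_closedBall hz
  · exact intervalIntegrable_const
  · exact Filter.Eventually.of_forall fun s _ z _ => hd z s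

/-- The substitution r = eˣ. It turns the Mellin transform into a two-sided Laplace transform on ℝ,
where compact support and Fourier theory apply directly. -/
theorem integral_Ioi_eq_integral_exp {E : Type*} [NormedAddCommGroup E] [NormedSpace ℝ E]
    (h : ℝ → E) : ∫ r in Ioi (0 : ℝ), h r = ∫ x : ℝ, Real.exp x • h (Real.exp x) := by
  have := integral_image_eq_integral_abs_deriv_smul (s := univ) (f := Real.exp) (f' := Real.exp)
    MeasurableSet.univ (fun x _ => (Real.hasDerivAt_exp x).hasDerivWithinAt)
    Real.exp_injective.injOn h
  simpa [Real.range_exp, abs_of_pos (Real.exp_pos _)] using this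

theorem mellinHat_eq_integral (f : ℝ → ℝ → ℝ) (z : ℂ) (φ : ℝ) :
    mellinHat f z φ = (√(2 * π) : ℂ)⁻¹ *
      ∫ x : ℝ, Complex.exp (-z * x) * (f (Real.exp x) φ : ℂ) := by
  unfold mellinHat mellin
  rw [integral_Ioi_eq_integral_exp]
  congr 2
  ext x
  have h0 : (Real.exp x : ℂ) ≠ 0 := by exact_mod_cast (Real.exp_pos x).ne'
  have : (Real.exp x : ℂ) * (Real.exp x : ℂ) ^ (-z - 1) = Complex.exp (-z * x) := by
    conv_lhs => enter [1]; rw [← Complex.cpow_one (Real.exp x : ℂ)]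
    rw [← Complex.cpow_add _ _ h0, Complex.cpow_def_of_ne_zero h0, ← Complex.ofReal_log
      (Real.exp_pos x).le, Real.log_exp]
    ring_nf
  rw [← this, smul_eq_mul, Complex.real_smul, mul_assoc]

namespace Nice

variable {f g : ℝ → ℝ → ℝ}

theorem continuous_mellin_integrand (hf : Nice f) :
    Continuous fun p : (ℂ × ℝ) × ℝ =>
      Complex.exp (-p.1.1 * p.2) * (f (Real.exp p.2) p.1.2 : ℂ) := by
  have : Continuous fun p : (ℂ × ℝ) × ℝ => f (Real.exp p.2) p.1.2 :=
    hf.continuous.comp (f := fun p : (ℂ × ℝ) × ℝ => (Real.exp p.2, p.1.2)) (by fun_prop)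
  exact Continuous.mul (by fun_prop) (Complex.continuous_ofReal.comp this)

theorem integral_eq_interval {E : Type*} [NormedAddCommGroup E] [NormedSpace ℝ E] {F : ℝ → E}
    {R : ℝ} (hR : 0 < R) (h : ∀ x, R < |x| → F x = 0) : ∫ x, F x = ∫ x in (-R)..R, F x := by
  rw [intervalIntegral.integral_of_le (by linarith), ← integral_Icc_eq_integral_Ioc]
  refine (setIntegral_eq_integral_of_forall_compl_eq_zero fun x hx => h x ?_).symm
  by_contra hh
  exact hx (abs_le.1 (not_lt.1 hh))

theorem exists_mellinHat_eq_interval (hf : Nice f) : ∃ R : ℝ, 0 < R ∧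
    (∀ x φ : ℝ, R < |x| → f (Real.exp x) φ = 0) ∧ ∀ z φ, mellinHat f z φ = (√(2 * π) : ℂ)⁻¹ *
      ∫ x in (-R)..R, Complex.exp (-z * x) * (f (Real.exp x) φ : ℂ) := by
  obtain ⟨R, hR, h⟩ := hf.exists_log_support
  refine ⟨R, hR, h, fun z φ => ?_⟩
  rw [mellinHat_eq_integral, integral_eq_interval hR]
  intro x hx
  simp [h x φ hx]

theorem continuous_mellinHat (hf : Nice f) :
    Continuous fun p : ℂ × ℝ => mellinHat f p.1 p.2 := by
  obtain ⟨R, -, -, h⟩ := hf.exists_mellinHat_eq_interval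
  simp_rw [h]
  refine continuous_const.mul ?_
  exact intervalIntegral.continuous_parametric_intervalIntegral_of_continuous'
    (f := fun (p : ℂ × ℝ) x => Complex.exp (-p.1 * x) * (f (Real.exp x) p.2 : ℂ))
    hf.continuous_mellin_integrand _ _

theorem integrable_mellin (hf : Nice f) (z : ℂ) (φ : ℝ) :
    Integrable fun x : ℝ => Complex.exp (-z * x) * (f (Real.exp x) φ : ℂ) := by
  obtain ⟨R, hR, h⟩ := hf.exists_log_support
  refine Continuous.integrable_of_hasCompactSupport ?_ ?_
  · exact hf.continuous_mellin_integrand.comp (f := fun x : ℝ => ((z, φ), x)) (by fun_prop)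
  · refine HasCompactSupport.intro (isCompact_Icc (a := -R) (b := R)) fun x hx => ?_
    have : R < |x| := by
      by_contra hh
      exact hx (abs_le.1 (not_lt.1 hh))
    simp [h x φ this]

theorem mellinHat_add (hf : Nice f) (hg : Nice g) (z : ℂ) (φ : ℝ) :
    mellinHat (fun r φ => f r φ + g r φ) z φ = mellinHat f z φ + mellinHat g z φ := by
  simp_rw [mellinHat_eq_integral]
  rw [← mul_add, ← integral_add (hf.integrable_mellin z φ) (hg.integrable_mellin z φ)]
  congr 2; ext x; push_cast; ring

theorem hasDerivAt_mellinHat_snd (hf : Nice f) (z : ℂ) (φ : ℝ) :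
    HasDerivAt (fun s => mellinHat f z s) (mellinHat (Wedge.dphi f) z φ) φ := by
  obtain ⟨R, hR, h⟩ := hf.exists_log_support
  obtain ⟨R', hR', h'⟩ := hf.dphi.exists_log_support
  have e : ∀ s, mellinHat f z s = (√(2 * π) : ℂ)⁻¹ *
      ∫ x in (-(max R R'))..(max R R'), Complex.exp (-z * x) * (f (Real.exp x) s : ℂ) := by
    intro s
    rw [mellinHat_eq_integral, integral_eq_interval (lt_max_of_lt_left hR)]
    intro x hx
    simp [h x s ((le_max_left _ _).trans_lt hx)]
  have e' : mellinHat (Wedge.dphi f) z φ = (√(2 * π) : ℂ)⁻¹ *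
      ∫ x in (-(max R R'))..(max R R'),
        Complex.exp (-z * x) * (Wedge.dphi f (Real.exp x) φ : ℂ) := by
    rw [mellinHat_eq_integral, integral_eq_interval (lt_max_of_lt_left hR)]
    intro x hx
    simp [h' x φ ((le_max_right _ _).trans_lt hx)]
  simp_rw [e, e']
  refine (hasDerivAt_intervalIntegral_param (𝕜 := ℝ)
    (G := fun s x => Complex.exp (-z * x) * (f (Real.exp x) s : ℂ))
    (G' := fun s x => Complex.exp (-z * x) * (Wedge.dphi f (Real.exp x) s : ℂ)) _ _
    ?_ ?_ ?_ φ).const_mul _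
  · exact hf.continuous_mellin_integrand.comp
      (f := fun p : ℝ × ℝ => ((z, p.1), p.2)) (by fun_prop)
  · exact hf.dphi.continuous_mellin_integrand.comp
      (f := fun p : ℝ × ℝ => ((z, p.1), p.2)) (by fun_prop)
  · exact fun s x => ((hf.hasDerivAt_dphi (Real.exp x) s).ofReal_comp).const_mul _

/-- Differentiating r^{-z} in z produces -log r, and log r is smooth on the support of f. This is
the holomorphy on which the shift of the line of integration rests. -/
theorem hasDerivAt_mellinHat_fst (hf : Nice f) (z : ℂ) (φ : ℝ) :
    HasDerivAt (fun z => mellinHat f z φ)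
      (-mellinHat (fun r φ => Real.log r * f r φ) z φ) z := by
  obtain ⟨R, hR, h⟩ := hf.exists_log_support
  have e : ∀ z, mellinHat f z φ = (√(2 * π) : ℂ)⁻¹ *
      ∫ x in (-R)..R, Complex.exp (-z * x) * (f (Real.exp x) φ : ℂ) := by
    intro z
    rw [mellinHat_eq_integral, integral_eq_interval hR]
    intro x hx
    simp [h x φ hx]
  have e' : -mellinHat (fun r φ => Real.log r * f r φ) z φ = (√(2 * π) : ℂ)⁻¹ *
      ∫ x in (-R)..R, (Complex.exp (-z * x) * -x) * (f (Real.exp x) φ : ℂ) := by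
    rw [mellinHat_eq_integral, integral_eq_interval hR, ← mul_neg,
      ← intervalIntegral.integral_neg]
    · congr 2; ext x; simp; ring
    · intro x hx
      simp [h x φ hx]
  simp_rw [e, e']
  have hcF : Continuous fun p : ℂ × ℝ => f (Real.exp p.2) φ :=
    hf.continuous.comp (f := fun p : ℂ × ℝ => (Real.exp p.2, φ)) (by fun_prop)
  refine (hasDerivAt_intervalIntegral_param (𝕜 := ℂ)
    (G := fun z x => Complex.exp (-z * x) * (f (Real.exp x) φ : ℂ))
    (G' := fun z x => (Complex.exp (-z * x) * -x) * (f (Real.exp x) φ : ℂ)) _ _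
    ?_ ?_ ?_ z).const_mul _
  · exact Continuous.mul (by fun_prop) (Complex.continuous_ofReal.comp hcF)
  · exact Continuous.mul (by fun_prop) (Complex.continuous_ofReal.comp hcF)
  · intro z x
    have : HasDerivAt (fun z : ℂ => -z * x) (-x) z := by
      simpa using ((hasDerivAt_id z).neg).mul_const (x : ℂ)
    exact this.cexp.mul_const _

/-- Integration by parts in x = log r; compact support leaves no boundary terms. Each r∂_r is thus
worth one power of z. -/
theorem mellinHat_rdr (hf : Nice f) (z : ℂ) (φ : ℝ) :
    mellinHat (Wedge.rdr f) z φ = z * mellinHat f z φ := by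
  simp_rw [mellinHat_eq_integral]
  rw [mul_left_comm]
  congr 1
  have hd : ∀ x : ℝ, HasDerivAt (fun x : ℝ => Complex.exp (-z * x) * (f (Real.exp x) φ : ℂ))
      (-(z * (Complex.exp (-z * x) * (f (Real.exp x) φ : ℂ)))
        + Complex.exp (-z * x) * (Wedge.rdr f (Real.exp x) φ : ℂ)) x := by
    intro x
    have h1 : HasDerivAt (fun x : ℝ => Complex.exp (-z * x)) (Complex.exp (-z * x) * -z) x := by
      have : HasDerivAt (fun x : ℂ => Complex.exp (-z * x)) (Complex.exp (-z * x) * -z) x := by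
        simpa using (((hasDerivAt_id (x : ℂ)).const_mul (-z))).cexp
      exact this.comp_ofReal
    have h2 : HasDerivAt (fun x : ℝ => (f (Real.exp x) φ : ℂ))
        (Wedge.rdr f (Real.exp x) φ : ℂ) x := by
      have := ((hf.hasDerivAt_dr (Real.exp x) φ).comp x (Real.hasDerivAt_exp x)).ofReal_comp
      simpa [Wedge.rdr, mul_comm] using this
    refine (h1.mul h2).congr_deriv ?_
    ring
  have hi := integral_eq_zero_of_hasDerivAt_of_integrable hd
    (((hf.integrable_mellin z φ).const_mul z).neg.add (hf.rdr.integrable_mellin z φ))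
    (hf.integrable_mellin z φ)
  have hi' := integral_add ((hf.integrable_mellin z φ).const_mul z).neg
    (hf.rdr.integrable_mellin z φ)
  simp only [Pi.neg_apply] at hi'
  rw [hi', integral_neg, MeasureTheory.integral_const_mul] at hi
  linear_combination hi

theorem mellinHat_congr {z : ℂ} {φ : ℝ} (h : ∀ r, 0 < r → f r φ = g r φ) :
    mellinHat f z φ = mellinHat g z φ := by
  simp_rw [mellinHat_eq_integral, h _ (Real.exp_pos _)]

theorem mellinHat_const_mul (c : ℝ) (f : ℝ → ℝ → ℝ) (z : ℂ) (φ : ℝ) :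
    mellinHat (fun r φ => c * f r φ) z φ = c * mellinHat f z φ := by
  simp_rw [mellinHat_eq_integral]
  rw [mul_left_comm, ← MeasureTheory.integral_const_mul (c : ℂ)]
  refine congrArg _ (integral_congr_ae (Filter.Eventually.of_forall fun x => ?_))
  push_cast; ring

theorem mellinHat_sub (hf : Nice f) (hg : Nice g) (z : ℂ) (φ : ℝ) :
    mellinHat (fun r φ => f r φ - g r φ) z φ = mellinHat f z φ - mellinHat g z φ := by
  simp_rw [mellinHat_eq_integral]
  rw [← mul_sub, ← integral_sub (hf.integrable_mellin z φ) (hg.integrable_mellin z φ)]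
  congr 2; ext x; push_cast; ring

theorem mellinHat_rpow_mul (β : ℝ) (f : ℝ → ℝ → ℝ) (z : ℂ) (φ : ℝ) :
    mellinHat (fun r φ => r ^ β * f r φ) z φ = mellinHat f (z - β) φ := by
  simp_rw [mellinHat_eq_integral]
  congr 2; ext x
  rw [← Real.exp_mul]
  push_cast
  rw [← mul_assoc, ← Complex.exp_add]
  ring_nf

theorem mellinHat_inv_sq_mul (f : ℝ → ℝ → ℝ) (z : ℂ) (φ : ℝ) :
    mellinHat (fun r φ => (r ^ 2)⁻¹ * f r φ) z φ = mellinHat f (z + 2) φ := by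
  have := mellinHat_rpow_mul (-2) f z φ
  rw [← mellinHat_congr (f := fun r φ => r ^ (-2 : ℝ) * f r φ), this]
  · push_cast; ring_nf
  · intro r hr
    rw [Real.rpow_neg hr.le, Real.rpow_two]

/-- Holds because f is real-valued; it identifies the conjugated factor in Parseval's identity. -/
theorem mellinHat_conj (f : ℝ → ℝ → ℝ) (z : ℂ) (φ : ℝ) :
    mellinHat f ((starRingEnd ℂ) z) φ = (starRingEnd ℂ) (mellinHat f z φ) := by
  simp_rw [mellinHat_eq_integral]
  rw [map_mul, ← integral_conj]
  congr 1
  · simp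
  · congr 1; ext x
    rw [map_mul, ← Complex.exp_conj]
    simp

/-- Mellin transforms of smooth compactly supported functions decay rapidly along vertical
strips. -/
theorem mellinHat_decay (hf : Nice f) (ρ θ : ℝ) (N : ℕ) : ∃ C : ℝ, 0 ≤ C ∧
    ∀ z : ℂ, |z.re| ≤ ρ → ∀ φ ∈ Icc 0 θ, ‖mellinHat f z φ‖ * (1 + ‖z‖) ^ N ≤ C := by
  induction N generalizing f with
  | zero =>
    obtain ⟨R, hR, hs, h⟩ := hf.exists_mellinHat_eq_interval
    have hcF : Continuous fun p : ℝ × ℝ => f (Real.exp p.1) p.2 :=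
      hf.continuous.comp (f := fun p : ℝ × ℝ => (Real.exp p.1, p.2)) (by fun_prop)
    obtain ⟨M, hM⟩ := ((isCompact_uIcc (a := -R) (b := R)).prod
      (isCompact_Icc (a := 0) (b := θ))).exists_bound_of_continuousOn hcF.continuousOn
    refine ⟨‖(√(2 * π) : ℂ)⁻¹‖ * (Real.exp (ρ * R) * |M| * |R - -R|), by positivity, ?_⟩
    intro z hz φ hφ
    rw [pow_zero, mul_one, h, norm_mul]
    gcongr
    refine intervalIntegral.norm_integral_le_of_norm_le_const fun x hx => ?_
    have hx' : |x| ≤ R := by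
      rw [uIoc_of_le (by linarith)] at hx
      exact abs_le.2 ⟨hx.1.le, hx.2⟩
    have h1 := hM (x, φ) ⟨uIoc_subset_uIcc hx, hφ⟩
    rw [norm_mul, Complex.norm_exp, Complex.norm_real]
    have h2 : (-z * (x : ℂ)).re ≤ ρ * R := by
      have : (-z * (x : ℂ)).re = -(z.re * x) := by simp
      rw [this]
      calc -(z.re * x) ≤ |z.re * x| := neg_le_abs _
        _ = |z.re| * |x| := abs_mul _ _
        _ ≤ ρ * R := by gcongr; exact (abs_nonneg _).trans hz
    gcongr
    exact h1.trans (le_abs_self M)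
  | succ N ih =>
    -- One more power of 1 + |z| is paid for by one r∂_r, since `rdr f` has transform z times that
    -- of f and is again `Nice`.
    obtain ⟨C, hC, h⟩ := ih hf
    obtain ⟨C', hC', h'⟩ := ih hf.rdr
    refine ⟨C + C', by positivity, fun z hz φ hφ => ?_⟩
    have h1 := h z hz φ hφ
    have h2 := h' z hz φ hφ
    rw [hf.mellinHat_rdr, norm_mul] at h2
    calc _ = ‖mellinHat f z φ‖ * (1 + ‖z‖) ^ N + ‖z‖ * ‖mellinHat f z φ‖ * (1 + ‖z‖) ^ N := by ring
      _ ≤ _ := add_le_add h1 h2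

end Nice

end Wedge

end

/-! ### Shifting the line of integration; Plancherel's identity -/

noncomputable section

namespace Wedge

/-- The lines of integration of a function that is holomorphic in a vertical strip, except
possibly for the origin, may be shifted. -/
theorem integral_verticalLine_eq {F : ℂ → ℂ} {ρ C : ℝ}
    (hF : ∀ z : ℂ, |z.re| < ρ → z ≠ 0 → DifferentiableAt ℂ F z)
    (hb : ∀ z : ℂ, |z.re| < ρ → z ≠ 0 → ‖F z‖ ≤ C * (1 + z.im ^ 2)⁻¹)
    {a b : ℝ} (ha : |a| < ρ) (hb' : |b| < ρ) :
    ∫ t : ℝ, F (a + t * Complex.I) = ∫ t : ℝ, F (b + t * Complex.I) := by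
  have hρ : 0 < ρ := (abs_nonneg a).trans_lt ha
  set S : Set ℂ := {z | |z.re| < ρ} with hS
  have hSo : IsOpen S := isOpen_lt (by fun_prop) continuous_const
  have hS0 : S ∈ nhds (0 : ℂ) := hSo.mem_nhds (by simpa [hS] using hρ)
  have hdiff : DifferentiableOn ℂ F (S \ {0}) := fun z hz =>
    (hF z hz.1 hz.2).differentiableWithinAt
  have hbdd : BddAbove (norm ∘ F '' (S \ {0})) := by
    refine ⟨|C|, ?_⟩
    rintro _ ⟨z, hz, rfl⟩
    refine (hb z hz.1 hz.2).trans ?_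
    calc C * (1 + z.im ^ 2)⁻¹ ≤ |C| * 1 := by
          gcongr
          · exact le_abs_self C
          · exact inv_le_one_of_one_le₀ (by nlinarith [sq_nonneg z.im])
      _ = |C| := mul_one _
  -- F is bounded near 0, so the singularity is removable. The extension G differs from F at one
  -- point at most, which no line integral sees.
  have hG := Complex.differentiableOn_update_limUnder_of_bddAbove hS0 hdiff hbdd
  set G := Function.update F 0 ((nhdsWithin 0 {0}ᶜ).limUnder F) with hGdef
  have hGF : ∀ z, z ≠ 0 → G z = F z := fun z hz => Function.update_of_ne hz _ _
  have hline : ∀ c : ℝ, ∫ t : ℝ, F (c + t * Complex.I) = ∫ t : ℝ, G (c + t * Complex.I) := by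
    intro c
    refine integral_congr_ae ?_
    have : ({0} : Set ℝ)ᶜ ∈ ae (volume : Measure ℝ) := by
      rw [mem_ae_iff, compl_compl]; exact measure_singleton 0
    filter_upwards [this] with t ht
    refine (hGF _ fun h0 => ht ?_).symm
    simpa using congrArg Complex.im h0
  have hGint : ∀ c : ℝ, |c| < ρ → Integrable fun t : ℝ => G (c + t * Complex.I) := by
    intro c hc
    have hcont : Continuous fun t : ℝ => G (c + t * Complex.I) :=
      hG.continuousOn.comp_continuous (f := fun t : ℝ => (c + t * Complex.I : ℂ)) (by fun_prop)
        (fun t => by simpa [hS] using hc)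
    refine Integrable.mono' ((integrable_inv_one_add_sq).const_mul C)
      hcont.aestronglyMeasurable ?_
    have : ({0} : Set ℝ)ᶜ ∈ ae (volume : Measure ℝ) := by
      rw [mem_ae_iff, compl_compl]; exact measure_singleton 0
    filter_upwards [this] with t ht
    have h0 : (c + t * Complex.I : ℂ) ≠ 0 := fun h0 => ht (by simpa using congrArg Complex.im h0)
    rw [hGF _ h0]
    simpa using hb _ (by simpa using hc) h0
  rw [hline a, hline b]
  have hrect : ∀ T : ℝ, (∫ x in a..b, G (x + (-T : ℝ) * Complex.I))
      - (∫ x in a..b, G (x + (T : ℝ) * Complex.I))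
      + Complex.I • (∫ t in (-T)..T, G (b + t * Complex.I))
      - Complex.I • (∫ t in (-T)..T, G (a + t * Complex.I)) = 0 := by
    intro T
    have := Complex.integral_boundary_rect_eq_zero_of_differentiableOn G
      (a + (-T : ℝ) * Complex.I) (b + T * Complex.I) ?_
    · simpa using this
    · refine hG.mono fun z hz => ?_
      have h1 : z.re ∈ uIcc a b := by simpa using hz.1
      have h2 : uIcc a b ⊆ Ioo (-ρ) ρ :=
        (ordConnected_Ioo).uIcc_subset (abs_lt.1 ha) (abs_lt.1 hb')
      exact abs_lt.2 (h2 h1)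
  have hlim : ∀ c : ℝ, |c| < ρ → Filter.Tendsto (fun T : ℝ => ∫ t in (-T)..T,
      G (c + t * Complex.I)) Filter.atTop (nhds (∫ t : ℝ, G (c + t * Complex.I))) := fun c hc =>
    intervalIntegral_tendsto_integral (hGint c hc) Filter.tendsto_neg_atTop_atBot
      Filter.tendsto_id
  -- The horizontal sides of the rectangle, with s = 1 and s = -1 treated at once; the quadratic
  -- decay makes them vanish as T → ∞.
  have hhor : ∀ s : ℝ, s ^ 2 = 1 → Filter.Tendsto (fun T : ℝ => ∫ x in a..b,
      G (x + (s * T : ℝ) * Complex.I)) Filter.atTop (nhds 0) := by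
    intro s hs
    have hbound : ∀ᶠ T : ℝ in Filter.atTop, ‖∫ x in a..b, G (x + (s * T : ℝ) * Complex.I)‖
        ≤ C * (1 + T ^ 2)⁻¹ * |b - a| := by
      filter_upwards [Filter.eventually_gt_atTop 0] with T hT
      refine intervalIntegral.norm_integral_le_of_norm_le_const fun x hx => ?_
      have h2 : x ∈ Ioo (-ρ) ρ :=
        ((ordConnected_Ioo).uIcc_subset (abs_lt.1 ha) (abs_lt.1 hb')) (uIoc_subset_uIcc hx)
      have hs0 : s ≠ 0 := by rintro rfl; norm_num at hs
      have h0 : (x + (s * T : ℝ) * Complex.I : ℂ) ≠ 0 := fun h0 => by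
        have := congrArg Complex.im h0
        simp [hs0, hT.ne'] at this
      rw [hGF _ h0]
      have := hb _ (by simpa using abs_lt.2 h2) h0
      simpa [mul_pow, hs] using this
    refine squeeze_zero_norm' hbound ?_
    have : Filter.Tendsto (fun T : ℝ => (1 + T ^ 2)⁻¹) Filter.atTop (nhds 0) :=
      (Filter.tendsto_atTop_add_const_left _ _ (Filter.tendsto_pow_atTop two_ne_zero)).inv_tendsto_atTop
    simpa using (this.const_mul C).mul_const |b - a|
  have h1 := hhor (-1) (by norm_num)
  have h2 := hhor 1 (by norm_num)
  have key := ((h1.sub h2).add ((hlim b hb').const_smul Complex.I)).sub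
    ((hlim a ha).const_smul Complex.I)
  have hz : (fun T : ℝ => ((∫ x in a..b, G (x + (-1 * T : ℝ) * Complex.I))
      - (∫ x in a..b, G (x + (1 * T : ℝ) * Complex.I)))
      + Complex.I • (∫ t in (-T)..T, G (b + t * Complex.I))
      - Complex.I • (∫ t in (-T)..T, G (a + t * Complex.I))) = fun _ => 0 := by
    funext T
    simpa using hrect T
  rw [hz] at key
  have := tendsto_nhds_unique key tendsto_const_nhds
  simp only [sub_zero, zero_add, smul_eq_mul] at this
  have h3 : Complex.I * ((∫ t : ℝ, G (b + t * Complex.I)) - ∫ t : ℝ, G (a + t * Complex.I)) = 0 := by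
    linear_combination this
  exact (sub_eq_zero.1 ((mul_eq_zero.1 h3).resolve_left Complex.I_ne_zero)).symm

namespace Nice

/-- Plancherel's identity for the Mellin transform along a vertical line. -/
theorem integral_mellinHat_sq {f : ℝ → ℝ → ℝ} (hf : Nice f) (α φ : ℝ) :
    ∫ t : ℝ, ‖mellinHat f (α + t * Complex.I) φ‖ ^ 2
      = ∫ r in Ioi (0 : ℝ), r ^ (-2 * α - 1) * f r φ ^ 2 := by
  obtain ⟨R, hR, hs⟩ := hf.exists_log_support
  -- The factor e^{-αx} moves the line Re z = α to the imaginary axis, where the Mellin transform is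
  -- a constant times the Fourier transform of h at t/(2π).
  set h : ℝ → ℂ := fun x => ((Real.exp (-α * x) * f (Real.exp x) φ : ℝ) : ℂ) with hh
  have hsm : ContDiff ℝ ∞ h := by
    refine Complex.ofRealCLM.contDiff.comp (ContDiff.mul (by fun_prop) ?_)
    exact hf.smooth.comp (f := fun x : ℝ => (Real.exp x, φ))
      (Real.contDiff_exp.prodMk contDiff_const)
  have hcs : HasCompactSupport h := by
    refine HasCompactSupport.intro (isCompact_Icc (a := -R) (b := R)) fun x hx => ?_
    have : R < |x| := by
      by_contra hh'
      exact hx (abs_le.1 (not_lt.1 hh'))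
    simp [hh, hs x φ this]
  set S := hcs.toSchwartzMap hsm with hS
  have hF : ∀ t : ℝ, mellinHat f (α + t * Complex.I) φ
      = (√(2 * π) : ℂ)⁻¹ * FourierTransform.fourier (S : ℝ → ℂ) (t / (2 * π)) := by
    intro t
    rw [mellinHat_eq_integral, Real.fourier_eq']
    congr 1
    refine integral_congr_ae (Filter.Eventually.of_forall fun x => ?_)
    have : (S x : ℂ) = h x := rfl
    simp only [this, hh, smul_eq_mul]
    push_cast
    rw [← mul_assoc, ← Complex.exp_add]
    congr 2
    have : (π : ℂ) ≠ 0 := by exact_mod_cast Real.pi_ne_zero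
    simp
    field_simp
  have hsq : ∀ t : ℝ, ‖mellinHat f (α + t * Complex.I) φ‖ ^ 2
      = (2 * π)⁻¹ * ‖FourierTransform.fourier (S : ℝ → ℂ) (t / (2 * π))‖ ^ 2 := by
    intro t
    rw [hF, norm_mul, mul_pow]
    congr 1
    rw [norm_inv, Complex.norm_real, inv_pow, Real.norm_eq_abs, sq_abs,
      Real.sq_sqrt (by positivity)]
  simp_rw [hsq]
  rw [MeasureTheory.integral_const_mul,
    Measure.integral_comp_div (fun ξ => ‖FourierTransform.fourier (S : ℝ → ℂ) ξ‖ ^ 2) (2 * π),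
    smul_eq_mul, abs_of_pos (by positivity), inv_mul_cancel_left₀ (by positivity)]
  have := SchwartzMap.integral_norm_sq_fourier S
  rw [SchwartzMap.fourier_coe] at this
  rw [this, integral_Ioi_eq_integral_exp]
  refine integral_congr_ae (Filter.Eventually.of_forall fun x => ?_)
  have : (S x : ℂ) = h x := rfl
  simp only [this, hh, Complex.norm_real, smul_eq_mul, Real.norm_eq_abs, sq_abs]
  rw [← Real.exp_mul, mul_pow, ← Real.exp_nat_mul, ← mul_assoc (Real.exp x), ← Real.exp_add]
  congr 2
  push_cast
  ring

end Nice

end Wedge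

end

noncomputable section

namespace Wedge

/-! ### Inequalities of Wirtinger type and a trace inequality -/

section Wirtinger

variable {θ : ℝ}

/-- With T = tan(κ(x - θ/2)) one has (F' + κTF)² = F'² - κ²F² + (κTF²)', because T' = κ(1 + T²). The
last term integrates to zero by the boundary conditions, and κθ < π keeps the tangent finite on [0,
θ]. -/
theorem wirtinger_dirichlet_aux (hθ : 0 < θ) {F F' : ℝ → ℝ} (hF : ∀ x, HasDerivAt F (F' x) x)
    (hF' : Continuous F') (h0 : F 0 = 0) (h1 : F θ = 0) {κ : ℝ} (hκ : 0 ≤ κ) (hκθ : κ * θ < π) :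
    κ ^ 2 * ∫ x in (0 : ℝ)..θ, F x ^ 2 ≤ ∫ x in (0 : ℝ)..θ, F' x ^ 2 := by
  have hFc : Continuous F := continuous_iff_continuousAt.2 fun x => (hF x).continuousAt
  set T : ℝ → ℝ := fun x => Real.tan (κ * (x - θ / 2)) with hT
  have hcos : ∀ x ∈ Icc 0 θ, 0 < Real.cos (κ * (x - θ / 2)) := by
    intro x hx
    apply Real.cos_pos_of_mem_Ioo
    constructor <;> nlinarith [hx.1, hx.2]
  have hTd : ∀ x ∈ Icc 0 θ, HasDerivAt T ((1 + T x ^ 2) * κ) x := by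
    intro x hx
    have h := (Real.hasDerivAt_tan (hcos x hx).ne').comp x
      (((hasDerivAt_id x).sub_const (θ / 2)).const_mul κ)
    refine h.congr_deriv ?_
    have hc := (hcos x hx).ne'
    simp only [hT, Real.tan_eq_sin_div_cos, mul_one]
    generalize κ * (x - θ / 2) = y at hc
    have : 1 / Real.cos y ^ 2 = 1 + (Real.sin y / Real.cos y) ^ 2 := by
      field_simp
      linarith [Real.sin_sq_add_cos_sq y]
    rw [this]
  have hTc : ContinuousOn T (Icc 0 θ) := fun x hx => (hTd x hx).continuousAt.continuousWithinAt
  have hd : ∀ x ∈ uIcc 0 θ, HasDerivAt (fun x => κ * T x * F x ^ 2)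
      (κ * ((1 + T x ^ 2) * κ) * F x ^ 2 + κ * T x * (2 * F x * F' x)) x := by
    intro x hx
    rw [uIcc_of_le hθ.le] at hx
    have := ((hTd x hx).const_mul κ).mul ((hF x).pow 2)
    refine this.congr_deriv ?_
    simp
  have hci : ContinuousOn (fun x => κ * ((1 + T x ^ 2) * κ) * F x ^ 2
      + κ * T x * (2 * F x * F' x)) (uIcc 0 θ) := by
    rw [uIcc_of_le hθ.le]
    have := hFc.continuousOn (s := Icc 0 θ)
    have := hF'.continuousOn (s := Icc 0 θ)
    fun_prop
  have hint := intervalIntegral.integral_eq_sub_of_hasDerivAt hd hci.intervalIntegrable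
  rw [h0, h1] at hint
  have hnn : 0 ≤ ∫ x in (0 : ℝ)..θ, (F' x + κ * T x * F x) ^ 2 :=
    intervalIntegral.integral_nonneg hθ.le fun x _ => sq_nonneg _
  have hsplit : ∫ x in (0 : ℝ)..θ, (F' x + κ * T x * F x) ^ 2
      = (∫ x in (0 : ℝ)..θ, F' x ^ 2) - κ ^ 2 * (∫ x in (0 : ℝ)..θ, F x ^ 2)
        + ∫ x in (0 : ℝ)..θ, (κ * ((1 + T x ^ 2) * κ) * F x ^ 2
      + κ * T x * (2 * F x * F' x)) := by
    rw [← intervalIntegral.integral_const_mul, ← intervalIntegral.integral_sub,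
      ← intervalIntegral.integral_add]
    · congr 1; ext x; ring
    · exact Continuous.intervalIntegrable (by fun_prop) _ _
    · exact hci.intervalIntegrable
    · exact Continuous.intervalIntegrable (by fun_prop) _ _
    · exact Continuous.intervalIntegrable (by fun_prop) _ _
  rw [hsplit, hint] at hnn
  linarith [hnn]

/-- For κ = π/θ the tangent in `wirtinger_dirichlet_aux` blows up at the endpoints; the sharp
constant is reached by letting κ increase to π/θ. -/
theorem wirtinger_dirichlet (hθ : 0 < θ) {F F' : ℝ → ℝ} (hF : ∀ x, HasDerivAt F (F' x) x)
    (hF' : Continuous F') (h0 : F 0 = 0) (h1 : F θ = 0) :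
    (π / θ) ^ 2 * ∫ x in (0 : ℝ)..θ, F x ^ 2 ≤ ∫ x in (0 : ℝ)..θ, F' x ^ 2 := by
  have hc : Filter.Tendsto (fun κ : ℝ => κ ^ 2 * ∫ x in (0 : ℝ)..θ, F x ^ 2)
      (nhdsWithin (π / θ) (Iio (π / θ))) (nhds ((π / θ) ^ 2 * ∫ x in (0 : ℝ)..θ, F x ^ 2)) :=
    (Continuous.tendsto (by fun_prop) _).mono_left nhdsWithin_le_nhds
  have hpos : 0 < π / θ := by positivity
  refine le_of_tendsto hc ?_
  filter_upwards [Ioo_mem_nhdsLT hpos] with κ hκ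
  exact wirtinger_dirichlet_aux hθ hF hF' h0 h1 hκ.1.le ((lt_div_iff₀ hθ).1 hκ.2)

/-- The primitive F of f vanishes at both ends, so the Dirichlet inequality applies to it. Since ∫ F
f' = -∫ f², expanding ∫ (k²F + f')² ≥ 0 with k = π/θ transfers that bound to f. -/
theorem wirtinger_mean_zero (hθ : 0 < θ) {f f' : ℝ → ℝ} (hf : ∀ x, HasDerivAt f (f' x) x)
    (hf' : Continuous f') (h0 : ∫ x in (0 : ℝ)..θ, f x = 0) :
    (π / θ) ^ 2 * ∫ x in (0 : ℝ)..θ, f x ^ 2 ≤ ∫ x in (0 : ℝ)..θ, f' x ^ 2 := by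
  have hfc : Continuous f := continuous_iff_continuousAt.2 fun x => (hf x).continuousAt
  set F : ℝ → ℝ := fun x => ∫ y in (0 : ℝ)..x, f y with hFdef
  have hF : ∀ x, HasDerivAt F (f x) x := fun x =>
    intervalIntegral.integral_hasDerivAt_right (hfc.intervalIntegrable _ _)
      (hfc.stronglyMeasurableAtFilter _ _) hfc.continuousAt
  have hFc : Continuous F := continuous_iff_continuousAt.2 fun x => (hF x).continuousAt
  have hF0 : F 0 = 0 := by simp [hFdef]
  have hw := wirtinger_dirichlet hθ hF hfc hF0 h0
  have hparts : ∫ x in (0 : ℝ)..θ, (f x ^ 2 + F x * f' x) = 0 := by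
    have := intervalIntegral.integral_eq_sub_of_hasDerivAt (a := 0) (b := θ)
      (f := fun x => F x * f x) (f' := fun x => f x ^ 2 + F x * f' x)
      (fun x _ => ((hF x).mul (hf x)).congr_deriv (by ring))
      (Continuous.intervalIntegrable (by fun_prop) _ _)
    rw [this, hF0, show F θ = 0 from h0]; simp
  have hk : 0 < π / θ := by positivity
  set k := π / θ
  have hnn : 0 ≤ ∫ x in (0 : ℝ)..θ, (k ^ 2 * F x + f' x) ^ 2 :=
    intervalIntegral.integral_nonneg hθ.le fun x _ => sq_nonneg _
  have e1 : ∫ x in (0 : ℝ)..θ, (k ^ 2 * F x + f' x) ^ 2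
      = k ^ 4 * (∫ x in (0 : ℝ)..θ, F x ^ 2) + (∫ x in (0 : ℝ)..θ, f' x ^ 2)
        + 2 * k ^ 2 * (∫ x in (0 : ℝ)..θ, (f x ^ 2 + F x * f' x))
        - 2 * k ^ 2 * ∫ x in (0 : ℝ)..θ, f x ^ 2 := by
    simp_rw [← intervalIntegral.integral_const_mul]
    rw [← intervalIntegral.integral_add, ← intervalIntegral.integral_add,
      ← intervalIntegral.integral_sub]
    · congr 1; ext x; ring
    all_goals exact Continuous.intervalIntegrable (by fun_prop) _ _
  rw [e1, hparts] at hnn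
  nlinarith [mul_le_mul_of_nonneg_left hw (sq_nonneg k)]

theorem integral_norm_sq_eq {f : ℝ → ℂ} (hf : Continuous f) (a b : ℝ) :
    ∫ x in a..b, ‖f x‖ ^ 2 = (∫ x in a..b, (f x).re ^ 2) + ∫ x in a..b, (f x).im ^ 2 := by
  have h1 : Continuous fun x => (f x).re := Complex.continuous_re.comp hf
  have h2 : Continuous fun x => (f x).im := Complex.continuous_im.comp hf
  rw [← intervalIntegral.integral_add]
  · congr 1; ext x; rw [Complex.sq_norm, Complex.normSq_apply]; ring
  all_goals exact Continuous.intervalIntegrable (by fun_prop) _ _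

theorem hasDerivAt_re {f : ℝ → ℂ} {f' : ℂ} {x : ℝ} (h : HasDerivAt f f' x) :
    HasDerivAt (fun x => (f x).re) f'.re x :=
  (Complex.reCLM.hasFDerivAt.comp_hasDerivAt x h)

theorem hasDerivAt_im {f : ℝ → ℂ} {f' : ℂ} {x : ℝ} (h : HasDerivAt f f' x) :
    HasDerivAt (fun x => (f x).im) f'.im x :=
  (Complex.imCLM.hasFDerivAt.comp_hasDerivAt x h)

theorem wirtinger_mean_zero_complex (hθ : 0 < θ) {f f' : ℝ → ℂ}
    (hf : ∀ x, HasDerivAt f (f' x) x) (hf' : Continuous f') (h0 : ∫ x in (0 : ℝ)..θ, f x = 0) :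
    (π / θ) ^ 2 * ∫ x in (0 : ℝ)..θ, ‖f x‖ ^ 2 ≤ ∫ x in (0 : ℝ)..θ, ‖f' x‖ ^ 2 := by
  have hfc : Continuous f := continuous_iff_continuousAt.2 fun x => (hf x).continuousAt
  have hre : ∫ x in (0 : ℝ)..θ, (f x).re = 0 := by
    have := Complex.reCLM.intervalIntegral_comp_comm (μ := volume) (hfc.intervalIntegrable 0 θ)
    simpa [h0] using this
  have him : ∫ x in (0 : ℝ)..θ, (f x).im = 0 := by
    have := Complex.imCLM.intervalIntegral_comp_comm (μ := volume) (hfc.intervalIntegrable 0 θ)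
    simpa [h0] using this
  rw [integral_norm_sq_eq hfc, integral_norm_sq_eq hf', mul_add]
  exact add_le_add
    (wirtinger_mean_zero hθ (fun x => hasDerivAt_re (hf x)) (Complex.continuous_re.comp hf') hre)
    (wirtinger_mean_zero hθ (fun x => hasDerivAt_im (hf x)) (Complex.continuous_im.comp hf') him)

/-- A trace inequality on an interval. -/
theorem trace_sq_le (hθ : 0 < θ) {f f' : ℝ → ℂ} (hf : ∀ x, HasDerivAt f (f' x) x)
    (hf' : Continuous f') {b τ : ℝ} (hb : b ∈ Icc 0 θ) (hτ : 0 < τ) :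
    ‖f b‖ ^ 2 ≤ (θ⁻¹ + τ⁻¹) * (∫ x in (0 : ℝ)..θ, ‖f x‖ ^ 2)
      + τ * ∫ x in (0 : ℝ)..θ, ‖f' x‖ ^ 2 := by
  have hfc : Continuous f := continuous_iff_continuousAt.2 fun x => (hf x).continuousAt
  set K := ∫ x in (0 : ℝ)..θ, (τ⁻¹ * ‖f x‖ ^ 2 + τ * ‖f' x‖ ^ 2) with hK
  -- The difference of |f|² at b and s is the integral of 2⟨f, f'⟩; Young's inequality with weight τ
  -- bounds it by K, independently of s.
  have hpt : ∀ s ∈ Icc 0 θ, ‖f b‖ ^ 2 ≤ ‖f s‖ ^ 2 + K := by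
    intro s hs
    have hd : ∀ x ∈ uIcc s b, HasDerivAt (fun x => ‖f x‖ ^ 2) (2 * inner ℝ (f x) (f' x)) x :=
      fun x _ => (hf x).norm_sq
    have hci : Continuous fun x => 2 * inner ℝ (f x) (f' x) := by fun_prop
    have := intervalIntegral.integral_eq_sub_of_hasDerivAt hd (hci.intervalIntegrable _ _)
    have hle : |∫ x in s..b, 2 * inner ℝ (f x) (f' x)| ≤ K := by
      calc |∫ x in s..b, 2 * inner ℝ (f x) (f' x)|
          ≤ ∫ x in uIoc s b, |2 * inner ℝ (f x) (f' x)| :=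
            (intervalIntegral.norm_integral_le_integral_norm_uIoc (E := ℝ))
        _ ≤ ∫ x in uIoc s b, (τ⁻¹ * ‖f x‖ ^ 2 + τ * ‖f' x‖ ^ 2) := by
            refine setIntegral_mono ?_ ?_ fun x => ?_
            · exact (Continuous.integrableOn_uIoc (by fun_prop))
            · exact (Continuous.integrableOn_uIoc (by fun_prop))
            · have h1 := abs_real_inner_le_norm (f x) (f' x)
              simp only [abs_mul, abs_two]
              have h2 : τ⁻¹ * ‖f x‖ ^ 2 + τ * ‖f' x‖ ^ 2 - 2 * (‖f x‖ * ‖f' x‖)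
                  = τ⁻¹ * (‖f x‖ - τ * ‖f' x‖) ^ 2 := by field_simp; ring
              have h3 : 0 ≤ τ⁻¹ * (‖f x‖ - τ * ‖f' x‖) ^ 2 := by positivity
              linarith
        _ ≤ ∫ x in Ioc 0 θ, (τ⁻¹ * ‖f x‖ ^ 2 + τ * ‖f' x‖ ^ 2) := by
            refine setIntegral_mono_set ?_ ?_ ?_
            · rw [← uIoc_of_le hθ.le]
              exact (Continuous.integrableOn_uIoc (by fun_prop))
            · exact Filter.Eventually.of_forall fun x => by positivity
            · refine Filter.Eventually.of_forall fun x hx => ?_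
              exact ⟨(le_min hs.1 hb.1).trans_lt hx.1, hx.2.trans (max_le hs.2 hb.2)⟩
        _ = K := by rw [hK, intervalIntegral.integral_of_le hθ.le]
    rw [this] at hle
    linarith [le_abs_self (‖f b‖ ^ 2 - ‖f s‖ ^ 2)]
  -- Averaging over the free point s produces the term with θ⁻¹.
  have hint : ∫ s in (0 : ℝ)..θ, ‖f b‖ ^ 2 ≤ ∫ s in (0 : ℝ)..θ, (‖f s‖ ^ 2 + K) := by
    refine intervalIntegral.integral_mono_on hθ.le ?_ ?_ hpt
    all_goals exact Continuous.intervalIntegrable (by fun_prop) _ _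
  rw [intervalIntegral.integral_const, intervalIntegral.integral_add
    (Continuous.intervalIntegrable (by fun_prop) _ _)
    (Continuous.intervalIntegrable (by fun_prop) _ _), intervalIntegral.integral_const] at hint
  have hK' : K = τ⁻¹ * (∫ x in (0 : ℝ)..θ, ‖f x‖ ^ 2) + τ * ∫ x in (0 : ℝ)..θ, ‖f' x‖ ^ 2 := by
    rw [hK, intervalIntegral.integral_add, intervalIntegral.integral_const_mul,
      intervalIntegral.integral_const_mul]
    all_goals exact Continuous.intervalIntegrable (by fun_prop) _ _
  simp only [sub_zero, smul_eq_mul] at hint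
  have : ‖f b‖ ^ 2 ≤ θ⁻¹ * (∫ x in (0 : ℝ)..θ, ‖f x‖ ^ 2) + K := by
    have := mul_le_mul_of_nonneg_left hint (inv_pos.2 hθ).le
    rwa [inv_mul_cancel_left₀ hθ.ne', mul_add, inv_mul_cancel_left₀ hθ.ne'] at this
  rw [hK'] at this
  linarith

end Wirtinger

end Wedge

end

/-! ### Energy estimates for Φ'' + z²Φ = g with Neumann data -/

noncomputable section

namespace Wedge

/-- `Φ'' + z² Φ = g`, with `Φ'` the derivative of `Φ`. -/
structure HelmholtzODE (z : ℂ) (g Φ Φ' : ℝ → ℂ) : Prop where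
  continuous_source : Continuous g
  hasDerivAt : ∀ x, HasDerivAt Φ (Φ' x) x
  hasDerivAt_deriv : ∀ x, HasDerivAt Φ' (g x - z ^ 2 * Φ x) x

namespace HelmholtzODE

variable {z : ℂ} {g Φ Φ' : ℝ → ℂ} {θ δ : ℝ}

theorem continuous (h : HelmholtzODE z g Φ Φ') : Continuous Φ :=
  continuous_iff_continuousAt.2 fun x => (h.hasDerivAt x).continuousAt

theorem continuous_deriv (h : HelmholtzODE z g Φ Φ') : Continuous Φ' :=
  continuous_iff_continuousAt.2 fun x => (h.hasDerivAt_deriv x).continuousAt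

theorem integral_source (h : HelmholtzODE z g Φ Φ') (θ : ℝ) :
    z ^ 2 * ∫ x in (0 : ℝ)..θ, Φ x = (∫ x in (0 : ℝ)..θ, g x) - (Φ' θ - Φ' 0) := by
  have hc := h.continuous
  have hg := h.continuous_source
  rw [← intervalIntegral.integral_eq_sub_of_hasDerivAt (fun x _ => h.hasDerivAt_deriv x)
    (Continuous.intervalIntegrable (by fun_prop) _ _), intervalIntegral.integral_sub
    (Continuous.intervalIntegrable (by fun_prop) _ _)
    (Continuous.intervalIntegrable (by fun_prop) _ _), intervalIntegral.integral_const_mul]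
  ring

/-- Subtracting the mean value. -/
theorem sub_const (h : HelmholtzODE z g Φ Φ') (M : ℂ) :
    HelmholtzODE z (fun x => g x - z ^ 2 * M) (fun x => Φ x - M) Φ' :=
  ⟨h.continuous_source.sub continuous_const, fun x => (h.hasDerivAt x).sub_const M,
    fun x => (h.hasDerivAt_deriv x).congr_deriv (by ring)⟩

/-- The energy estimate for solutions of mean zero. -/
theorem energy (h : HelmholtzODE z g Φ Φ') (hθ : 0 < θ) (hδ : 0 < δ) (hδ1 : δ ≤ 1)
    (hz : |z.re| ≤ (1 - δ) * (π / θ)) (h0 : ∫ x in (0 : ℝ)..θ, Φ x = 0) :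
    δ / 2 * ((∫ x in (0 : ℝ)..θ, ‖Φ' x‖ ^ 2) + ‖z‖ ^ 2 * ∫ x in (0 : ℝ)..θ, ‖Φ x‖ ^ 2)
      ≤ ‖Φ' θ‖ * ‖Φ θ‖ + ‖Φ' 0‖ * ‖Φ 0‖
        + ‖∫ x in (0 : ℝ)..θ, g x * (starRingEnd ℂ) (Φ x)‖ := by
  have hc := h.continuous
  have hc' := h.continuous_deriv
  have hg := h.continuous_source
  have hconj : Continuous fun x => (starRingEnd ℂ) (Φ x) := Complex.continuous_conj.comp hc
  have hdconj : ∀ x, HasDerivAt (fun x => (starRingEnd ℂ) (Φ x)) ((starRingEnd ℂ) (Φ' x)) x :=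
    fun x => (h.hasDerivAt x).star
  have hw := wirtinger_mean_zero_complex hθ h.hasDerivAt hc' h0
  set A := ∫ x in (0 : ℝ)..θ, ‖Φ' x‖ ^ 2 with hA
  set D := ∫ x in (0 : ℝ)..θ, ‖Φ x‖ ^ 2 with hD
  have hD0 : 0 ≤ D := intervalIntegral.integral_nonneg hθ.le fun x _ => by positivity
  have hA0 : 0 ≤ A := intervalIntegral.integral_nonneg hθ.le fun x _ => by positivity
  -- The equation tested with the conjugate of Φ and integrated by parts.
  have hid : (A : ℂ) - z ^ 2 * D = Φ' θ * (starRingEnd ℂ) (Φ θ) - Φ' 0 * (starRingEnd ℂ) (Φ 0)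
      - ∫ x in (0 : ℝ)..θ, g x * (starRingEnd ℂ) (Φ x) := by
    rw [← intervalIntegral.integral_eq_sub_of_hasDerivAt
      (f := fun x => Φ' x * (starRingEnd ℂ) (Φ x))
      (fun x _ => (h.hasDerivAt_deriv x).mul (hdconj x))
      (Continuous.intervalIntegrable (by fun_prop) _ _), hA, hD,
      ← intervalIntegral.integral_ofReal, ← intervalIntegral.integral_ofReal,
      ← intervalIntegral.integral_const_mul, ← intervalIntegral.integral_sub,
      ← intervalIntegral.integral_sub]
    · congr 1; ext x
      have h1 := Complex.mul_conj' (Φ x)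
      have h2 := Complex.mul_conj' (Φ' x)
      push_cast
      rw [← h1, ← h2]; ring
    all_goals exact Continuous.intervalIntegrable (by fun_prop) _ _
  have hre : A - (z.re ^ 2 - z.im ^ 2) * D ≤ ‖Φ' θ‖ * ‖Φ θ‖ + ‖Φ' 0‖ * ‖Φ 0‖
        + ‖∫ x in (0 : ℝ)..θ, g x * (starRingEnd ℂ) (Φ x)‖ := by
    have e : ((A : ℂ) - z ^ 2 * D).re = A - (z.re ^ 2 - z.im ^ 2) * D := by
      simp [pow_two]
    rw [← e, hid]
    refine (Complex.re_le_norm _).trans ((norm_sub_le _ _).trans ?_)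
    gcongr
    refine (norm_sub_le _ _).trans ?_
    simp
  refine le_trans ?_ hre
  have hns : ‖z‖ ^ 2 = z.re ^ 2 + z.im ^ 2 := by
    rw [Complex.sq_norm, Complex.normSq_apply]; ring
  -- The only negative contribution to the real part is (Re z)² D; Wirtinger's inequality absorbs
  -- it, leaving 1 - (1-δ)² ≥ δ times A.
  have hx2 : z.re ^ 2 * D ≤ (1 - δ) ^ 2 * A := by
    have : z.re ^ 2 ≤ ((1 - δ) * (π / θ)) ^ 2 := by
      rw [← sq_abs]; gcongr
    calc z.re ^ 2 * D ≤ ((1 - δ) * (π / θ)) ^ 2 * D := by gcongr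
      _ = (1 - δ) ^ 2 * ((π / θ) ^ 2 * D) := by ring
      _ ≤ _ := by gcongr
  have hy : 0 ≤ z.im ^ 2 * D := by positivity
  rw [hns]
  have h3 : 0 ≤ (δ / 2 * (1 - δ)) * A := by
    have : 0 ≤ 1 - δ := by linarith
    positivity
  have h5 : δ * (z.im ^ 2 * D) ≤ 1 * (z.im ^ 2 * D) := by gcongr
  have h6 : (δ / 2) * (z.re ^ 2 * D) ≤ (δ / 2) * ((1 - δ) ^ 2 * A) := by gcongr
  have h7 : 0 ≤ δ ^ 2 * (1 - δ) * A := by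
    have : 0 ≤ 1 - δ := by linarith
    positivity
  nlinarith [hx2, h6, h3, h5, hy, h7, mul_nonneg hδ.le hA0]

theorem norm_integral_mul_conj_le {f g : ℝ → ℂ} (hf : Continuous f) (hg : Continuous g)
    (hθ : 0 < θ) {s : ℝ} (hs : 0 < s) :
    ‖∫ x in (0 : ℝ)..θ, f x * (starRingEnd ℂ) (g x)‖
      ≤ s / 2 * (∫ x in (0 : ℝ)..θ, ‖f x‖ ^ 2) + s⁻¹ / 2 * ∫ x in (0 : ℝ)..θ, ‖g x‖ ^ 2 := by
  rw [← intervalIntegral.integral_const_mul, ← intervalIntegral.integral_const_mul,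
    ← intervalIntegral.integral_add (Continuous.intervalIntegrable (by fun_prop) _ _)
    (Continuous.intervalIntegrable (by fun_prop) _ _)]
  refine intervalIntegral.norm_integral_le_of_norm_le hθ.le
    (Filter.Eventually.of_forall fun x _ => ?_) (Continuous.intervalIntegrable (by fun_prop) _ _)
  rw [norm_mul, RCLike.norm_conj]
  have h2 : s / 2 * ‖f x‖ ^ 2 + s⁻¹ / 2 * ‖g x‖ ^ 2 - ‖f x‖ * ‖g x‖
      = s⁻¹ / 2 * (s * ‖f x‖ - ‖g x‖) ^ 2 := by field_simp; ring
  have h3 : 0 ≤ s⁻¹ / 2 * (s * ‖f x‖ - ‖g x‖) ^ 2 := by positivity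
  linarith

theorem sq_integral_le_of_mean_zero {f f' : ℝ → ℂ} (hθ : 0 < θ)
    (hf : ∀ x, HasDerivAt f (f' x) x) (hf' : Continuous f')
    (h0 : ∫ x in (0 : ℝ)..θ, f x = 0) :
    ∫ x in (0 : ℝ)..θ, ‖f x‖ ^ 2 ≤ θ ^ 2 * ∫ x in (0 : ℝ)..θ, ‖f' x‖ ^ 2 := by
  have hw := wirtinger_mean_zero_complex hθ hf hf' h0
  have hD0 : 0 ≤ ∫ x in (0 : ℝ)..θ, ‖f x‖ ^ 2 :=
    intervalIntegral.integral_nonneg hθ.le fun x _ => by positivity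
  have h1 : (1 : ℝ) ≤ π ^ 2 := by nlinarith [Real.pi_gt_three]
  have h2 : θ ^ 2 * ((π / θ) ^ 2 * ∫ x in (0 : ℝ)..θ, ‖f x‖ ^ 2)
      = π ^ 2 * ∫ x in (0 : ℝ)..θ, ‖f x‖ ^ 2 := by field_simp
  have h3 := mul_le_mul_of_nonneg_left hw (sq_nonneg θ)
  nlinarith

/-- The estimate of the gradient by a source of mean zero, with homogeneous Neumann data. -/
theorem gradient_le_source (h : HelmholtzODE z g Φ Φ') (hθ : 0 < θ) (hδ : 0 < δ) (hδ1 : δ ≤ 1)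
    (hz : |z.re| ≤ (1 - δ) * (π / θ)) (hz0 : z ≠ 0) (h0 : Φ' 0 = 0) (h1 : Φ' θ = 0)
    (hg0 : ∫ x in (0 : ℝ)..θ, g x = 0) :
    (∫ x in (0 : ℝ)..θ, ‖Φ' x‖ ^ 2) + ‖z‖ ^ 2 * (∫ x in (0 : ℝ)..θ, ‖Φ x‖ ^ 2)
      ≤ 4 / δ ^ 2 * θ ^ 2 * ∫ x in (0 : ℝ)..θ, ‖g x‖ ^ 2 := by
  have hm : ∫ x in (0 : ℝ)..θ, Φ x = 0 := by
    have := h.integral_source θ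
    rw [hg0, h0, h1] at this
    simpa [hz0] using this
  have he := h.energy hθ hδ hδ1 hz hm
  -- With this Young parameter the Φ-part of the source term is at most δ/4 times A, half of what
  -- `energy` provides.
  have hs : 0 < 2 * θ ^ 2 / δ := by positivity
  have hcs := norm_integral_mul_conj_le h.continuous_source h.continuous hθ hs
  have hp := sq_integral_le_of_mean_zero hθ h.hasDerivAt h.continuous_deriv hm
  rw [h0, h1] at he
  simp only [norm_zero, zero_mul, zero_add] at he
  set A := ∫ x in (0 : ℝ)..θ, ‖Φ' x‖ ^ 2 with hA
  set D := ∫ x in (0 : ℝ)..θ, ‖Φ x‖ ^ 2 with hD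
  set G := ∫ x in (0 : ℝ)..θ, ‖g x‖ ^ 2
  have hD0 : 0 ≤ ‖z‖ ^ 2 * D :=
    mul_nonneg (by positivity) (intervalIntegral.integral_nonneg hθ.le fun x _ => by positivity)
  have h4 : (2 * θ ^ 2 / δ)⁻¹ / 2 * D ≤ δ / 4 * A := by
    calc _ ≤ (2 * θ ^ 2 / δ)⁻¹ / 2 * (θ ^ 2 * A) := by gcongr
      _ = δ / 4 * A := by field_simp; ring
  have h5 : δ / 4 * (A + ‖z‖ ^ 2 * D) ≤ θ ^ 2 / δ * G := by
    have e : 2 * θ ^ 2 / δ / 2 = θ ^ 2 / δ := by field_simp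
    rw [e] at hcs
    nlinarith
  have h6 := mul_le_mul_of_nonneg_left h5 (show 0 ≤ 4 / δ by positivity)
  have e1 : 4 / δ * (δ / 4 * (A + ‖z‖ ^ 2 * D)) = A + ‖z‖ ^ 2 * D := by field_simp
  have e2 : 4 / δ * (θ ^ 2 / δ * G) = 4 / δ ^ 2 * θ ^ 2 * G := by field_simp
  rwa [e1, e2] at h6

end HelmholtzODE

end Wedge

end

/-! ### Mean values, estimates by boundary data, pointwise bounds -/

noncomputable section

namespace Wedge

/-- The mean value over `(0, θ)`. -/
def mean (θ : ℝ) (Φ : ℝ → ℂ) : ℂ := (θ : ℂ)⁻¹ * ∫ x in (0 : ℝ)..θ, Φ x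

theorem integral_sub_mean {θ : ℝ} (hθ : 0 < θ) {Φ : ℝ → ℂ} (hΦ : Continuous Φ) :
    ∫ x in (0 : ℝ)..θ, (Φ x - mean θ Φ) = 0 := by
  rw [intervalIntegral.integral_sub (hΦ.intervalIntegrable _ _)
    (continuous_const.intervalIntegrable _ _), intervalIntegral.integral_const, mean]
  have : (θ : ℂ) ≠ 0 := by exact_mod_cast hθ.ne'
  simp [this]

theorem integral_conj_eq_zero {θ : ℝ} {Φ : ℝ → ℂ}
    (h : ∫ x in (0 : ℝ)..θ, Φ x = 0) : ∫ x in (0 : ℝ)..θ, (starRingEnd ℂ) (Φ x) = 0 := by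
  simp only [intervalIntegral, integral_conj, ← map_sub] at h ⊢
  rw [h, map_zero]

/-- Pythagoras: the cross term vanishes because Φ minus its mean has mean zero. The energy controls
only that part; the mean is read off from the integrated equation. -/
theorem integral_norm_sq_eq_mean {θ : ℝ} (hθ : 0 < θ) {Φ : ℝ → ℂ} (hΦ : Continuous Φ) :
    ∫ x in (0 : ℝ)..θ, ‖Φ x‖ ^ 2
      = (∫ x in (0 : ℝ)..θ, ‖Φ x - mean θ Φ‖ ^ 2) + θ * ‖mean θ Φ‖ ^ 2 := by
  set M := mean θ Φ with hM
  have h0 := integral_sub_mean hθ hΦ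
  rw [← hM] at h0
  have hre : ∫ x in (0 : ℝ)..θ, inner ℝ M (Φ x - M) = 0 := by
    have := (innerSL ℝ M).intervalIntegral_comp_comm (μ := volume)
      ((hΦ.sub (continuous_const (y := M))).intervalIntegrable 0 θ)
    simpa [h0] using this
  have : ∀ x, ‖Φ x‖ ^ 2 = ‖Φ x - M‖ ^ 2 + 2 * inner ℝ M (Φ x - M) + ‖M‖ ^ 2 := by
    intro x
    have h := norm_add_sq_real M (Φ x - M)
    rw [add_sub_cancel] at h
    linarith
  simp_rw [this]
  rw [intervalIntegral.integral_add, intervalIntegral.integral_add,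
    intervalIntegral.integral_const_mul, hre, intervalIntegral.integral_const]
  · simp
  all_goals exact Continuous.intervalIntegrable (by fun_prop) _ _

/-- The trace inequality with parameter η/(Ky), multiplied by Ky. This parameter makes the
coefficient of F' exactly η, at the price of K²/η in front of F. -/
theorem interpolation_aux {K y p η F F' : ℝ} (hK : 0 < K) (hy : 0 < y) (hη : 0 < η)
    (hF : 0 ≤ F) (hp : p ≤ y) :
    K * y * ((p + (η / (K * y))⁻¹) * F + η / (K * y) * F')
      ≤ η * F' + (K + K ^ 2 / η) * y ^ 2 * F := by
  have e : K * y * ((p + (η / (K * y))⁻¹) * F + η / (K * y) * F')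
      = K * y * p * F + K ^ 2 / η * y ^ 2 * F + η * F' := by
    field_simp
  rw [e]
  have : K * y * p * F ≤ K * y * y * F := by gcongr
  calc K * y * p * F + K ^ 2 / η * y ^ 2 * F + η * F'
      ≤ K * y * y * F + K ^ 2 / η * y ^ 2 * F + η * F' := by gcongr
    _ = _ := by ring

namespace HelmholtzODE

variable {z : ℂ} {g Φ Φ' : ℝ → ℂ} {θ δ : ℝ}

/-- The energy estimate, for solutions with arbitrary mean value. -/
theorem energy_sub_mean (h : HelmholtzODE z g Φ Φ') (hθ : 0 < θ) (hδ : 0 < δ) (hδ1 : δ ≤ 1)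
    (hz : |z.re| ≤ (1 - δ) * (π / θ)) :
    δ / 2 * ((∫ x in (0 : ℝ)..θ, ‖Φ' x‖ ^ 2)
        + ‖z‖ ^ 2 * ∫ x in (0 : ℝ)..θ, ‖Φ x - mean θ Φ‖ ^ 2)
      ≤ ‖Φ' θ‖ * ‖Φ θ - mean θ Φ‖ + ‖Φ' 0‖ * ‖Φ 0 - mean θ Φ‖
        + ‖∫ x in (0 : ℝ)..θ, g x * (starRingEnd ℂ) (Φ x - mean θ Φ)‖ := by
  have h0 := integral_sub_mean hθ h.continuous
  have he := (h.sub_const (mean θ Φ)).energy hθ hδ hδ1 hz h0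
  have hg := h.continuous_source
  have hc : Continuous fun x => (starRingEnd ℂ) (Φ x - mean θ Φ) :=
    Complex.continuous_conj.comp (h.continuous.sub continuous_const)
  have e : ∫ x in (0 : ℝ)..θ, (g x - z ^ 2 * mean θ Φ) * (starRingEnd ℂ) (Φ x - mean θ Φ)
      = ∫ x in (0 : ℝ)..θ, g x * (starRingEnd ℂ) (Φ x - mean θ Φ) := by
    simp_rw [sub_mul]
    rw [intervalIntegral.integral_sub (Continuous.intervalIntegrable (by fun_prop) _ _)
      (Continuous.intervalIntegrable (by fun_prop) _ _), intervalIntegral.integral_const_mul,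
      integral_conj_eq_zero h0, mul_zero, sub_zero]
  rwa [e] at he

/-- The estimate of the gradient by the boundary data `- z f`. A small multiple of the derivative
of `f` suffices. -/
theorem gradient_le_boundary (h : HelmholtzODE z g Φ Φ') (hθ : 0 < θ) (hδ : 0 < δ) (hδ1 : δ ≤ 1)
    (hz : |z.re| ≤ (1 - δ) * (π / θ)) (hz0 : z ≠ 0) (hg : ∀ x ∈ Icc 0 θ, g x = 0)
    {f f' : ℝ → ℂ} (hf : ∀ x, HasDerivAt f (f' x) x) (hf' : Continuous f')
    (h0 : Φ' 0 = -z * f 0) (h1 : Φ' θ = -z * f θ) {η : ℝ} (hη : 0 < η) :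
    (∫ x in (0 : ℝ)..θ, ‖Φ' x‖ ^ 2) + ‖z‖ ^ 2 * (∫ x in (0 : ℝ)..θ, ‖Φ x‖ ^ 2)
      ≤ η * (∫ x in (0 : ℝ)..θ, ‖f' x‖ ^ 2) + 2 * (32 / δ ^ 2 + (32 / δ ^ 2) ^ 2 / η)
        * (‖z‖ ^ 2 + (θ ^ 2)⁻¹) * ∫ x in (0 : ℝ)..θ, ‖f x‖ ^ 2 := by
  have hg' : ∀ x ∈ uIcc 0 θ, g x = 0 := by rwa [uIcc_of_le hθ.le]
  have hzp : 0 < ‖z‖ := norm_pos_iff.2 hz0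
  have he := h.energy_sub_mean hθ hδ hδ1 hz
  have hz1 : ∫ x in (0 : ℝ)..θ, g x * (starRingEnd ℂ) (Φ x - mean θ Φ) = 0 := by
    rw [intervalIntegral.integral_congr (g := fun _ => 0) fun x hx => by simp [hg' x hx]]
    simp
  have hgi : ∫ x in (0 : ℝ)..θ, g x = 0 := by
    rw [intervalIntegral.integral_congr (g := fun _ => 0) hg']
    simp
  -- Integrating the equation without source gives z² times the integral of Φ; the factor z in the
  -- data cancels one power, so the mean is controlled by the traces of f.
  have hmean : z * mean θ Φ = θ⁻¹ * (f θ - f 0) := by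
    have := h.integral_source θ
    rw [hgi, h0, h1] at this
    have h3 : z * ∫ x in (0 : ℝ)..θ, Φ x = f θ - f 0 := by
      apply mul_left_cancel₀ hz0; linear_combination this
    rw [mean, mul_left_comm, h3]; simp
  rw [hz1, norm_zero, add_zero, h0, h1, norm_mul, norm_mul, norm_neg] at he
  rw [integral_norm_sq_eq_mean hθ h.continuous]
  set M := mean θ Φ
  have h0' := integral_sub_mean hθ h.continuous
  have hd0 : ∀ x, HasDerivAt (fun x => Φ x - M) (Φ' x) x := fun x => (h.hasDerivAt x).sub_const M
  have hp := sq_integral_le_of_mean_zero hθ hd0 h.continuous_deriv h0'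
  have htr : ∀ b ∈ Icc 0 θ, _ := fun b hb =>
    trace_sq_le hθ hd0 h.continuous_deriv hb (inv_pos.2 hzp)
  set A := ∫ x in (0 : ℝ)..θ, ‖Φ' x‖ ^ 2
  set D := ∫ x in (0 : ℝ)..θ, ‖Φ x - M‖ ^ 2
  have hD0 : 0 ≤ D := intervalIntegral.integral_nonneg hθ.le fun x _ => by positivity
  have hA0 : 0 ≤ A := intervalIntegral.integral_nonneg hθ.le fun x _ => by positivity
  set E := A + ‖z‖ ^ 2 * D with hE
  have hθ0 : (0 : ℝ) ∈ Icc 0 θ := ⟨le_rfl, hθ.le⟩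
  have hθθ : θ ∈ Icc 0 θ := ⟨hθ.le, le_rfl⟩
  -- traces of the mean zero part
  have htr' : ∀ b ∈ Icc 0 θ, ‖z‖ * ‖Φ b - M‖ ^ 2 ≤ 2 * E := by
    intro b hb
    have h4 := mul_le_mul_of_nonneg_left (htr b hb) hzp.le
    rw [inv_inv] at h4
    have e : ‖z‖ * ((θ⁻¹ + ‖z‖) * D + ‖z‖⁻¹ * A) = (‖z‖ * θ⁻¹) * D + ‖z‖ ^ 2 * D + A := by
      field_simp
    rw [e] at h4
    have h5 : (‖z‖ * θ⁻¹) * D ≤ (‖z‖ ^ 2 + (θ⁻¹) ^ 2) / 2 * D := by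
      gcongr; nlinarith [sq_nonneg (‖z‖ - θ⁻¹)]
    have h6 : (θ⁻¹) ^ 2 * D ≤ A := by
      calc (θ⁻¹) ^ 2 * D ≤ (θ⁻¹) ^ 2 * (θ ^ 2 * A) := by gcongr
        _ = A := by field_simp
    have : 0 ≤ ‖z‖ ^ 2 * D := by positivity
    rw [hE]; nlinarith
  -- traces of the data
  set K := 32 / δ ^ 2 with hK
  have hK0 : 0 < K := by positivity
  set y := ‖z‖ + θ⁻¹ with hy
  have hy0 : 0 < y := by positivity
  set F := ∫ x in (0 : ℝ)..θ, ‖f x‖ ^ 2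
  set F' := ∫ x in (0 : ℝ)..θ, ‖f' x‖ ^ 2
  have hF0 : 0 ≤ F := intervalIntegral.integral_nonneg hθ.le fun x _ => by positivity
  set T := (θ⁻¹ + (η / (K * y))⁻¹) * F + η / (K * y) * F' with hT
  have hτ : 0 < η / (K * y) := by positivity
  have hT0 : ‖f 0‖ ^ 2 ≤ T := trace_sq_le hθ hf hf' hθ0 hτ
  have hTθ : ‖f θ‖ ^ 2 ≤ T := trace_sq_le hθ hf hf' hθθ hτ
  have hTnn : 0 ≤ T := (sq_nonneg _).trans hT0
  have hprod : ∀ b ∈ Icc 0 θ, ‖f b‖ ^ 2 ≤ T →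
      ‖z‖ * ‖f b‖ * ‖Φ b - M‖ ≤ 4 / δ * (‖z‖ * T) + δ / 8 * E := by
    intro b hb hfb
    have h4 := htr' b hb
    have e : ‖z‖ * ‖f b‖ * ‖Φ b - M‖ ≤ 4 / δ * (‖z‖ * ‖f b‖ ^ 2)
        + δ / 16 * (‖z‖ * ‖Φ b - M‖ ^ 2) := by
      have : 4 / δ * (‖z‖ * ‖f b‖ ^ 2) + δ / 16 * (‖z‖ * ‖Φ b - M‖ ^ 2)
          - ‖z‖ * ‖f b‖ * ‖Φ b - M‖
          = ‖z‖ * (δ / 16) * (8 / δ * ‖f b‖ - ‖Φ b - M‖) ^ 2 := by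
        field_simp; ring
      have h5 : 0 ≤ ‖z‖ * (δ / 16) * (8 / δ * ‖f b‖ - ‖Φ b - M‖) ^ 2 := by positivity
      linarith
    refine e.trans ?_
    have h6 : 4 / δ * (‖z‖ * ‖f b‖ ^ 2) ≤ 4 / δ * (‖z‖ * T) := by gcongr
    have h7 := mul_le_mul_of_nonneg_left h4 (show 0 ≤ δ / 16 by positivity)
    linarith
  have hEle : E ≤ K * (‖z‖ * T) := by
    have h4 := hprod 0 hθ0 hT0
    have h5 := hprod θ hθθ hTθ
    have h6 : δ / 4 * E ≤ 8 / δ * (‖z‖ * T) := by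
      have e1 : 8 / δ * (‖z‖ * T) = 2 * (4 / δ * (‖z‖ * T)) := by ring
      linarith
    have h7 := mul_le_mul_of_nonneg_left h6 (show 0 ≤ 4 / δ by positivity)
    have e1 : 4 / δ * (δ / 4 * E) = E := by field_simp
    have e2 : 4 / δ * (8 / δ * (‖z‖ * T)) = K * (‖z‖ * T) := by rw [hK]; field_simp; ring
    rwa [e1, e2] at h7
  have hMle : ‖z‖ ^ 2 * (θ * ‖M‖ ^ 2) ≤ K * (θ⁻¹ * T) := by
    have e : ‖z‖ ^ 2 * (θ * ‖M‖ ^ 2) = θ⁻¹ * ‖f θ - f 0‖ ^ 2 := by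
      have : ‖z‖ * ‖M‖ = θ⁻¹ * ‖f θ - f 0‖ := by
        rw [← norm_mul, hmean, norm_mul, Complex.norm_real,
          Real.norm_of_nonneg (inv_pos.2 hθ).le]
      calc _ = θ * (‖z‖ * ‖M‖) ^ 2 := by ring
        _ = _ := by rw [this]; field_simp
    rw [e]
    have h4 : ‖f θ - f 0‖ ^ 2 ≤ 4 * T := by
      have := norm_sub_le (f θ) (f 0)
      calc ‖f θ - f 0‖ ^ 2 ≤ (‖f θ‖ + ‖f 0‖) ^ 2 := by gcongr
        _ ≤ 2 * ‖f θ‖ ^ 2 + 2 * ‖f 0‖ ^ 2 := by nlinarith [sq_nonneg (‖f θ‖ - ‖f 0‖)]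
        _ ≤ 4 * T := by linarith
    have h5 : (4 : ℝ) ≤ K := by
      rw [hK, le_div_iff₀ (by positivity)]
      nlinarith
    calc θ⁻¹ * ‖f θ - f 0‖ ^ 2 ≤ θ⁻¹ * (4 * T) := by gcongr
      _ = 4 * (θ⁻¹ * T) := by ring
      _ ≤ K * (θ⁻¹ * T) := by gcongr
  have hfin : K * y * T ≤ η * F' + (K + K ^ 2 / η) * y ^ 2 * F :=
    interpolation_aux hK0 hy0 hη hF0 (by rw [hy]; linarith)
  have hy2 : y ^ 2 ≤ 2 * (‖z‖ ^ 2 + (θ ^ 2)⁻¹) := by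
    rw [hy, ← inv_pow]; exact add_sq_le
  calc A + ‖z‖ ^ 2 * (D + θ * ‖M‖ ^ 2) = E + ‖z‖ ^ 2 * (θ * ‖M‖ ^ 2) := by rw [hE]; ring
    _ ≤ K * (‖z‖ * T) + K * (θ⁻¹ * T) := add_le_add hEle hMle
    _ = K * y * T := by rw [hy]; ring
    _ ≤ η * F' + (K + K ^ 2 / η) * y ^ 2 * F := hfin
    _ ≤ η * F' + (K + K ^ 2 / η) * (2 * (‖z‖ ^ 2 + (θ ^ 2)⁻¹)) * F := by gcongr
    _ = _ := by ring

/-- A pointwise estimate that is uniform in vertical strips and allows for the double pole of the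
potential at `z = 0`. -/
theorem exists_pointwise_bound (hθ : 0 < θ) (hδ : 0 < δ) (hδ1 : δ ≤ 1) : ∃ C : ℝ, 0 ≤ C ∧
    ∀ (z : ℂ) (g Φ Φ' : ℝ → ℂ) (m : ℝ), HelmholtzODE z g Φ Φ' →
      |z.re| ≤ (1 - δ) * (π / θ) → z ≠ 0 → ‖Φ' 0‖ ≤ m → ‖Φ' θ‖ ≤ m →
      (∀ x ∈ Icc 0 θ, ‖g x‖ ≤ (1 + ‖z‖) * m) →
      ‖(∫ x in (0 : ℝ)..θ, g x) - (Φ' θ - Φ' 0)‖ ≤ ‖z‖ * (θ * m) →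
      ∀ x ∈ Icc 0 θ, ‖z * Φ x‖ ≤ C * (1 + ‖z‖) ^ 3 * m ∧ ‖Φ' x‖ ≤ C * (1 + ‖z‖) ^ 3 * m := by
  set a := 6 / δ * ((2 + θ) * θ) with ha
  have ha0 : 0 ≤ a := by positivity
  refine ⟨a + 1 + (1 + θ * (a + 2)), by positivity, ?_⟩
  intro z g Φ Φ' m h hz hz0 h0 h1 hg hmean
  have hm : 0 ≤ m := (norm_nonneg _).trans h0
  have hzp : 0 < ‖z‖ := norm_pos_iff.2 hz0
  have he := h.energy_sub_mean hθ hδ hδ1 hz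
  -- The compatibility hypothesis carries a factor |z|. It cancels one power of z² in the integrated
  -- equation, so z times the mean stays bounded as z → 0.
  have hM : ‖z * mean θ Φ‖ ≤ m := by
    rw [← h.integral_source θ, norm_mul, norm_pow, pow_two, mul_assoc] at hmean
    have h3 := le_of_mul_le_mul_left hmean hzp
    rw [mean, mul_left_comm, norm_mul, norm_mul z, ← Complex.ofReal_inv, Complex.norm_real,
      Real.norm_of_nonneg (inv_pos.2 hθ).le]
    calc θ⁻¹ * (‖z‖ * ‖∫ x in (0 : ℝ)..θ, Φ x‖) ≤ θ⁻¹ * (θ * m) := by gcongr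
      _ = m := by field_simp
  set M := mean θ Φ
  have h0' := integral_sub_mean hθ h.continuous
  have hd0 : ∀ x, HasDerivAt (fun x => Φ x - M) (Φ' x) x := fun x => (h.hasDerivAt x).sub_const M
  have hp := sq_integral_le_of_mean_zero hθ hd0 h.continuous_deriv h0'
  have htr : ∀ b ∈ Icc 0 θ, _ := fun b hb =>
    trace_sq_le hθ hd0 h.continuous_deriv hb hθ
  have hcΦ : Continuous fun x => Φ x - M := h.continuous.sub continuous_const
  set A := ∫ x in (0 : ℝ)..θ, ‖Φ' x‖ ^ 2
  have hD0 : 0 ≤ ∫ x in (0 : ℝ)..θ, ‖Φ x - mean θ Φ‖ ^ 2 :=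
    intervalIntegral.integral_nonneg hθ.le fun x _ => by positivity
  have hA0 : 0 ≤ A := intervalIntegral.integral_nonneg hθ.le fun x _ => by positivity
  set s := √(3 * θ * A) with hs
  have hss : s ^ 2 = 3 * θ * A := Real.sq_sqrt (by positivity)
  have hs0 : 0 ≤ s := Real.sqrt_nonneg _
  have hsup : ∀ b ∈ Icc 0 θ, ‖Φ b - M‖ ≤ s := by
    intro b hb
    refine Real.le_sqrt_of_sq_le ((htr b hb).trans ?_)
    calc _ ≤ (θ⁻¹ + θ⁻¹) * (θ ^ 2 * A) + θ * A := by gcongr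
      _ = 3 * θ * A := by field_simp; ring
  have hint : ‖∫ x in (0 : ℝ)..θ, g x * (starRingEnd ℂ) (Φ x - M)‖ ≤ (1 + ‖z‖) * m * s * θ := by
    have := intervalIntegral.norm_integral_le_of_norm_le_const (a := 0) (b := θ)
      (f := fun x => g x * (starRingEnd ℂ) (Φ x - M)) (C := (1 + ‖z‖) * m * s) fun x hx => by
        rw [uIoc_of_le hθ.le] at hx
        rw [norm_mul, RCLike.norm_conj]
        have hx' : x ∈ Icc 0 θ := ⟨hx.1.le, hx.2⟩
        gcongr
        · exact hg x hx'
        · exact hsup x hx'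
    rwa [sub_zero, abs_of_pos hθ] at this
  have hθ0 : (0 : ℝ) ∈ Icc 0 θ := ⟨le_rfl, hθ.le⟩
  have hθθ : θ ∈ Icc 0 θ := ⟨hθ.le, le_rfl⟩
  have hsle : s ≤ a * (1 + ‖z‖) * m := by
    have h4 : δ / 2 * A ≤ (2 + θ) * ((1 + ‖z‖) * m) * s := by
      have e1 : ‖Φ' θ‖ * ‖Φ θ - M‖ ≤ (1 + ‖z‖) * m * s := by
        gcongr
        · nlinarith
        · exact hsup θ hθθ
      have e2 : ‖Φ' 0‖ * ‖Φ 0 - M‖ ≤ (1 + ‖z‖) * m * s := by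
        gcongr
        · nlinarith
        · exact hsup 0 hθ0
      have e3 : 0 ≤ δ / 2 * (‖z‖ ^ 2 * ∫ x in (0 : ℝ)..θ, ‖Φ x - mean θ Φ‖ ^ 2) := by positivity
      nlinarith
    -- The sup bound s of Φ - M appears on the right as well, but only linearly, while the energy A
    -- equals s²/(3θ); one factor s cancels.
    have h5 : s * s ≤ a * (1 + ‖z‖) * m * s := by
      have := mul_le_mul_of_nonneg_left h4 (show 0 ≤ 6 / δ * θ by positivity)
      calc s * s = 6 / δ * θ * (δ / 2 * A) := by rw [← pow_two, hss]; field_simp; ring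
        _ ≤ _ := this
        _ = _ := by rw [ha]; ring
    rcases hs0.eq_or_lt with hs1 | hs1
    · rw [← hs1]; positivity
    · exact le_of_mul_le_mul_right h5 hs1
  have hp1 : 1 ≤ 1 + ‖z‖ := by linarith
  have hzΦ : ∀ x ∈ Icc 0 θ, ‖z * Φ x‖ ≤ (a + 1) * (1 + ‖z‖) ^ 2 * m := by
    intro x hx
    have e : z * Φ x = z * (Φ x - M) + z * M := by ring
    have h1 := hsup x hx
    calc ‖z * Φ x‖ ≤ ‖z‖ * ‖Φ x - M‖ + ‖z * M‖ := by
          rw [e, ← norm_mul]; exact norm_add_le _ _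
      _ ≤ (1 + ‖z‖) * (a * (1 + ‖z‖) * m) + (1 + ‖z‖) ^ 2 * m := by
          gcongr
          · linarith
          · exact h1.trans hsle
          · exact hM.trans (le_mul_of_one_le_left hm (one_le_pow₀ hp1))
      _ = _ := by ring
  have hq : (1 + ‖z‖) ^ 2 * m ≤ (1 + ‖z‖) ^ 3 * m := by gcongr; norm_num
  have hr : (1 + ‖z‖) * m ≤ (1 + ‖z‖) ^ 3 * m := by
    calc (1 + ‖z‖) * m = (1 + ‖z‖) ^ 1 * m := by ring
      _ ≤ _ := by gcongr; norm_num
  have ht : m ≤ (1 + ‖z‖) ^ 3 * m := le_mul_of_one_le_left hm (one_le_pow₀ hp1)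
  have hpm : 0 ≤ (1 + ‖z‖) ^ 3 * m := by positivity
  intro x hx
  constructor
  · calc ‖z * Φ x‖ ≤ (a + 1) * ((1 + ‖z‖) ^ 2 * m) := (hzΦ x hx).trans_eq (by ring)
      _ ≤ (a + 1) * ((1 + ‖z‖) ^ 3 * m) := by gcongr
      _ ≤ (a + 1 + (1 + θ * (a + 2))) * ((1 + ‖z‖) ^ 3 * m) := by
          have : 0 ≤ θ * (a + 2) := by positivity
          exact mul_le_mul_of_nonneg_right (by linarith) hpm
      _ = _ := by ring
  · have hsnd : ∀ y ∈ Icc 0 θ, ‖g y - z ^ 2 * Φ y‖ ≤ (a + 2) * ((1 + ‖z‖) ^ 3 * m) := by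
      intro y hy
      calc ‖g y - z ^ 2 * Φ y‖ ≤ ‖g y‖ + ‖z‖ * ‖z * Φ y‖ := by
            rw [← norm_mul, ← mul_assoc, ← pow_two]; exact norm_sub_le _ _
        _ ≤ (1 + ‖z‖) * m + (1 + ‖z‖) * ((a + 1) * (1 + ‖z‖) ^ 2 * m) := by
            gcongr
            · exact hg y hy
            · linarith
            · exact hzΦ y hy
        _ ≤ (1 + ‖z‖) ^ 3 * m + (1 + ‖z‖) * ((a + 1) * (1 + ‖z‖) ^ 2 * m) := by gcongr
        _ = _ := by ring
    have hcg := h.continuous_source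
    have hcΦ' := h.continuous
    have hfund := intervalIntegral.integral_eq_sub_of_hasDerivAt (a := 0) (b := x)
      (fun y _ => h.hasDerivAt_deriv y) (Continuous.intervalIntegrable (by fun_prop) _ _)
    have hn := intervalIntegral.norm_integral_le_of_norm_le_const (a := 0) (b := x)
      (f := fun y => g y - z ^ 2 * Φ y) (C := (a + 2) * ((1 + ‖z‖) ^ 3 * m)) fun y hy => by
        rw [uIoc_of_le hx.1] at hy
        exact hsnd y ⟨hy.1.le, hy.2.trans hx.2⟩
    rw [hfund, sub_zero, abs_of_nonneg hx.1] at hn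
    calc ‖Φ' x‖ ≤ ‖Φ' x - Φ' 0‖ + ‖Φ' 0‖ := by
          have := norm_add_le (Φ' x - Φ' 0) (Φ' 0); rwa [sub_add_cancel] at this
      _ ≤ (a + 2) * ((1 + ‖z‖) ^ 3 * m) * θ + (1 + ‖z‖) ^ 3 * m := by
          refine add_le_add (hn.trans ?_) (h0.trans ht)
          gcongr; exact hx.2
      _ = (1 + θ * (a + 2)) * ((1 + ‖z‖) ^ 3 * m) := by ring
      _ ≤ (a + 1 + (1 + θ * (a + 2))) * ((1 + ‖z‖) ^ 3 * m) :=
          mul_le_mul_of_nonneg_right (by linarith) hpm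
      _ = _ := by ring

end HelmholtzODE

end Wedge

end

noncomputable section

namespace Wedge

/-! ### The solution of the Neumann problem -/

/-- `∫_0^φ cos (z s) g(s) ds` -/
def cosInt (z : ℂ) (g : ℝ → ℂ) (φ : ℝ) : ℂ := ∫ s in (0 : ℝ)..φ, Complex.cos (z * s) * g s

/-- `∫_0^φ sin (z s) g(s) ds` -/
def sinInt (z : ℂ) (g : ℝ → ℂ) (φ : ℝ) : ℂ := ∫ s in (0 : ℝ)..φ, Complex.sin (z * s) * g s

/-- The solution of `Φ'' + z² Φ = g`, `Φ'(0) = h₀`, `Φ'(θ) = h₁`, by variation of constants. -/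
def neumannSol (θ : ℝ) (z : ℂ) (g : ℝ → ℂ) (h₀ h₁ : ℂ) (φ : ℝ) : ℂ :=
  (h₀ * Complex.cos (z * (θ - φ)) - h₁ * Complex.cos (z * φ)
    + Complex.cos (z * φ) * (Complex.cos (z * θ) * cosInt z g θ
      + Complex.sin (z * θ) * sinInt z g θ)) / (z * Complex.sin (z * θ))
  + (Complex.sin (z * φ) * cosInt z g φ - Complex.cos (z * φ) * sinInt z g φ) / z

/-- The derivative of `neumannSol`. -/
def neumannSolDeriv (θ : ℝ) (z : ℂ) (g : ℝ → ℂ) (h₀ h₁ : ℂ) (φ : ℝ) : ℂ :=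
  (h₀ * Complex.sin (z * (θ - φ)) + h₁ * Complex.sin (z * φ)
    - Complex.sin (z * φ) * (Complex.cos (z * θ) * cosInt z g θ
      + Complex.sin (z * θ) * sinInt z g θ)) / Complex.sin (z * θ)
  + (Complex.cos (z * φ) * cosInt z g φ + Complex.sin (z * φ) * sinInt z g φ)

section

variable {θ : ℝ} {z : ℂ} {g : ℝ → ℂ}

theorem hasDerivAt_cosInt (hg : Continuous g) (z : ℂ) (φ : ℝ) :
    HasDerivAt (cosInt z g) (Complex.cos (z * φ) * g φ) φ := by
  have hc : Continuous fun s : ℝ => Complex.cos (z * s) * g s := by fun_prop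
  exact intervalIntegral.integral_hasDerivAt_right (hc.intervalIntegrable _ _)
    (hc.stronglyMeasurableAtFilter _ _) hc.continuousAt

theorem hasDerivAt_sinInt (hg : Continuous g) (z : ℂ) (φ : ℝ) :
    HasDerivAt (sinInt z g) (Complex.sin (z * φ) * g φ) φ := by
  have hc : Continuous fun s : ℝ => Complex.sin (z * s) * g s := by fun_prop
  exact intervalIntegral.integral_hasDerivAt_right (hc.intervalIntegrable _ _)
    (hc.stronglyMeasurableAtFilter _ _) hc.continuousAt

theorem hasDerivAt_cos_mul (z : ℂ) (φ : ℝ) :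
    HasDerivAt (fun φ : ℝ => Complex.cos (z * φ)) (-Complex.sin (z * φ) * z) φ := by
  have : HasDerivAt (fun w : ℂ => Complex.cos (z * w)) (-Complex.sin (z * φ) * z) φ := by
    simpa using ((hasDerivAt_id (φ : ℂ)).const_mul z).ccos
  exact this.comp_ofReal

theorem hasDerivAt_sin_mul (z : ℂ) (φ : ℝ) :
    HasDerivAt (fun φ : ℝ => Complex.sin (z * φ)) (Complex.cos (z * φ) * z) φ := by
  have : HasDerivAt (fun w : ℂ => Complex.sin (z * w)) (Complex.cos (z * φ) * z) φ := by
    simpa using ((hasDerivAt_id (φ : ℂ)).const_mul z).csin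
  exact this.comp_ofReal

theorem hasDerivAt_cos_mul_sub (z : ℂ) (θ φ : ℝ) :
    HasDerivAt (fun φ : ℝ => Complex.cos (z * (θ - φ))) (Complex.sin (z * (θ - φ)) * z) φ := by
  have : HasDerivAt (fun w : ℂ => Complex.cos (z * (θ - w))) (Complex.sin (z * (θ - φ)) * z) φ := by
    simpa using (((hasDerivAt_id (φ : ℂ)).const_sub (θ : ℂ)).const_mul z).ccos
  exact this.comp_ofReal

theorem hasDerivAt_sin_mul_sub (z : ℂ) (θ φ : ℝ) :
    HasDerivAt (fun φ : ℝ => Complex.sin (z * (θ - φ))) (-Complex.cos (z * (θ - φ)) * z) φ := by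
  have : HasDerivAt (fun w : ℂ => Complex.sin (z * (θ - w)))
      (-Complex.cos (z * (θ - φ)) * z) φ := by
    simpa using (((hasDerivAt_id (φ : ℂ)).const_sub (θ : ℂ)).const_mul z).csin
  exact this.comp_ofReal

/-- Variation of constants. Writing the solution with the primitives `cosInt` and `sinInt` instead
of Green's kernel avoids differentiating across the kink of the kernel; apart from algebra only sin²
+ cos² = 1 enters. -/
theorem helmholtzODE_neumannSol (hg : Continuous g) (hz : z ≠ 0) (hs : Complex.sin (z * θ) ≠ 0)
    (h₀ h₁ : ℂ) :
    HelmholtzODE z g (neumannSol θ z g h₀ h₁) (neumannSolDeriv θ z g h₀ h₁) := by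
  have key : ∀ φ : ℝ, Complex.sin (z * φ) ^ 2 = 1 - Complex.cos (z * φ) ^ 2 := fun φ => by
    linear_combination Complex.sin_sq_add_cos_sq (z * φ)
  refine ⟨hg, fun φ => ?_, fun φ => ?_⟩
  · have h := (((((hasDerivAt_cos_mul_sub z θ φ).const_mul h₀).sub
      ((hasDerivAt_cos_mul z φ).const_mul h₁)).add
      ((hasDerivAt_cos_mul z φ).mul_const (Complex.cos (z * θ) * cosInt z g θ
      + Complex.sin (z * θ) * sinInt z g θ))).div_const (z * Complex.sin (z * θ))).add
      ((((hasDerivAt_sin_mul z φ).mul (hasDerivAt_cosInt hg z φ)).sub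
        ((hasDerivAt_cos_mul z φ).mul (hasDerivAt_sinInt hg z φ))).div_const z)
    refine h.congr_deriv ?_
    rw [neumannSolDeriv]
    field_simp
    ring
  · have h := (((((hasDerivAt_sin_mul_sub z θ φ).const_mul h₀).add
      ((hasDerivAt_sin_mul z φ).const_mul h₁)).sub
      ((hasDerivAt_sin_mul z φ).mul_const (Complex.cos (z * θ) * cosInt z g θ
      + Complex.sin (z * θ) * sinInt z g θ))).div_const (Complex.sin (z * θ))).add
      (((hasDerivAt_cos_mul z φ).mul (hasDerivAt_cosInt hg z φ)).add
        ((hasDerivAt_sin_mul z φ).mul (hasDerivAt_sinInt hg z φ)))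
    refine h.congr_deriv ?_
    rw [neumannSol]
    field_simp
    ring_nf
    rw [key φ]
    ring

theorem neumannSolDeriv_zero (hs : Complex.sin (z * θ) ≠ 0) (h₀ h₁ : ℂ) :
    neumannSolDeriv θ z g h₀ h₁ 0 = h₀ := by
  simp [neumannSolDeriv, cosInt, sinInt, hs]

theorem neumannSolDeriv_end (hs : Complex.sin (z * θ) ≠ 0) (h₀ h₁ : ℂ) :
    neumannSolDeriv θ z g h₀ h₁ θ = h₁ := by
  simp only [neumannSolDeriv, sub_self, mul_zero, Complex.sin_zero]
  field_simp
  ring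

/-- The representation of the solution by Green's function. -/
theorem integral_green_eq (hg : Continuous g) (hz : z ≠ 0)
    (hs : Complex.sin (z * θ) ≠ 0) (h₀ h₁ : ℂ) {G : ℝ → ℂ} (hG : ∀ s ∈ Ioo 0 θ, G s = g s)
    {φ : ℝ} (hφ : φ ∈ Icc 0 θ) :
    h₀ / (z * Complex.sin (z * θ)) * Complex.cos (z * (θ - φ))
      - h₁ / (z * Complex.sin (z * θ)) * Complex.cos (z * φ)
      + ∫ s in (0 : ℝ)..θ, green θ φ s z * G s = neumannSol θ z g h₀ h₁ φ := by
  have hc : Continuous fun s : ℝ => Complex.cos (z * s) * g s := by fun_prop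
  have hsn : Continuous fun s : ℝ => Complex.sin (z * s) * g s := by fun_prop
  set d := z * Complex.sin (z * θ) with hd
  -- The kernel changes its formula at s = φ, so the integral is split there; addition theorems then
  -- reassemble the primitives up to φ and up to θ.
  have e1 : EqOn (fun s : ℝ => Complex.cos (z * (θ - φ)) / d * (Complex.cos (z * s) * g s))
      (fun s => green θ φ s z * G s) (uIoo 0 φ) := by
    intro s hs'
    rw [uIoo_of_le hφ.1] at hs'
    simp only [green, if_pos hs'.2, hG s ⟨hs'.1, hs'.2.trans_le hφ.2⟩]
    ring
  have e2 : EqOn (fun s : ℝ => Complex.cos (z * φ) / d * (Complex.cos (z * θ) *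
        (Complex.cos (z * s) * g s) + Complex.sin (z * θ) * (Complex.sin (z * s) * g s)))
      (fun s => green θ φ s z * G s) (uIoo φ θ) := by
    intro s hs'
    rw [uIoo_of_le hφ.2] at hs'
    simp only [green, if_neg (not_lt.2 hs'.1.le), hG s ⟨hφ.1.trans_lt hs'.1, hs'.2⟩, ← hd]
    rw [mul_sub, Complex.cos_sub]
    ring
  have i1 := (Continuous.intervalIntegrable (μ := volume)
    (hc.const_mul (Complex.cos (z * (θ - φ)) / d)) 0 φ).congr_uIoo e1
  have i2 := (Continuous.intervalIntegrable (μ := volume) (((hc.const_mul (Complex.cos (z * θ))).add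
    (hsn.const_mul (Complex.sin (z * θ)))).const_mul (Complex.cos (z * φ) / d)) φ θ).congr_uIoo e2
  rw [← intervalIntegral.integral_add_adjacent_intervals i1 i2,
    ← intervalIntegral.integral_congr_uIoo e1, ← intervalIntegral.integral_congr_uIoo e2,
    intervalIntegral.integral_const_mul, intervalIntegral.integral_const_mul,
    intervalIntegral.integral_add ((hc.const_mul _).intervalIntegrable _ _)
    ((hsn.const_mul _).intervalIntegrable _ _), intervalIntegral.integral_const_mul,
    intervalIntegral.integral_const_mul,
    ← intervalIntegral.integral_interval_sub_left (hc.intervalIntegrable 0 θ)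
      (hc.intervalIntegrable 0 φ),
    ← intervalIntegral.integral_interval_sub_left (hsn.intervalIntegrable 0 θ)
      (hsn.intervalIntegrable 0 φ)]
  change _ + (Complex.cos (z * (θ - φ)) / d * cosInt z g φ + Complex.cos (z * φ) / d *
    (Complex.cos (z * θ) * (cosInt z g θ - cosInt z g φ) + Complex.sin (z * θ) *
      (sinInt z g θ - sinInt z g φ))) = _
  rw [neumannSol, hd, mul_sub z, Complex.cos_sub]
  field_simp
  ring

end

/-- The zeros of the complex sine are the real integer multiples of π, so in this strip only z = 0
can make the denominators of the potential vanish. -/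
theorem sin_mul_ne_zero {θ : ℝ} (hθ : 0 < θ) {z : ℂ} (hz : z ≠ 0) (hre : |z.re| < π / θ) :
    Complex.sin (z * θ) ≠ 0 := by
  intro h
  obtain ⟨k, hk⟩ := Complex.sin_eq_zero_iff.1 h
  have h1 := congrArg Complex.re hk
  have h2 := congrArg Complex.im hk
  simp at h1 h2
  have him : z.im = 0 := h2.resolve_right hθ.ne'
  rw [lt_div_iff₀ hθ] at hre
  have h3 : |(k : ℝ)| * π < 1 * π := by
    calc |(k : ℝ)| * π = |z.re * θ| := by rw [h1, abs_mul, abs_of_pos Real.pi_pos]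
      _ = |z.re| * θ := by rw [abs_mul, abs_of_pos hθ]
      _ < 1 * π := by linarith
  have h4 : |(k : ℝ)| < 1 := lt_of_mul_lt_mul_right h3 Real.pi_pos.le
  have h5 : k = 0 := by
    rw [← Int.cast_abs] at h4
    have : |k| < 1 := by exact_mod_cast h4
    exact Int.abs_lt_one_iff.1 this
  rw [h5] at h1
  have h6 : z.re = 0 := by simpa [hθ.ne'] using h1
  exact hz (Complex.ext h6 him)

end Wedge

end

noncomputable section

namespace Wedge

/-! ### The potential of a field -/

/-- Both components are smooth and supported in an annulus. -/
structure NiceField (w : PolarField) : Prop where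
  rad : Nice w.rad
  ang : Nice w.ang

/-- The right-hand side `z ŵ_r(z - 1) + ∂_φ ŵ_φ(z - 1)` of the equation for the potential. -/
def potSource (w : PolarField) (z : ℂ) (s : ℝ) : ℂ :=
  z * mellinHat w.rad (z - 1) s + mellinHat (dphi w.ang) (z - 1) s

/-- The Mellin transform of the potential, as a function on the whole line. -/
def pot (θ : ℝ) (w : PolarField) (z : ℂ) : ℝ → ℂ :=
  neumannSol θ z (potSource w z) (mellinHat w.ang (z - 1) 0) (mellinHat w.ang (z - 1) θ)

/-- The angular derivative of `pot`. -/
def potDeriv (θ : ℝ) (w : PolarField) (z : ℂ) : ℝ → ℂ :=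
  neumannSolDeriv θ z (potSource w z) (mellinHat w.ang (z - 1) 0) (mellinHat w.ang (z - 1) θ)

namespace NiceField

variable {w : PolarField} {θ : ℝ} {z : ℂ}

theorem continuous_potSource (hw : NiceField w) :
    Continuous fun p : ℂ × ℝ => potSource w p.1 p.2 := by
  have h1 : Continuous fun p : ℂ × ℝ => mellinHat w.rad (p.1 - 1) p.2 :=
    hw.rad.continuous_mellinHat.comp (f := fun p : ℂ × ℝ => (p.1 - 1, p.2)) (by fun_prop)
  have h2 : Continuous fun p : ℂ × ℝ => mellinHat (dphi w.ang) (p.1 - 1) p.2 :=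
    hw.ang.dphi.continuous_mellinHat.comp (f := fun p : ℂ × ℝ => (p.1 - 1, p.2)) (by fun_prop)
  exact (continuous_fst.mul h1).add h2

theorem continuous_potSource_snd (hw : NiceField w) (z : ℂ) : Continuous (potSource w z) :=
  hw.continuous_potSource.comp (f := fun s : ℝ => (z, s)) (by fun_prop)

theorem helmholtzODE (hw : NiceField w) (hz : z ≠ 0) (hs : Complex.sin (z * θ) ≠ 0) :
    HelmholtzODE z (potSource w z) (pot θ w z) (potDeriv θ w z) :=
  helmholtzODE_neumannSol (hw.continuous_potSource_snd z) hz hs _ _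

theorem potDeriv_zero (hs : Complex.sin (z * θ) ≠ 0) :
    potDeriv θ w z 0 = mellinHat w.ang (z - 1) 0 := neumannSolDeriv_zero hs _ _

theorem potDeriv_end (hs : Complex.sin (z * θ) ≠ 0) :
    potDeriv θ w z θ = mellinHat w.ang (z - 1) θ := neumannSolDeriv_end hs _ _

theorem potentialHat_eq_pot (hw : NiceField w) (hz : z ≠ 0)
    (hs : Complex.sin (z * θ) ≠ 0) {φ : ℝ} (hφ : φ ∈ Icc 0 θ) :
    potentialHat θ w z φ = pot θ w z φ := by
  refine integral_green_eq (hw.continuous_potSource_snd z) hz hs _ _ (fun s _ => ?_) hφ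
  rw [(hw.ang.hasDerivAt_mellinHat_snd (z - 1) s).deriv, potSource]

/-- The angle has to be interior: `potentialHat` and `pot` are identified only on [0, θ], while
`deriv` sees a full neighbourhood. -/
theorem deriv_potentialHat_eq (hw : NiceField w) (hz : z ≠ 0)
    (hs : Complex.sin (z * θ) ≠ 0) {φ : ℝ} (hφ : φ ∈ Ioo 0 θ) :
    deriv (fun s => potentialHat θ w z s) φ = potDeriv θ w z φ := by
  have : (fun s => potentialHat θ w z s) =ᶠ[nhds φ] pot θ w z := by
    filter_upwards [Ioo_mem_nhds hφ.1 hφ.2] with s hs'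
    exact hw.potentialHat_eq_pot hz hs ⟨hs'.1.le, hs'.2.le⟩
  rw [this.deriv_eq]
  exact ((hw.helmholtzODE hz hs).hasDerivAt φ).deriv

/-! #### Dependence on the spectral parameter -/

theorem differentiable_mellinHat_shift {f : ℝ → ℝ → ℝ} (hf : Nice f) (φ : ℝ) :
    Differentiable ℂ fun z : ℂ => mellinHat f (z - 1) φ := fun z =>
  ((hf.hasDerivAt_mellinHat_fst (z - 1) φ).comp_sub_const z 1).differentiableAt

/-- Holomorphy in z by differentiation under the integral over a compact interval. The derivative of
the source involves transforms of functions multiplied by log r, which are still `Nice`. -/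
theorem differentiable_integral_potSource (hw : NiceField w) {c c' : ℂ → ℝ → ℂ}
    (hc : Continuous fun p : ℂ × ℝ => c p.1 p.2) (hc' : Continuous fun p : ℂ × ℝ => c' p.1 p.2)
    (hd : ∀ z s, HasDerivAt (fun z => c z s) (c' z s) z) (φ : ℝ) :
    Differentiable ℂ fun z : ℂ => ∫ s in (0 : ℝ)..φ, c z s * potSource w z s := by
  intro z₀
  have h1 : Continuous fun p : ℂ × ℝ => mellinHat w.rad (p.1 - 1) p.2 :=
    hw.rad.continuous_mellinHat.comp (f := fun p : ℂ × ℝ => (p.1 - 1, p.2)) (by fun_prop)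
  have h2 : Continuous fun p : ℂ × ℝ => mellinHat (fun r φ => Real.log r * w.rad r φ) (p.1 - 1) p.2 :=
    hw.rad.log_mul.continuous_mellinHat.comp (f := fun p : ℂ × ℝ => (p.1 - 1, p.2)) (by fun_prop)
  have h3 : Continuous fun p : ℂ × ℝ =>
      mellinHat (fun r φ => Real.log r * dphi w.ang r φ) (p.1 - 1) p.2 :=
    hw.ang.dphi.log_mul.continuous_mellinHat.comp
      (f := fun p : ℂ × ℝ => (p.1 - 1, p.2)) (by fun_prop)
  have hS := hw.continuous_potSource
  set S' : ℂ → ℝ → ℂ := fun z s => (1 * mellinHat w.rad (z - 1) s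
      + z * -mellinHat (fun r φ => Real.log r * w.rad r φ) (z - 1) s)
      + -mellinHat (fun r φ => Real.log r * dphi w.ang r φ) (z - 1) s with hS'
  have hS'c : Continuous fun p : ℂ × ℝ => S' p.1 p.2 :=
    ((continuous_const.mul h1).add (continuous_fst.mul h2.neg)).add h3.neg
  have hSd : ∀ z s, HasDerivAt (fun z => potSource w z s) (S' z s) z := fun z s =>
    ((hasDerivAt_id z).mul ((hw.rad.hasDerivAt_mellinHat_fst (z - 1) s).comp_sub_const z 1)).add
      ((hw.ang.dphi.hasDerivAt_mellinHat_fst (z - 1) s).comp_sub_const z 1)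
  exact (hasDerivAt_intervalIntegral_param (𝕜 := ℂ)
    (G := fun z s => c z s * potSource w z s)
    (G' := fun z s => c' z s * potSource w z s + c z s * S' z s) 0 φ
    (hc.mul hS) ((hc'.mul hS).add (hc.mul hS'c))
    (fun z s => (hd z s).mul (hSd z s)) z₀).differentiableAt

theorem differentiable_cosInt (hw : NiceField w) (φ : ℝ) :
    Differentiable ℂ fun z : ℂ => cosInt z (potSource w z) φ :=
  hw.differentiable_integral_potSource (c := fun z s => Complex.cos (z * s))
    (c' := fun z s => -Complex.sin (z * s) * s) (by fun_prop) (by fun_prop)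
    (fun z s => by simpa using ((hasDerivAt_id z).mul_const (s : ℂ)).ccos) φ

theorem differentiable_sinInt (hw : NiceField w) (φ : ℝ) :
    Differentiable ℂ fun z : ℂ => sinInt z (potSource w z) φ :=
  hw.differentiable_integral_potSource (c := fun z s => Complex.sin (z * s))
    (c' := fun z s => Complex.cos (z * s) * s) (by fun_prop) (by fun_prop)
    (fun z s => by simpa using ((hasDerivAt_id z).mul_const (s : ℂ)).csin) φ

theorem differentiableAt_pot (hw : NiceField w) (hz : z ≠ 0) (hs : Complex.sin (z * θ) ≠ 0)
    (φ : ℝ) : DifferentiableAt ℂ (fun z => pot θ w z φ) z := by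
  have hC := hw.differentiable_cosInt
  have hS := hw.differentiable_sinInt
  have h0 := differentiable_mellinHat_shift hw.ang 0
  have h1 := differentiable_mellinHat_shift hw.ang θ
  have hCθ := hC θ
  have hSθ := hS θ
  have hCφ := hC φ
  have hSφ := hS φ
  unfold pot neumannSol
  have hne : z * Complex.sin (z * θ) ≠ 0 := mul_ne_zero hz hs
  refine DifferentiableAt.add (DifferentiableAt.div ?_ ?_ hne) (DifferentiableAt.div ?_ ?_ hz)
  all_goals fun_prop

theorem differentiableAt_potDeriv (hw : NiceField w) (hs : Complex.sin (z * θ) ≠ 0)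
    (φ : ℝ) : DifferentiableAt ℂ (fun z => potDeriv θ w z φ) z := by
  have hC := hw.differentiable_cosInt
  have hS := hw.differentiable_sinInt
  have h0 := differentiable_mellinHat_shift hw.ang 0
  have h1 := differentiable_mellinHat_shift hw.ang θ
  have hCθ := hC θ
  have hSθ := hS θ
  have hCφ := hC φ
  have hSφ := hS φ
  unfold potDeriv neumannSolDeriv
  refine DifferentiableAt.add (DifferentiableAt.div ?_ ?_ hs) ?_
  all_goals fun_prop

theorem continuous_cosInt (hw : NiceField w) :
    Continuous fun p : ℂ × ℝ => cosInt p.1 (potSource w p.1) p.2 := by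
  have : Continuous fun p : (ℂ × ℝ) × ℝ => potSource w p.1.1 p.2 :=
    hw.continuous_potSource.comp (f := fun p : (ℂ × ℝ) × ℝ => (p.1.1, p.2)) (by fun_prop)
  exact intervalIntegral.continuous_parametric_intervalIntegral_of_continuous
    (f := fun (p : ℂ × ℝ) s => Complex.cos (p.1 * s) * potSource w p.1 s)
    (Continuous.mul (by fun_prop) this) continuous_snd

theorem continuous_sinInt (hw : NiceField w) :
    Continuous fun p : ℂ × ℝ => sinInt p.1 (potSource w p.1) p.2 := by
  have : Continuous fun p : (ℂ × ℝ) × ℝ => potSource w p.1.1 p.2 :=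
    hw.continuous_potSource.comp (f := fun p : (ℂ × ℝ) × ℝ => (p.1.1, p.2)) (by fun_prop)
  exact intervalIntegral.continuous_parametric_intervalIntegral_of_continuous
    (f := fun (p : ℂ × ℝ) s => Complex.sin (p.1 * s) * potSource w p.1 s)
    (Continuous.mul (by fun_prop) this) continuous_snd

section Continuity

variable {X : Type*} [TopologicalSpace X] {ζ : X → ℂ} {ψ : X → ℝ}

theorem continuous_pot (hw : NiceField w) (hζ : Continuous ζ) (hψ : Continuous ψ)
    (h0 : ∀ x, ζ x ≠ 0) (hs : ∀ x, Complex.sin (ζ x * θ) ≠ 0) :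
    Continuous fun x => pot θ w (ζ x) (ψ x) := by
  have hCψ := hw.continuous_cosInt.comp (f := fun x => (ζ x, ψ x)) (by fun_prop)
  have hSψ := hw.continuous_sinInt.comp (f := fun x => (ζ x, ψ x)) (by fun_prop)
  have hCθ := hw.continuous_cosInt.comp (f := fun x => (ζ x, θ)) (by fun_prop)
  have hSθ := hw.continuous_sinInt.comp (f := fun x => (ζ x, θ)) (by fun_prop)
  have hM0 := hw.ang.continuous_mellinHat.comp (f := fun x => (ζ x - 1, (0 : ℝ))) (by fun_prop)
  have hMθ := hw.ang.continuous_mellinHat.comp (f := fun x => (ζ x - 1, θ)) (by fun_prop)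
  simp only [Function.comp_def] at hCψ hSψ hCθ hSθ hM0 hMθ
  unfold pot neumannSol
  refine Continuous.add (Continuous.div ?_ ?_ fun x => mul_ne_zero (h0 x) (hs x))
    (Continuous.div ?_ hζ h0)
  all_goals fun_prop

theorem continuous_potDeriv (hw : NiceField w) (hζ : Continuous ζ) (hψ : Continuous ψ)
    (hs : ∀ x, Complex.sin (ζ x * θ) ≠ 0) :
    Continuous fun x => potDeriv θ w (ζ x) (ψ x) := by
  have hCψ := hw.continuous_cosInt.comp (f := fun x => (ζ x, ψ x)) (by fun_prop)
  have hSψ := hw.continuous_sinInt.comp (f := fun x => (ζ x, ψ x)) (by fun_prop)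
  have hCθ := hw.continuous_cosInt.comp (f := fun x => (ζ x, θ)) (by fun_prop)
  have hSθ := hw.continuous_sinInt.comp (f := fun x => (ζ x, θ)) (by fun_prop)
  have hM0 := hw.ang.continuous_mellinHat.comp (f := fun x => (ζ x - 1, (0 : ℝ))) (by fun_prop)
  have hMθ := hw.ang.continuous_mellinHat.comp (f := fun x => (ζ x - 1, θ)) (by fun_prop)
  simp only [Function.comp_def] at hCψ hSψ hCθ hSθ hM0 hMθ
  unfold potDeriv neumannSolDeriv
  refine Continuous.add (Continuous.div ?_ ?_ hs) ?_
  all_goals fun_prop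

end Continuity

/-- The gradient of the potential decays rapidly in vertical strips. -/
theorem exists_pot_decay (hw : NiceField w) (hθ : 0 < θ) {ρ : ℝ} (hρ0 : 0 ≤ ρ) (hρ : ρ < π / θ)
    (N : ℕ) : ∃ C : ℝ, 0 ≤ C ∧ ∀ z : ℂ, |z.re| ≤ ρ → z ≠ 0 → ∀ φ ∈ Icc 0 θ,
      ‖z * pot θ w z φ‖ * (1 + ‖z‖) ^ N ≤ C ∧ ‖potDeriv θ w z φ‖ * (1 + ‖z‖) ^ N ≤ C := by
  have hk : 0 < π / θ := by positivity
  -- Chosen so that (1-δ)π/θ = ρ, the half-width of the strip.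
  set δ := 1 - ρ / (π / θ) with hδdef
  have hδ : 0 < δ := by rw [hδdef, sub_pos, div_lt_one hk]; exact hρ
  have hδ1 : δ ≤ 1 := by rw [hδdef]; have : 0 ≤ ρ / (π / θ) := by positivity
                         linarith
  have hρe : (1 - δ) * (π / θ) = ρ := by rw [hδdef]; field_simp; ring
  obtain ⟨K, hK, hpt⟩ := HelmholtzODE.exists_pointwise_bound hθ hδ hδ1
  obtain ⟨C₁, hC₁, hb₁⟩ := hw.rad.mellinHat_decay (ρ + 1) θ (N + 3)
  obtain ⟨C₂, hC₂, hb₂⟩ := hw.ang.mellinHat_decay (ρ + 1) θ (N + 3)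
  obtain ⟨C₃, hC₃, hb₃⟩ := hw.ang.dphi.mellinHat_decay (ρ + 1) θ (N + 3)
  set C := 2 ^ (N + 3) * (C₁ + C₂ + C₃) with hC
  have hC0 : 0 ≤ C := by positivity
  refine ⟨K * C, by positivity, fun z hz hz0 => ?_⟩
  have hs : Complex.sin (z * θ) ≠ 0 := sin_mul_ne_zero hθ hz0 (hz.trans_lt hρ)
  have hp : 0 < 1 + ‖z‖ := by positivity
  -- Three spare powers, because the pointwise bound loses (1 + |z|)³.
  set m := C / (1 + ‖z‖) ^ (N + 3) with hm
  have hre : |(z - 1).re| ≤ ρ + 1 := by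
    simp only [Complex.sub_re, Complex.one_re]
    exact (abs_sub _ _).trans (by simpa using hz)
  have hconv : ∀ {a : ℂ} {D : ℝ}, D ≤ C₁ + C₂ + C₃ → ‖a‖ * (1 + ‖z - 1‖) ^ (N + 3) ≤ D →
      ‖a‖ ≤ m := by
    intro a D hD ha
    rw [hm, le_div_iff₀ (by positivity)]
    have h1 : 1 + ‖z‖ ≤ 2 * (1 + ‖z - 1‖) := by
      have := norm_add_le (z - 1) 1
      rw [sub_add_cancel, norm_one] at this
      linarith [norm_nonneg (z - 1)]
    calc ‖a‖ * (1 + ‖z‖) ^ (N + 3) ≤ ‖a‖ * (2 * (1 + ‖z - 1‖)) ^ (N + 3) := by gcongr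
      _ = 2 ^ (N + 3) * (‖a‖ * (1 + ‖z - 1‖) ^ (N + 3)) := by rw [mul_pow]; ring
      _ ≤ 2 ^ (N + 3) * (C₁ + C₂ + C₃) := by gcongr; exact ha.trans hD
  have hm₁ : ∀ φ ∈ Icc 0 θ, ‖mellinHat w.rad (z - 1) φ‖ ≤ m := fun φ hφ =>
    hconv (by linarith) (hb₁ _ hre φ hφ)
  have hm₂ : ∀ φ ∈ Icc 0 θ, ‖mellinHat w.ang (z - 1) φ‖ ≤ m := fun φ hφ =>
    hconv (by linarith) (hb₂ _ hre φ hφ)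
  have hm₃ : ∀ φ ∈ Icc 0 θ, ‖mellinHat (dphi w.ang) (z - 1) φ‖ ≤ m := fun φ hφ =>
    hconv (by linarith) (hb₃ _ hre φ hφ)
  have hθ0 : (0 : ℝ) ∈ Icc 0 θ := ⟨le_rfl, hθ.le⟩
  have hθθ : θ ∈ Icc 0 θ := ⟨hθ.le, le_rfl⟩
  have h1 : Continuous fun s : ℝ => mellinHat w.rad (z - 1) s :=
    hw.rad.continuous_mellinHat.comp (f := fun s : ℝ => (z - 1, s)) (by fun_prop)
  have h3 : Continuous fun s : ℝ => mellinHat (dphi w.ang) (z - 1) s :=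
    hw.ang.dphi.continuous_mellinHat.comp (f := fun s : ℝ => (z - 1, s)) (by fun_prop)
  -- The integral of ∂_φ ŵ_φ cancels against the Neumann data. What remains has the factor z that
  -- the pointwise bound needs near z = 0.
  have hmean : (∫ x in (0 : ℝ)..θ, potSource w z x) - (potDeriv θ w z θ - potDeriv θ w z 0)
      = z * ∫ x in (0 : ℝ)..θ, mellinHat w.rad (z - 1) x := by
    simp only [potSource]
    rw [intervalIntegral.integral_add ((h1.const_mul z).intervalIntegrable _ _)
      (h3.intervalIntegrable _ _), intervalIntegral.integral_eq_sub_of_hasDerivAt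
      (fun s _ => hw.ang.hasDerivAt_mellinHat_snd (z - 1) s) (h3.intervalIntegrable _ _),
      potDeriv_zero hs, potDeriv_end hs, intervalIntegral.integral_const_mul]
    ring
  have hfin := hpt z _ _ _ m (hw.helmholtzODE hz0 hs) (by rw [hρe]; exact hz) hz0
    (by rw [potDeriv_zero hs]; exact hm₂ 0 hθ0) (by rw [potDeriv_end hs]; exact hm₂ θ hθθ)
    (fun x hx => by
      have h4 : ‖z * mellinHat w.rad (z - 1) x‖ ≤ ‖z‖ * m := by
        rw [norm_mul]; gcongr; exact hm₁ x hx
      have := norm_add_le (z * mellinHat w.rad (z - 1) x) (mellinHat (dphi w.ang) (z - 1) x)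
      rw [potSource]
      linarith [hm₃ x hx])
    (by
      rw [hmean, norm_mul]
      gcongr
      have := intervalIntegral.norm_integral_le_of_norm_le_const (a := 0) (b := θ)
        (f := fun x => mellinHat w.rad (z - 1) x) (C := m) fun x hx => by
          rw [uIoc_of_le hθ.le] at hx
          exact hm₁ x ⟨hx.1.le, hx.2⟩
      rw [sub_zero, abs_of_pos hθ] at this
      linarith)
  have hKm : K * (1 + ‖z‖) ^ 3 * m * (1 + ‖z‖) ^ N = K * C := by
    rw [hm, pow_add]; field_simp
  intro φ hφ
  obtain ⟨ha, hb⟩ := hfin φ hφ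
  constructor
  · rw [← hKm]; gcongr
  · rw [← hKm]; gcongr

end NiceField

end Wedge

end

noncomputable section

namespace Wedge

/-! ### Inverse Mellin transforms of rapidly decaying symbols -/

/-- Continuous functions on the line `Re z = γ` and the interval `[0, θ]` that decay at least
quadratically. -/
structure LineSymbol (θ γ : ℝ) (F : ℂ → ℝ → ℂ) : Prop where
  continuous : Continuous fun p : ℝ × ℝ => F ((γ : ℂ) + (p.1 : ℂ) * Complex.I) p.2
  bound : ∃ C : ℝ, ∀ t : ℝ, ∀ φ ∈ Icc 0 θ,
    ‖F ((γ : ℂ) + (t : ℂ) * Complex.I) φ‖ ≤ C * (1 + t ^ 2)⁻¹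

theorem norm_cpow_line {r : ℝ} (hr : 0 < r) (γ t : ℝ) :
    ‖(r : ℂ) ^ ((γ : ℂ) + (t : ℂ) * Complex.I)‖ = r ^ γ := by
  rw [Complex.norm_cpow_eq_rpow_re_of_pos hr]; simp

theorem cpow_eq_exp_log {r : ℝ} (hr : 0 < r) (z : ℂ) :
    (r : ℂ) ^ z = Complex.exp (Real.log r * z) := by
  rw [Complex.cpow_def_of_ne_zero (by exact_mod_cast hr.ne'), Complex.ofReal_log hr.le]

theorem continuous_cpow_line {r : ℝ} (hr : 0 < r) (γ : ℝ) :
    Continuous fun t : ℝ => (r : ℂ) ^ ((γ : ℂ) + (t : ℂ) * Complex.I) := by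
  simp_rw [cpow_eq_exp_log hr]
  fun_prop

namespace LineSymbol

variable {θ γ : ℝ} {F F' : ℂ → ℝ → ℂ}

theorem continuous_fst (hF : LineSymbol θ γ F) (φ : ℝ) :
    Continuous fun t : ℝ => F ((γ : ℂ) + (t : ℂ) * Complex.I) φ :=
  hF.continuous.comp (f := fun t : ℝ => (t, φ)) (by fun_prop)

theorem integrable (hF : LineSymbol θ γ F) {φ : ℝ} (hφ : φ ∈ Icc 0 θ) :
    Integrable fun t : ℝ => F ((γ : ℂ) + (t : ℂ) * Complex.I) φ := by
  obtain ⟨C, hC⟩ := hF.bound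
  exact Integrable.mono' (integrable_inv_one_add_sq.const_mul C)
    (hF.continuous_fst φ).aestronglyMeasurable (Filter.Eventually.of_forall fun t => hC t φ hφ)

theorem exists_nhds_rpow_le {r : ℝ} (hr : 0 < r) (γ : ℝ) :
    {y : ℝ | 0 < y ∧ y ^ γ ≤ r ^ γ + 1} ∈ nhds r := by
  have h1 : ∀ᶠ y : ℝ in nhds r, 0 < y := eventually_gt_nhds hr
  have h2 : ContinuousAt (fun y : ℝ => y ^ γ) r :=
    Real.continuousAt_rpow_const r γ (Or.inl hr.ne')
  have h3 : ∀ᶠ y : ℝ in nhds r, y ^ γ < r ^ γ + 1 :=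
    h2.eventually_lt continuousAt_const (by linarith)
  filter_upwards [h1, h3] with y hy hy' using ⟨hy, hy'.le⟩

theorem integrand_bound {C : ℝ} (hC : ∀ t : ℝ, ∀ φ ∈ Icc 0 θ,
    ‖F ((γ : ℂ) + (t : ℂ) * Complex.I) φ‖ ≤ C * (1 + t ^ 2)⁻¹) {r M σ : ℝ} (hr : 0 < r)
    (hM : r ^ σ ≤ M) {φ : ℝ} (hφ : φ ∈ Icc 0 θ) (t : ℝ) :
    ‖(r : ℂ) ^ ((σ : ℂ) + (t : ℂ) * Complex.I) * F ((γ : ℂ) + (t : ℂ) * Complex.I) φ‖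
      ≤ M * C * (1 + t ^ 2)⁻¹ := by
  rw [norm_mul, norm_cpow_line hr, mul_assoc]
  have : 0 ≤ r ^ σ := (Real.rpow_pos_of_pos hr σ).le
  exact mul_le_mul hM (hC t φ hφ) (norm_nonneg _) (this.trans hM)

theorem integrable_integrand (hF : LineSymbol θ γ F) {r : ℝ} (hr : 0 < r) {φ : ℝ}
    (hφ : φ ∈ Icc 0 θ) : Integrable fun t : ℝ =>
      (r : ℂ) ^ ((γ : ℂ) + (t : ℂ) * Complex.I) * F ((γ : ℂ) + (t : ℂ) * Complex.I) φ := by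
  obtain ⟨C, hC⟩ := hF.bound
  exact Integrable.mono' (integrable_inv_one_add_sq.const_mul (r ^ γ * C))
    ((continuous_cpow_line hr γ).mul (hF.continuous_fst φ)).aestronglyMeasurable
    (Filter.Eventually.of_forall fun t => integrand_bound hC hr le_rfl hφ t)

theorem continuousOn_mellinHatInv (hF : LineSymbol θ γ F) :
    ContinuousOn (fun p : ℝ × ℝ => mellinHatInv γ F p.1 p.2) (Ioi 0 ×ˢ Icc 0 θ) := by
  obtain ⟨C, hC⟩ := hF.bound
  intro p hp
  refine ContinuousWithinAt.mul continuousWithinAt_const ?_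
  refine continuousWithinAt_of_dominated
    (bound := fun t : ℝ => (p.1 ^ γ + 1) * C * (1 + t ^ 2)⁻¹) ?_ ?_ ?_ ?_
  · filter_upwards [self_mem_nhdsWithin] with q hq
    exact ((continuous_cpow_line hq.1 γ).mul (hF.continuous_fst q.2)).aestronglyMeasurable
  · have : {q : ℝ × ℝ | 0 < q.1 ∧ q.1 ^ γ ≤ p.1 ^ γ + 1} ∈ nhds p :=
      _root_.continuous_fst.continuousAt (exists_nhds_rpow_le hp.1 γ)
    filter_upwards [self_mem_nhdsWithin, mem_nhdsWithin_of_mem_nhds this] with q hq hq'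
    exact Filter.Eventually.of_forall fun t => integrand_bound hC hq'.1 hq'.2 hq.2 t
  · exact integrable_inv_one_add_sq.const_mul _
  · refine Filter.Eventually.of_forall fun t => ContinuousAt.continuousWithinAt ?_
    refine ContinuousAt.mul ?_ ?_
    · have h1 : ContinuousAt (fun y : ℝ => (y : ℂ) ^ ((γ : ℂ) + (t : ℂ) * Complex.I)) p.1 :=
        Complex.continuousAt_ofReal_cpow_const _ _ (Or.inr hp.1.ne')
      exact h1.comp _root_.continuous_fst.continuousAt
    · exact (hF.continuous.comp (f := fun q : ℝ × ℝ => (t, q.2)) (by fun_prop)).continuousAt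

/-- Differentiating r^z brings down z/r, which is why zF must satisfy the same decay as F; r^{γ-1}
is bounded near r, so the derivatives are dominated. -/
theorem hasDerivAt_mellinHatInv_fst (hF : LineSymbol θ γ F)
    (hF' : LineSymbol θ γ fun z φ => z * F z φ) {r φ : ℝ} (hr : 0 < r) (hφ : φ ∈ Icc 0 θ) :
    HasDerivAt (fun s => mellinHatInv γ F s φ)
      ((r : ℂ)⁻¹ * mellinHatInv γ (fun z φ => z * F z φ) r φ) r := by
  obtain ⟨C, hC⟩ := hF'.bound
  have hd : ∀ (t y : ℝ), 0 < y → HasDerivAt (fun y : ℝ =>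
      (y : ℂ) ^ ((γ : ℂ) + (t : ℂ) * Complex.I) * F ((γ : ℂ) + (t : ℂ) * Complex.I) φ)
      ((y : ℂ) ^ (((γ - 1 : ℝ) : ℂ) + (t : ℂ) * Complex.I) *
        (((γ : ℂ) + (t : ℂ) * Complex.I) * F ((γ : ℂ) + (t : ℂ) * Complex.I) φ)) y := by
    intro t y hy
    have h1 : HasDerivAt (fun w : ℂ => w ^ ((γ : ℂ) + (t : ℂ) * Complex.I)) _ (y : ℂ) :=
      (hasDerivAt_id (y : ℂ)).cpow_const (c := (γ : ℂ) + (t : ℂ) * Complex.I)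
        (Or.inl (by simpa using hy))
    refine (h1.comp_ofReal.mul_const _).congr_deriv ?_
    have : ((γ - 1 : ℝ) : ℂ) + (t : ℂ) * Complex.I = (γ : ℂ) + (t : ℂ) * Complex.I - 1 := by
      push_cast; ring
    rw [this]
    simp only [id]
    ring
  have key := (hasDerivAt_integral_of_dominated_loc_of_deriv_le (μ := volume)
    (F := fun (y : ℝ) (t : ℝ) => (y : ℂ) ^ ((γ : ℂ) + (t : ℂ) * Complex.I) *
      F ((γ : ℂ) + (t : ℂ) * Complex.I) φ)
    (F' := fun (y : ℝ) (t : ℝ) => (y : ℂ) ^ (((γ - 1 : ℝ) : ℂ) + (t : ℂ) * Complex.I) *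
        (((γ : ℂ) + (t : ℂ) * Complex.I) * F ((γ : ℂ) + (t : ℂ) * Complex.I) φ))
    (bound := fun t : ℝ => (r ^ (γ - 1) + 1) * C * (1 + t ^ 2)⁻¹)
    (exists_nhds_rpow_le hr (γ - 1)) ?_ (hF.integrable_integrand hr hφ) ?_ ?_ ?_ ?_).2
  · have e : (r : ℂ)⁻¹ * mellinHatInv γ (fun z φ => z * F z φ) r φ = (√(2 * π) : ℂ)⁻¹ *
        ∫ t : ℝ, (r : ℂ) ^ (((γ - 1 : ℝ) : ℂ) + (t : ℂ) * Complex.I) *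
        (((γ : ℂ) + (t : ℂ) * Complex.I) * F ((γ : ℂ) + (t : ℂ) * Complex.I) φ) := by
      rw [mellinHatInv, mul_left_comm, ← MeasureTheory.integral_const_mul]
      congr 1
      refine integral_congr_ae (Filter.Eventually.of_forall fun t => ?_)
      have h0 : (r : ℂ) ≠ 0 := by exact_mod_cast hr.ne'
      have : ((γ - 1 : ℝ) : ℂ) + (t : ℂ) * Complex.I = (γ : ℂ) + (t : ℂ) * Complex.I - 1 := by
        push_cast; ring
      simp only [this, Complex.cpow_sub _ _ h0, Complex.cpow_one]
      field_simp
    rw [e]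
    exact key.const_mul _
  · filter_upwards [eventually_gt_nhds hr] with y hy
    exact (hF.integrable_integrand hy hφ).aestronglyMeasurable
  · exact ((continuous_cpow_line hr (γ - 1)).mul (hF'.continuous_fst φ)).aestronglyMeasurable
  · exact Filter.Eventually.of_forall fun t y hy =>
      integrand_bound (F := fun z φ => z * F z φ) hC hy.1 hy.2 hφ t
  · exact integrable_inv_one_add_sq.const_mul _
  · exact Filter.Eventually.of_forall fun t y hy => hd t y hy.1

theorem hasDerivAt_mellinHatInv_snd (hF : LineSymbol θ γ F) (hF' : LineSymbol θ γ F')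
    (hd : ∀ (t : ℝ) (φ : ℝ), HasDerivAt (F ((γ : ℂ) + (t : ℂ) * Complex.I))
      (F' ((γ : ℂ) + (t : ℂ) * Complex.I) φ) φ) {r φ : ℝ} (hr : 0 < r) (hφ : φ ∈ Ioo 0 θ) :
    HasDerivAt (fun s => mellinHatInv γ F r s) (mellinHatInv γ F' r φ) φ := by
  obtain ⟨C, hC⟩ := hF'.bound
  refine HasDerivAt.const_mul _ ?_
  refine (hasDerivAt_integral_of_dominated_loc_of_deriv_le (μ := volume)
    (F := fun (s : ℝ) (t : ℝ) => (r : ℂ) ^ ((γ : ℂ) + (t : ℂ) * Complex.I) *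
      F ((γ : ℂ) + (t : ℂ) * Complex.I) s)
    (F' := fun (s : ℝ) (t : ℝ) => (r : ℂ) ^ ((γ : ℂ) + (t : ℂ) * Complex.I) *
      F' ((γ : ℂ) + (t : ℂ) * Complex.I) s)
    (bound := fun t : ℝ => r ^ γ * C * (1 + t ^ 2)⁻¹)
    (Ioo_mem_nhds hφ.1 hφ.2) ?_ (hF.integrable_integrand hr ⟨hφ.1.le, hφ.2.le⟩) ?_ ?_ ?_ ?_).2
  · exact Filter.Eventually.of_forall fun s =>
      ((continuous_cpow_line hr γ).mul (hF.continuous_fst s)).aestronglyMeasurable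
  · exact ((continuous_cpow_line hr γ).mul (hF'.continuous_fst φ)).aestronglyMeasurable
  · exact Filter.Eventually.of_forall fun t s hs =>
      integrand_bound hC hr le_rfl ⟨hs.1.le, hs.2.le⟩ t
  · exact integrable_inv_one_add_sq.const_mul _
  · exact Filter.Eventually.of_forall fun t s _ => (hd t s).const_mul _

/-- Parseval's identity for the inverse Mellin transform of a symbol. -/
theorem integral_mellinHatInv_mul (hF : LineSymbol θ γ F) {L : ℝ → ℝ → ℝ} (hL : Nice L)
    {κ α φ : ℝ} (hα : γ + κ = -α) (hφ : φ ∈ Icc 0 θ) :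
    ∫ r in Ioi (0 : ℝ), r ^ (κ - 1) * ((mellinHatInv γ F r φ).re * L r φ)
      = (∫ t : ℝ, F ((γ : ℂ) + (t : ℂ) * Complex.I) φ *
          (starRingEnd ℂ) (mellinHat L ((α : ℂ) + (t : ℂ) * Complex.I) φ)).re := by
  rw [integral_Ioi_eq_integral_exp]
  -- the integrand of the double integral
  set H : ℝ → ℝ → ℂ := fun x t => (√(2 * π) : ℂ)⁻¹ *
    (Complex.exp ((-(α : ℂ) + t * Complex.I) * x) * (L (Real.exp x) φ : ℂ) *
      F ((γ : ℂ) + (t : ℂ) * Complex.I) φ) with hH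
  have hleft : ∀ x : ℝ, Real.exp x • (Real.exp x ^ (κ - 1) *
      ((mellinHatInv γ F (Real.exp x) φ).re * L (Real.exp x) φ)) = (∫ t, H x t).re := by
    intro x
    have e : ∫ t, H x t = ((Real.exp (κ * x) * L (Real.exp x) φ : ℝ) : ℂ) *
        mellinHatInv γ F (Real.exp x) φ := by
      rw [mellinHatInv, mul_left_comm, ← MeasureTheory.integral_const_mul,
        ← MeasureTheory.integral_const_mul]
      refine integral_congr_ae (Filter.Eventually.of_forall fun t => ?_)
      simp only [hH]
      rw [cpow_eq_exp_log (Real.exp_pos x), Real.log_exp]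
      have : Complex.exp ((-(α : ℂ) + t * Complex.I) * x) = Complex.exp ((κ * x : ℝ) : ℂ) *
          Complex.exp (x * ((γ : ℂ) + t * Complex.I)) := by
        rw [← Complex.exp_add]
        congr 1
        have : (-(α : ℂ)) = γ + κ := by exact_mod_cast hα.symm
        rw [this]; push_cast; ring
      rw [this]; push_cast; ring
    rw [e, Complex.re_ofReal_mul, ← Real.exp_mul, smul_eq_mul, ← mul_assoc, ← Real.exp_add]
    have : x + x * (κ - 1) = κ * x := by ring
    rw [this]; ring
  simp_rw [hleft]
  have hprod : Integrable (Function.uncurry H) (volume.prod volume) := by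
    have hLi := (hL.integrable_mellin (α : ℂ) φ)
    have hm := (hLi.mul_prod (hF.integrable hφ)).const_mul ((√(2 * π) : ℂ)⁻¹)
    refine hm.mono ?_ (Filter.Eventually.of_forall fun p => le_of_eq ?_)
    · refine Continuous.aestronglyMeasurable ?_
      have h1 : Continuous fun p : ℝ × ℝ => L (Real.exp p.1) φ :=
        hL.continuous.comp (f := fun p : ℝ × ℝ => (Real.exp p.1, φ)) (by fun_prop)
      have h2 : Continuous fun p : ℝ × ℝ => F ((γ : ℂ) + (p.2 : ℂ) * Complex.I) φ :=
        (hF.continuous_fst φ).comp _root_.continuous_snd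
      have h3 := Complex.continuous_ofReal.comp h1
      simp only [Function.comp_def] at h3
      exact continuous_const.mul ((Continuous.mul (by fun_prop) h3).mul h2)
    · simp only [Function.uncurry_def, hH, norm_mul, Complex.norm_exp]
      simp
  have hre : ∫ x, (∫ t, H x t).re = (∫ x, ∫ t, H x t).re :=
    Complex.reCLM.integral_comp_comm (μ := volume) hprod.integral_prod_left
  rw [hre, integral_integral_swap hprod]
  congr 1
  refine integral_congr_ae (Filter.Eventually.of_forall fun t => ?_)
  simp only [hH]
  rw [← Nice.mellinHat_conj, mellinHat_eq_integral, mul_left_comm,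
    ← MeasureTheory.integral_const_mul, ← MeasureTheory.integral_const_mul]
  refine integral_congr_ae (Filter.Eventually.of_forall fun x => ?_)
  simp only [map_add, map_mul, Complex.conj_ofReal, Complex.conj_I]
  have : -((α : ℂ) + t * -Complex.I) * x = (-(α : ℂ) + t * Complex.I) * x := by ring
  rw [this]
  ring

end LineSymbol

end Wedge

end

/-! ### The gradient of the potential and its independence of the line -/

noncomputable section

namespace Wedge

/-- The Mellin transform of the radial part of the gradient of the potential. -/
def gradRadHat (θ : ℝ) (w : PolarField) (z : ℂ) (φ : ℝ) : ℂ := (z + 1) * pot θ w (z + 1) φ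

/-- The Mellin transform of the angular part of the gradient of the potential. -/
def gradAngHat (θ : ℝ) (w : PolarField) (z : ℂ) (φ : ℝ) : ℂ := potDeriv θ w (z + 1) φ

/-- The angular derivative of `gradRadHat`. -/
def gradRadHatDeriv (θ : ℝ) (w : PolarField) (z : ℂ) (φ : ℝ) : ℂ :=
  (z + 1) * potDeriv θ w (z + 1) φ

/-- The angular derivative of `gradAngHat`. -/
def gradAngHatDeriv (θ : ℝ) (w : PolarField) (z : ℂ) (φ : ℝ) : ℂ :=
  potSource w (z + 1) φ - (z + 1) ^ 2 * pot θ w (z + 1) φ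

theorem line_add_one (γ t : ℝ) :
    (γ : ℂ) + (t : ℂ) * Complex.I + 1 = ((γ + 1 : ℝ) : ℂ) + (t : ℂ) * Complex.I := by
  push_cast; ring

/-- The symbols are singular at z = -1. Either the whole line avoids this point or, on the line
through it, the single parameter t = 0 has to be left out. -/
theorem line_ne_zero {γ t : ℝ} (h : γ + 1 ≠ 0 ∨ t ≠ 0) :
    (γ : ℂ) + (t : ℂ) * Complex.I + 1 ≠ 0 := by
  intro h0
  have h1 := congrArg Complex.re h0
  have h2 := congrArg Complex.im h0
  simp at h1 h2
  exact h.elim (fun h => h h1) (fun h => h h2)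

theorem line_re (γ t : ℝ) : ((γ : ℂ) + (t : ℂ) * Complex.I + 1).re = γ + 1 := by simp

theorem one_add_sq_le_norm (γ t : ℝ) :
    1 + t ^ 2 ≤ (1 + ‖(γ : ℂ) + (t : ℂ) * Complex.I + 1‖) ^ 2 := by
  set z := (γ : ℂ) + (t : ℂ) * Complex.I + 1 with hz
  have h1 : |z.im| ≤ ‖z‖ := Complex.abs_im_le_norm z
  have h2 : z.im = t := by simp [hz]
  rw [h2] at h1
  have h3 : t ^ 2 ≤ ‖z‖ ^ 2 := by rw [← sq_abs]; gcongr
  nlinarith [norm_nonneg z]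

theorem le_mul_inv_one_add_sq {γ t a C : ℝ} (ha : 0 ≤ a)
    (h : a * (1 + ‖(γ : ℂ) + (t : ℂ) * Complex.I + 1‖) ^ 2 ≤ C) : a ≤ C * (1 + t ^ 2)⁻¹ := by
  rw [← div_eq_mul_inv, le_div_iff₀ (by positivity)]
  exact (mul_le_mul_of_nonneg_left (one_add_sq_le_norm γ t) ha).trans h

theorem potSource_decay {w : PolarField} (hw : NiceField w) (ρ θ : ℝ) : ∃ C : ℝ,
    ∀ z : ℂ, |z.re| ≤ ρ → ∀ φ ∈ Icc 0 θ, ‖potSource w z φ‖ * (1 + ‖z‖) ^ 2 ≤ C := by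
  obtain ⟨C₁, hC₁, hb₁⟩ := hw.rad.mellinHat_decay (ρ + 1) θ 3
  obtain ⟨C₂, hC₂, hb₂⟩ := hw.ang.dphi.mellinHat_decay (ρ + 1) θ 2
  refine ⟨8 * C₁ + 4 * C₂, fun z hz φ hφ => ?_⟩
  have hre : |(z - 1).re| ≤ ρ + 1 := by
    simp only [Complex.sub_re, Complex.one_re]
    exact (abs_sub _ _).trans (by simpa using hz)
  have h1 := hb₁ _ hre φ hφ
  have h2 := hb₂ _ hre φ hφ
  have hn : 1 + ‖z‖ ≤ 2 * (1 + ‖z - 1‖) := by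
    have := norm_add_le (z - 1) 1
    rw [sub_add_cancel, norm_one] at this
    linarith [norm_nonneg (z - 1)]
  set a := ‖mellinHat w.rad (z - 1) φ‖
  set b := ‖mellinHat (dphi w.ang) (z - 1) φ‖
  have hs : ‖potSource w z φ‖ ≤ (1 + ‖z‖) * a + b := by
    refine (norm_add_le _ _).trans ?_
    rw [norm_mul]
    gcongr
    linarith
  calc ‖potSource w z φ‖ * (1 + ‖z‖) ^ 2 ≤ ((1 + ‖z‖) * a + b) * (1 + ‖z‖) ^ 2 := by gcongr
    _ = a * (1 + ‖z‖) ^ 3 + b * (1 + ‖z‖) ^ 2 := by ring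
    _ ≤ a * (2 * (1 + ‖z - 1‖)) ^ 3 + b * (2 * (1 + ‖z - 1‖)) ^ 2 := by gcongr
    _ = 8 * (a * (1 + ‖z - 1‖) ^ 3) + 4 * (b * (1 + ‖z - 1‖) ^ 2) := by ring
    _ ≤ 8 * C₁ + 4 * C₂ := by gcongr

namespace NiceField

variable {w : PolarField} {θ γ : ℝ}

section Symbols

variable (hw : NiceField w) (hθ : 0 < θ) (hγ : |γ + 1| < π / θ) (hγ0 : γ + 1 ≠ 0)

include hw hθ hγ hγ0

theorem lineSymbol_rad : LineSymbol θ γ (gradRadHat θ w) := by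
  have hne : ∀ p : ℝ × ℝ, (γ : ℂ) + (p.1 : ℂ) * Complex.I + 1 ≠ 0 := fun p =>
    line_ne_zero (Or.inl hγ0)
  refine ⟨Continuous.mul (by fun_prop) (hw.continuous_pot (by fun_prop) continuous_snd hne
    fun p => sin_mul_ne_zero hθ (hne p) (by rwa [line_re])), ?_⟩
  obtain ⟨C, -, hC⟩ := hw.exists_pot_decay hθ (abs_nonneg _) hγ 2
  exact ⟨C, fun t φ hφ => le_mul_inv_one_add_sq (norm_nonneg _)
    (hC _ (by rw [line_re]) (hne (t, φ)) φ hφ).1⟩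

theorem lineSymbol_ang : LineSymbol θ γ (gradAngHat θ w) := by
  have hne : ∀ p : ℝ × ℝ, (γ : ℂ) + (p.1 : ℂ) * Complex.I + 1 ≠ 0 := fun p =>
    line_ne_zero (Or.inl hγ0)
  refine ⟨hw.continuous_potDeriv (by fun_prop) continuous_snd
    fun p => sin_mul_ne_zero hθ (hne p) (by rwa [line_re]), ?_⟩
  obtain ⟨C, -, hC⟩ := hw.exists_pot_decay hθ (abs_nonneg _) hγ 2
  exact ⟨C, fun t φ hφ => le_mul_inv_one_add_sq (norm_nonneg _)
    (hC _ (by rw [line_re]) (hne (t, φ)) φ hφ).2⟩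

omit hw hθ hγ hγ0 in
theorem mul_decay {a z : ℂ} {C : ℝ} (h : ‖a‖ * (1 + ‖z + 1‖) ^ 3 ≤ C) :
    ‖z * a‖ * (1 + ‖z + 1‖) ^ 2 ≤ C := by
  have h1 : ‖z‖ ≤ 1 + ‖z + 1‖ := by
    have := norm_sub_le (z + 1) 1
    rw [add_sub_cancel_right, norm_one] at this
    linarith
  calc ‖z * a‖ * (1 + ‖z + 1‖) ^ 2 = ‖z‖ * ‖a‖ * (1 + ‖z + 1‖) ^ 2 := by rw [norm_mul]
    _ ≤ (1 + ‖z + 1‖) * ‖a‖ * (1 + ‖z + 1‖) ^ 2 := by gcongr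
    _ = ‖a‖ * (1 + ‖z + 1‖) ^ 3 := by ring
    _ ≤ C := h

omit hw hθ hγ hγ0 in
theorem mul_decay' {a z : ℂ} {C : ℝ} (h : ‖a‖ * (1 + ‖z + 1‖) ^ 3 ≤ C) :
    ‖(z + 1) * a‖ * (1 + ‖z + 1‖) ^ 2 ≤ C := by
  calc ‖(z + 1) * a‖ * (1 + ‖z + 1‖) ^ 2 = ‖z + 1‖ * ‖a‖ * (1 + ‖z + 1‖) ^ 2 := by rw [norm_mul]
    _ ≤ (1 + ‖z + 1‖) * ‖a‖ * (1 + ‖z + 1‖) ^ 2 := by gcongr; linarith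
    _ = ‖a‖ * (1 + ‖z + 1‖) ^ 3 := by ring
    _ ≤ C := h

theorem lineSymbol_mul_rad : LineSymbol θ γ (fun z φ => z * gradRadHat θ w z φ) := by
  have hne : ∀ p : ℝ × ℝ, (γ : ℂ) + (p.1 : ℂ) * Complex.I + 1 ≠ 0 := fun p =>
    line_ne_zero (Or.inl hγ0)
  refine ⟨Continuous.mul (by fun_prop) (hw.lineSymbol_rad hθ hγ hγ0).continuous, ?_⟩
  obtain ⟨C, -, hC⟩ := hw.exists_pot_decay hθ (abs_nonneg _) hγ 3
  exact ⟨C, fun t φ hφ => le_mul_inv_one_add_sq (norm_nonneg _)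
    (mul_decay (hC _ (by rw [line_re]) (hne (t, φ)) φ hφ).1)⟩

theorem lineSymbol_mul_ang : LineSymbol θ γ (fun z φ => z * gradAngHat θ w z φ) := by
  have hne : ∀ p : ℝ × ℝ, (γ : ℂ) + (p.1 : ℂ) * Complex.I + 1 ≠ 0 := fun p =>
    line_ne_zero (Or.inl hγ0)
  refine ⟨Continuous.mul (by fun_prop) (hw.lineSymbol_ang hθ hγ hγ0).continuous, ?_⟩
  obtain ⟨C, -, hC⟩ := hw.exists_pot_decay hθ (abs_nonneg _) hγ 3
  exact ⟨C, fun t φ hφ => le_mul_inv_one_add_sq (norm_nonneg _)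
    (mul_decay (hC _ (by rw [line_re]) (hne (t, φ)) φ hφ).2)⟩

theorem lineSymbol_radDeriv : LineSymbol θ γ (gradRadHatDeriv θ w) := by
  have hne : ∀ p : ℝ × ℝ, (γ : ℂ) + (p.1 : ℂ) * Complex.I + 1 ≠ 0 := fun p =>
    line_ne_zero (Or.inl hγ0)
  refine ⟨Continuous.mul (by fun_prop) (hw.lineSymbol_ang hθ hγ hγ0).continuous, ?_⟩
  obtain ⟨C, -, hC⟩ := hw.exists_pot_decay hθ (abs_nonneg _) hγ 3
  exact ⟨C, fun t φ hφ => le_mul_inv_one_add_sq (norm_nonneg _)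
    (mul_decay' (hC _ (by rw [line_re]) (hne (t, φ)) φ hφ).2)⟩

theorem lineSymbol_angDeriv : LineSymbol θ γ (gradAngHatDeriv θ w) := by
  have hne : ∀ p : ℝ × ℝ, (γ : ℂ) + (p.1 : ℂ) * Complex.I + 1 ≠ 0 := fun p =>
    line_ne_zero (Or.inl hγ0)
  refine ⟨Continuous.sub (hw.continuous_potSource.comp
    (f := fun p : ℝ × ℝ => ((γ : ℂ) + (p.1 : ℂ) * Complex.I + 1, p.2)) (by fun_prop))
    (Continuous.mul (by fun_prop) (hw.continuous_pot (by fun_prop) continuous_snd hne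
    fun p => sin_mul_ne_zero hθ (hne p) (by rwa [line_re]))), ?_⟩
  obtain ⟨C, -, hC⟩ := hw.exists_pot_decay hθ (abs_nonneg _) hγ 3
  obtain ⟨C', hC'⟩ := potSource_decay hw |γ + 1| θ
  refine ⟨C' + C, fun t φ hφ => le_mul_inv_one_add_sq (γ := γ) (norm_nonneg _) ?_⟩
  have h1 := mul_decay' (hC _ (by rw [line_re]) (hne (t, φ)) φ hφ).1
  have h2 := hC' ((γ : ℂ) + (t : ℂ) * Complex.I + 1) (by rw [line_re]) φ hφ
  simp only [gradAngHatDeriv]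
  generalize (γ : ℂ) + (t : ℂ) * Complex.I + 1 = z at *
  rw [← mul_assoc, ← pow_two] at h1
  calc _ ≤ (‖potSource w z φ‖ + ‖z ^ 2 * pot θ w z φ‖) * (1 + ‖z‖) ^ 2 := by
        gcongr; exact norm_sub_le _ _
    _ ≤ _ := by rw [add_mul]; exact add_le_add h2 h1

theorem hasDerivAt_gradRadHat (t φ : ℝ) :
    HasDerivAt (gradRadHat θ w ((γ : ℂ) + (t : ℂ) * Complex.I))
      (gradRadHatDeriv θ w ((γ : ℂ) + (t : ℂ) * Complex.I) φ) φ := by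
  have hne := line_ne_zero (t := t) (Or.inl hγ0)
  exact ((hw.helmholtzODE hne (sin_mul_ne_zero hθ hne (by rwa [line_re]))).hasDerivAt φ).const_mul _

theorem hasDerivAt_gradAngHat (t φ : ℝ) :
    HasDerivAt (gradAngHat θ w ((γ : ℂ) + (t : ℂ) * Complex.I))
      (gradAngHatDeriv θ w ((γ : ℂ) + (t : ℂ) * Complex.I) φ) φ := by
  have hne := line_ne_zero (t := t) (Or.inl hγ0)
  exact (hw.helmholtzODE hne (sin_mul_ne_zero hθ hne (by rwa [line_re]))).hasDerivAt_deriv φ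

end Symbols

theorem rpow_le_of_abs_le {r σ ρ : ℝ} (hr : 0 < r) (h : |σ| ≤ ρ) :
    r ^ (σ - 1) ≤ Real.exp (|Real.log r| * (ρ + 1)) := by
  rw [Real.rpow_def_of_pos hr]
  refine Real.exp_le_exp.2 ?_
  calc Real.log r * (σ - 1) ≤ |Real.log r * (σ - 1)| := le_abs_self _
    _ = |Real.log r| * |σ - 1| := abs_mul _ _
    _ ≤ |Real.log r| * (ρ + 1) := by
        gcongr
        exact (abs_sub _ _).trans (by simpa using h)

/-- The line integral of a holomorphic decaying function does not depend on the line. -/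
theorem mellinHatInv_shift (hθ : 0 < θ) {G : ℂ → ℝ → ℂ} {r φ : ℝ} (hr : 0 < r)
    (hd : ∀ z : ℂ, |z.re| < π / θ → z ≠ 0 → DifferentiableAt ℂ (fun z => G z φ) z)
    (hb : ∀ ρ : ℝ, 0 ≤ ρ → ρ < π / θ → ∃ C : ℝ, 0 ≤ C ∧ ∀ z : ℂ, |z.re| ≤ ρ → z ≠ 0 →
      ‖G z φ‖ * (1 + ‖z‖) ^ 2 ≤ C) {F : ℂ → ℝ → ℂ}
    (hF : ∀ z : ℂ, |(z + 1).re| < π / θ → z + 1 ≠ 0 → F z φ = G (z + 1) φ)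
    {γ γ' : ℝ} (hγ : |γ + 1| < π / θ) (hγ' : |γ' + 1| < π / θ) :
    mellinHatInv γ F r φ = mellinHatInv γ' (fun z s => G (z + 1) s) r φ := by
  have hk : 0 < π / θ := by positivity
  -- Decay is uniform only in strips strictly inside |Re z| < π/θ; ρ leaves room around both lines.
  obtain ⟨ρ, hρ1, hρ2⟩ := exists_between (max_lt hγ hγ')
  have hρ0 : 0 ≤ ρ := (abs_nonneg (γ + 1)).trans ((le_max_left _ _).trans hρ1.le)
  obtain ⟨C, hC0, hC⟩ := hb ρ hρ0 hρ2
  set H : ℂ → ℂ := fun z => (r : ℂ) ^ (z - 1) * G z φ with hH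
  have hline : ∀ σ : ℝ, |σ + 1| < π / θ → ∀ F' : ℂ → ℝ → ℂ,
      (∀ z : ℂ, |(z + 1).re| < π / θ → z + 1 ≠ 0 → F' z φ = G (z + 1) φ) →
      mellinHatInv σ F' r φ = (√(2 * π) : ℂ)⁻¹ * ∫ t : ℝ, H (((σ + 1 : ℝ) : ℂ) + t * Complex.I) := by
    intro σ hσ F' hF'
    rw [mellinHatInv]
    congr 1
    -- If the line passes through the singular point, the symbol may have a meaningless value at t =
    -- 0; a null set does not matter.
    refine integral_congr_ae ?_
    have : ({0} : Set ℝ)ᶜ ∈ ae (volume : Measure ℝ) := by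
      rw [mem_ae_iff, compl_compl]; exact measure_singleton 0
    filter_upwards [this] with t ht
    have hne := line_ne_zero (γ := σ) (t := t) (Or.inr ht)
    rw [hF' _ (by rwa [line_re]) hne, ← line_add_one]
    simp [hH]
  rw [hline γ hγ F hF, hline γ' hγ' _ fun z _ _ => rfl]
  congr 1
  refine integral_verticalLine_eq (ρ := ρ) (C := Real.exp (|Real.log r| * (ρ + 1)) * C) ?_ ?_
    ((le_max_left _ _).trans_lt hρ1) ((le_max_right _ _).trans_lt hρ1)
  · intro z hz hz0
    refine DifferentiableAt.mul ?_ (hd z (hz.trans hρ2) hz0)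
    have : (fun z : ℂ => (r : ℂ) ^ (z - 1)) = fun z => Complex.exp (Real.log r * (z - 1)) := by
      ext z; exact cpow_eq_exp_log hr _
    rw [this]
    fun_prop
  · intro z hz hz0
    have h1 : ‖G z φ‖ ≤ C * (1 + z.im ^ 2)⁻¹ := by
      rw [← div_eq_mul_inv, le_div_iff₀ (by positivity)]
      have h2 := one_add_sq_le_norm (z.re - 1) z.im
      have h3 : ((z.re - 1 : ℝ) : ℂ) + (z.im : ℂ) * Complex.I + 1 = z := by
        conv_rhs => rw [← Complex.re_add_im z]
        push_cast; ring
      rw [h3] at h2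
      exact (mul_le_mul_of_nonneg_left h2 (norm_nonneg _)).trans (hC z hz.le hz0)
    simp only [hH]
    rw [norm_mul, Complex.norm_cpow_eq_rpow_re_of_pos hr, mul_assoc]
    gcongr
    simpa using rpow_le_of_abs_le hr hz.le

section Shift

variable {γ' r φ : ℝ} (hw : NiceField w) (hθ : 0 < θ) (hγ : |γ + 1| < π / θ)
  (hγ' : |γ' + 1| < π / θ) (hr : 0 < r) (hφ : φ ∈ Ioo 0 θ)

include hw hθ hγ hγ' hr hφ

/-- Here the arbitrary γ of the statement disappears: the gradient may be computed on whichever line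
γ' suits the weight, even if γ = -1 is the singular line. z times the potential is bounded near z =
0, so no residue occurs. -/
theorem potentialGrad_rad_eq :
    (potentialGrad θ γ w).rad r φ = (mellinHatInv γ' (gradRadHat θ w) r φ).re := by
  have hφ' : φ ∈ Icc 0 θ := ⟨hφ.1.le, hφ.2.le⟩
  refine congrArg Complex.re (mellinHatInv_shift (G := fun z s => z * pot θ w z s) hθ hr
    ?_ ?_ ?_ hγ hγ')
  · exact fun z hz hz0 => differentiableAt_id.mul
      (hw.differentiableAt_pot hz0 (sin_mul_ne_zero hθ hz0 hz) φ)
  · intro ρ hρ0 hρ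
    obtain ⟨C, hC0, hC⟩ := hw.exists_pot_decay hθ hρ0 hρ 2
    exact ⟨C, hC0, fun z hz hz0 => (hC z hz hz0 φ hφ').1⟩
  · intro z hz hz0
    rw [hw.potentialHat_eq_pot hz0 (sin_mul_ne_zero hθ hz0 hz) hφ']

theorem potentialGrad_ang_eq :
    (potentialGrad θ γ w).ang r φ = (mellinHatInv γ' (gradAngHat θ w) r φ).re := by
  have hφ' : φ ∈ Icc 0 θ := ⟨hφ.1.le, hφ.2.le⟩
  refine congrArg Complex.re (mellinHatInv_shift (G := fun z s => potDeriv θ w z s) hθ hr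
    ?_ ?_ ?_ hγ hγ')
  · exact fun z hz hz0 => hw.differentiableAt_potDeriv (sin_mul_ne_zero hθ hz0 hz) φ
  · intro ρ hρ0 hρ
    obtain ⟨C, hC0, hC⟩ := hw.exists_pot_decay hθ hρ0 hρ 2
    exact ⟨C, hC0, fun z hz hz0 => (hC z hz hz0 φ hφ').2⟩
  · intro z hz hz0
    exact hw.deriv_potentialHat_eq hz0 (sin_mul_ne_zero hθ hz0 hz) hφ

end Shift

end NiceField

end Wedge

end

noncomputable section

namespace Wedge

/-! ### Integration over the wedge -/

/-- The product measure `dφ dr` on `(0, θ) × (0, ∞)`. -/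
def wedgeMeasure (θ : ℝ) : Measure (ℝ × ℝ) :=
  (volume.restrict (Ioc 0 θ)).prod (volume.restrict (Ioi 0))

/-- Integrability over the wedge. -/
def WedgeIntegrable (θ : ℝ) (f : ℝ → ℝ → ℝ) : Prop :=
  Integrable (fun p : ℝ × ℝ => f p.2 p.1 * p.2) (wedgeMeasure θ)

section IntWedge

variable {θ : ℝ} {f g : ℝ → ℝ → ℝ}

theorem intWedge_eq_integral (hθ : 0 < θ) (hf : WedgeIntegrable θ f) :
    intWedge θ f = ∫ p : ℝ × ℝ, f p.2 p.1 * p.2 ∂(wedgeMeasure θ) := by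
  rw [intWedge, intervalIntegral.integral_of_le hθ.le]
  exact (integral_prod _ hf).symm

theorem WedgeIntegrable.add (hf : WedgeIntegrable θ f) (hg : WedgeIntegrable θ g) :
    WedgeIntegrable θ (fun r φ => f r φ + g r φ) := by
  refine (Integrable.add hf hg).congr (Filter.Eventually.of_forall fun p => ?_)
  simp only [Pi.add_apply]; ring

theorem WedgeIntegrable.const_mul (hf : WedgeIntegrable θ f) (c : ℝ) :
    WedgeIntegrable θ (fun r φ => c * f r φ) := by
  refine (Integrable.const_mul hf c).congr (Filter.Eventually.of_forall fun p => ?_)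
  simp only []; ring

theorem WedgeIntegrable.sub (hf : WedgeIntegrable θ f) (hg : WedgeIntegrable θ g) :
    WedgeIntegrable θ (fun r φ => f r φ - g r φ) := by
  refine (Integrable.sub hf hg).congr (Filter.Eventually.of_forall fun p => ?_)
  simp only [Pi.sub_apply]; ring

theorem intWedge_add (hθ : 0 < θ) (hf : WedgeIntegrable θ f) (hg : WedgeIntegrable θ g) :
    intWedge θ (fun r φ => f r φ + g r φ) = intWedge θ f + intWedge θ g := by
  rw [intWedge_eq_integral hθ hf, intWedge_eq_integral hθ hg,
    intWedge_eq_integral hθ (hf.add hg), ← integral_add hf hg]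
  simp_rw [add_mul]

theorem intWedge_sub (hθ : 0 < θ) (hf : WedgeIntegrable θ f) (hg : WedgeIntegrable θ g) :
    intWedge θ (fun r φ => f r φ - g r φ) = intWedge θ f - intWedge θ g := by
  rw [intWedge_eq_integral hθ hf, intWedge_eq_integral hθ hg,
    intWedge_eq_integral hθ (hf.sub hg), ← integral_sub hf hg]
  simp_rw [sub_mul]

theorem intWedge_const_mul (θ c : ℝ) (f : ℝ → ℝ → ℝ) :
    intWedge θ (fun r φ => c * f r φ) = c * intWedge θ f := by
  simp only [intWedge, mul_assoc, MeasureTheory.integral_const_mul,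
    intervalIntegral.integral_const_mul]

theorem intWedge_congr (hθ : 0 < θ) (h : ∀ r, 0 < r → ∀ φ ∈ Ioo 0 θ, f r φ = g r φ) :
    intWedge θ f = intWedge θ g := by
  refine intervalIntegral.integral_congr_Ioo_of_le hθ.le fun φ hφ => ?_
  exact setIntegral_congr_fun measurableSet_Ioi fun r hr => by simp only [h r hr φ hφ]

theorem intWedge_nonneg (hθ : 0 < θ) (h : ∀ r, 0 < r → ∀ φ ∈ Icc 0 θ, 0 ≤ f r φ) :
    0 ≤ intWedge θ f := by
  refine intervalIntegral.integral_nonneg hθ.le fun φ hφ => ?_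
  exact setIntegral_nonneg measurableSet_Ioi fun r hr => mul_nonneg (h r hr φ hφ) (le_of_lt hr)

/-- Functions on the closed wedge without the tip that are continuous. -/
abbrev ContinuousOnWedge (θ : ℝ) (f : ℝ → ℝ → ℝ) : Prop :=
  ContinuousOn (fun p : ℝ × ℝ => f p.1 p.2) (Ioi 0 ×ˢ Icc 0 θ)

theorem ContinuousOnWedge.mul (hf : ContinuousOnWedge θ f) (hg : ContinuousOnWedge θ g) :
    ContinuousOnWedge θ (fun r φ => f r φ * g r φ) := ContinuousOn.mul hf hg

theorem ContinuousOnWedge.add (hf : ContinuousOnWedge θ f) (hg : ContinuousOnWedge θ g) :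
    ContinuousOnWedge θ (fun r φ => f r φ + g r φ) := ContinuousOn.add hf hg

theorem ContinuousOnWedge.sub (hf : ContinuousOnWedge θ f) (hg : ContinuousOnWedge θ g) :
    ContinuousOnWedge θ (fun r φ => f r φ - g r φ) := ContinuousOn.sub hf hg

theorem ContinuousOnWedge.neg (hf : ContinuousOnWedge θ f) :
    ContinuousOnWedge θ (fun r φ => -f r φ) := ContinuousOn.neg hf

theorem Nice.continuousOnWedge (hf : Nice f) (θ : ℝ) : ContinuousOnWedge θ f :=
  hf.continuous.continuousOn

theorem ContinuousOnWedge.slice_r (hf : ContinuousOnWedge θ f) {φ : ℝ} (hφ : φ ∈ Icc 0 θ) :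
    ContinuousOn (fun r => f r φ) (Ioi 0) :=
  hf.comp (f := fun r : ℝ => (r, φ)) (by fun_prop) fun r hr => ⟨hr, hφ⟩

theorem ContinuousOnWedge.slice_phi (hf : ContinuousOnWedge θ f) {r : ℝ} (hr : 0 < r) :
    ContinuousOn (fun φ => f r φ) (Icc 0 θ) :=
  hf.comp (f := fun φ : ℝ => (r, φ)) (by fun_prop) fun φ hφ => ⟨hr, hφ⟩

theorem continuousOnWedge_inv : ContinuousOnWedge θ (fun r _ => r⁻¹) :=
  ContinuousOn.inv₀ continuous_fst.continuousOn fun _ hp => ne_of_gt hp.1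

/-- Products of a continuous function and a smooth compactly supported one are integrable. -/
theorem WedgeIntegrable.mul_nice (hf : ContinuousOnWedge θ f) (hg : Nice g) :
    WedgeIntegrable θ (fun r φ => f r φ * g r φ) := by
  obtain ⟨a, b, ha, hab, h⟩ := hg.supp
  have hcomp : IntegrableOn (fun p : ℝ × ℝ => f p.2 p.1 * g p.2 p.1 * p.2)
      (Icc 0 θ ×ˢ Icc a b) (volume.prod volume) := by
    refine ContinuousOn.integrableOn_compact (isCompact_Icc.prod isCompact_Icc) ?_
    have h1 : ContinuousOn (fun p : ℝ × ℝ => f p.2 p.1) (Icc 0 θ ×ˢ Icc a b) :=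
      hf.comp (f := fun p : ℝ × ℝ => (p.2, p.1)) (by fun_prop) fun p hp =>
        ⟨ha.trans_le hp.2.1, hp.1⟩
    have h2 : Continuous (fun p : ℝ × ℝ => g p.2 p.1) :=
      hg.continuous.comp (f := fun p : ℝ × ℝ => (p.2, p.1)) (by fun_prop)
    exact (h1.mul h2.continuousOn).mul continuous_snd.continuousOn
  rw [WedgeIntegrable, wedgeMeasure, Measure.prod_restrict]
  refine hcomp.of_forall_sdiff_eq_zero (measurableSet_Ioc.prod measurableSet_Ioi) ?_
  rintro ⟨φ, r⟩ ⟨hp, hn⟩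
  have : r ∉ Icc a b := fun hr => hn ⟨⟨hp.1.1.le, hp.1.2⟩, hr⟩
  simp [h r φ this]

theorem WedgeIntegrable.of_nice (hg : Nice g) : WedgeIntegrable θ g := by
  have := WedgeIntegrable.mul_nice (θ := θ) (f := fun _ _ => (1 : ℝ)) continuousOn_const hg
  simpa using this

/-- The fundamental theorem on an interval slightly larger than the support; differentiability is
needed only for r > 0, where powers of r are smooth. -/
theorem integral_Ioi_deriv_eq_zero {F F' : ℝ → ℝ} {a b : ℝ} (ha : 0 < a) (hab : a ≤ b)
    (h : ∀ r, r ∉ Icc a b → F r = 0) (h' : ∀ r, r ∉ Icc a b → F' r = 0)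
    (hd : ∀ r, 0 < r → HasDerivAt F (F' r) r) (hc : ContinuousOn F' (Ioi 0)) :
    ∫ r in Ioi (0 : ℝ), F' r = 0 := by
  have h1 : ∫ r in Ioi (0 : ℝ), F' r = ∫ r in Ioc (a / 2) (b + 1), F' r := by
    refine setIntegral_eq_of_subset_of_forall_sdiff_eq_zero measurableSet_Ioi ?_ ?_
    · exact fun r hr => (half_pos ha).trans hr.1
    · refine fun r hr => h' r fun hh => hr.2 ⟨?_, ?_⟩
      · linarith [hh.1]
      · linarith [hh.2]
  have hle : a / 2 ≤ b + 1 := by linarith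
  have hsub : uIcc (a / 2) (b + 1) ⊆ Ioi 0 := by
    rw [uIcc_of_le hle]; exact fun r hr => (half_pos ha).trans_le hr.1
  rw [h1, ← intervalIntegral.integral_of_le hle, intervalIntegral.integral_eq_sub_of_hasDerivAt
    (fun r hr => hd r (hsub hr)) ((hc.mono hsub).intervalIntegrable),
    h (b + 1) (fun hh => by linarith [hh.2]), h (a / 2) (fun hh => by linarith [hh.1]), sub_zero]

end IntWedge

/-- `f` is continuously differentiable on the closed wedge without its tip; its radial and angular
derivatives are `a` and `p`. -/
structure C1OnWedge (θ : ℝ) (f a p : ℝ → ℝ → ℝ) : Prop where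
  cont : ContinuousOnWedge θ f
  cont_r : ContinuousOnWedge θ a
  cont_phi : ContinuousOnWedge θ p
  deriv_r : ∀ r, 0 < r → ∀ φ ∈ Ioo 0 θ, HasDerivAt (fun s => f s φ) (a r φ) r
  deriv_phi : ∀ r, 0 < r → ∀ φ ∈ Ioo 0 θ, HasDerivAt (fun s => f r s) (p r φ) φ

/-- Integration by parts: the volume terms and the boundary term of the bilinear forms combine to
the pairing with the Laplacian. -/
theorem intWedge_gradDot_sub_boundary {θ : ℝ} (hθ : 0 < θ) {q u : PolarField}
    {qr ar pr qa aa pa : ℝ → ℝ → ℝ} (hr : C1OnWedge θ qr ar pr) (ha : C1OnWedge θ qa aa pa)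
    (hqr : ∀ r, 0 < r → ∀ φ ∈ Ioo 0 θ, q.rad r φ = qr r φ)
    (hqa : ∀ r, 0 < r → ∀ φ ∈ Ioo 0 θ, q.ang r φ = qa r φ)
    (h0 : ∀ r, 0 < r → qa r 0 = 0) (h1 : ∀ r, 0 < r → qa r θ = 0)
    (hur : Nice u.rad) (hua : Nice u.ang)
    (ht : ∀ r, 0 < r → u.ang r 0 = 0 ∧ u.ang r θ = 0) :
    intWedge θ (fun r φ => q.gradDot u r φ)
      - intWedge θ (fun r φ => (r ^ 2)⁻¹ *
        dphi (fun r' φ' => dphi u.rad r' φ' * q.rad r' φ') r φ)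
      = - intWedge θ (fun r φ => q.dot u.laplace r φ) := by
  -- derivatives of `q` in the interior
  have dphir : ∀ r, 0 < r → ∀ φ ∈ Ioo 0 θ, HasDerivAt (fun s => q.rad r s) (pr r φ) φ := by
    intro r hr0 φ hφ
    refine (hr.deriv_phi r hr0 φ hφ).congr_of_eventuallyEq ?_
    filter_upwards [Ioo_mem_nhds hφ.1 hφ.2] with s hs using hqr r hr0 s hs
  have dphia : ∀ r, 0 < r → ∀ φ ∈ Ioo 0 θ, HasDerivAt (fun s => q.ang r s) (pa r φ) φ := by
    intro r hr0 φ hφ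
    refine (ha.deriv_phi r hr0 φ hφ).congr_of_eventuallyEq ?_
    filter_upwards [Ioo_mem_nhds hφ.1 hφ.2] with s hs using hqa r hr0 s hs
  have drr : ∀ r, 0 < r → ∀ φ ∈ Ioo 0 θ, dr q.rad r φ = ar r φ := by
    intro r hr0 φ hφ
    refine ((hr.deriv_r r hr0 φ hφ).congr_of_eventuallyEq ?_).deriv
    filter_upwards [eventually_gt_nhds hr0] with s hs using hqr s hs φ hφ
  have dra : ∀ r, 0 < r → ∀ φ ∈ Ioo 0 θ, dr q.ang r φ = aa r φ := by
    intro r hr0 φ hφ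
    refine ((ha.deriv_r r hr0 φ hφ).congr_of_eventuallyEq ?_).deriv
    filter_upwards [eventually_gt_nhds hr0] with s hs using hqa s hs φ hφ
  -- the radial and the angular divergence
  set R : ℝ → ℝ → ℝ := fun r φ => (r⁻¹ * ar r φ) * rdr u.rad r φ + (r⁻¹ * aa r φ) * rdr u.ang r φ
    + ((r⁻¹ * r⁻¹) * qr r φ * rdr (rdr u.rad) r φ + (r⁻¹ * r⁻¹) * qa r φ * rdr (rdr u.ang) r φ)
    with hR
  set S : ℝ → ℝ → ℝ := fun r φ => pa r φ * (dphi u.ang r φ + u.rad r φ)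
    + qa r φ * (dphi (dphi u.ang) r φ + dphi u.rad r φ) - (pr r φ * u.ang r φ
    + qr r φ * dphi u.ang r φ) with hS
  set S' : ℝ → ℝ → ℝ := fun r φ => (r⁻¹ * r⁻¹) * S r φ with hS'
  have ci : ContinuousOnWedge θ (fun r _ => r⁻¹) := continuousOnWedge_inv
  have cii : ContinuousOnWedge θ (fun r _ => r⁻¹ * r⁻¹) := ci.mul ci
  have iR : WedgeIntegrable θ R := by
    refine ((WedgeIntegrable.mul_nice (ci.mul hr.cont_r) hur.rdr).add
      (WedgeIntegrable.mul_nice (ci.mul ha.cont_r) hua.rdr)).add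
      ((WedgeIntegrable.mul_nice (cii.mul hr.cont) hur.rdr.rdr).add
      (WedgeIntegrable.mul_nice (cii.mul ha.cont) hua.rdr.rdr))
  have iS' : WedgeIntegrable θ S' := by
    have := ((WedgeIntegrable.mul_nice (cii.mul ha.cont_phi) (hua.dphi.add hur)).add
      (WedgeIntegrable.mul_nice (cii.mul ha.cont) (hua.dphi.dphi.add hur.dphi))).sub
      ((WedgeIntegrable.mul_nice (cii.mul hr.cont_phi) hua).add
      (WedgeIntegrable.mul_nice (cii.mul hr.cont) hua.dphi))
    refine this.congr (Filter.Eventually.of_forall fun p => ?_)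
    simp only [hS', hS]; ring
  -- both have vanishing integral
  have zR : intWedge θ R = 0 := by
    rw [intWedge]
    rw [intervalIntegral.integral_congr_Ioo_of_le (g := fun _ => 0) hθ.le, intervalIntegral.integral_zero]
    intro φ hφ
    have hφ' : φ ∈ Icc 0 θ := ⟨hφ.1.le, hφ.2.le⟩
    obtain ⟨a, b, ha0, hab, hs⟩ := hur.rdr.supp
    obtain ⟨c, d, hc0, hcd, hs'⟩ := hua.rdr.supp
    obtain ⟨a', b', ha0', hab', hs₂⟩ := hur.rdr.rdr.supp
    obtain ⟨c', d', hc0', hcd', hs₂'⟩ := hua.rdr.rdr.supp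
    set A := min (min a c) (min a' c')
    set B := max (max b d) (max b' d')
    have hA : 0 < A := lt_min (lt_min ha0 hc0) (lt_min ha0' hc0')
    have hAa : A ≤ a := (min_le_left _ _).trans (min_le_left _ _)
    have hAc : A ≤ c := (min_le_left _ _).trans (min_le_right _ _)
    have hAa' : A ≤ a' := (min_le_right _ _).trans (min_le_left _ _)
    have hAc' : A ≤ c' := (min_le_right _ _).trans (min_le_right _ _)
    have hBb : b ≤ B := (le_max_left _ _).trans (le_max_left _ _)
    have hBd : d ≤ B := (le_max_right _ _).trans (le_max_left _ _)
    have hBb' : b' ≤ B := (le_max_left _ _).trans (le_max_right _ _)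
    have hBd' : d' ≤ B := (le_max_right _ _).trans (le_max_right _ _)
    have out : ∀ {r x y : ℝ}, A ≤ x → y ≤ B → r ∉ Icc A B → r ∉ Icc x y := fun hx hy hr hh =>
      hr ⟨hx.trans hh.1, hh.2.trans hy⟩
    refine integral_Ioi_deriv_eq_zero (F := fun r => qr r φ * rdr u.rad r φ + qa r φ * rdr u.ang r φ)
      hA (hAa.trans (hab.trans hBb)) (fun r hr => ?_) (fun r hr => ?_) (fun r hr0 => ?_) ?_
    · simp [hs r φ (out hAa hBb hr), hs' r φ (out hAc hBd hr)]
    · simp [hR, hs r φ (out hAa hBb hr), hs' r φ (out hAc hBd hr), hs₂ r φ (out hAa' hBb' hr),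
        hs₂' r φ (out hAc' hBd' hr)]
    · refine (((hr.deriv_r r hr0 φ hφ).mul (hur.rdr.hasDerivAt_dr r φ)).add
        ((ha.deriv_r r hr0 φ hφ).mul (hua.rdr.hasDerivAt_dr r φ))).congr_deriv ?_
      have e1 : rdr (rdr u.rad) r φ = r * dr (rdr u.rad) r φ := rfl
      have e2 : rdr (rdr u.ang) r φ = r * dr (rdr u.ang) r φ := rfl
      simp only [hR, e1, e2]
      have := hr0.ne'
      field_simp
      ring
    · have cR : ContinuousOnWedge θ (fun r φ => R r φ * r) := by
        have h1 := hur.rdr.continuousOnWedge θ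
        have h2 := hua.rdr.continuousOnWedge θ
        have h3 := hur.rdr.rdr.continuousOnWedge θ
        have h4 := hua.rdr.rdr.continuousOnWedge θ
        exact ((((ci.mul hr.cont_r).mul h1).add ((ci.mul ha.cont_r).mul h2)).add
          (((cii.mul hr.cont).mul h3).add ((cii.mul ha.cont).mul h4))).mul
          (g := fun r _ => r) continuous_fst.continuousOn
      exact ContinuousOnWedge.slice_r cR hφ'
  have zS : intWedge θ S' = 0 := by
    rw [intWedge_eq_integral hθ iS', wedgeMeasure, integral_prod_symm _ iS']
    rw [setIntegral_congr_fun (g := fun _ => 0) measurableSet_Ioi, integral_zero]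
    intro r hr0
    have hr0' : 0 < r := hr0
    simp only [hS']
    have : ∀ φ, r⁻¹ * r⁻¹ * S r φ * r = r⁻¹ * S r φ := fun φ => by field_simp
    simp_rw [this]
    rw [MeasureTheory.integral_const_mul, ← intervalIntegral.integral_of_le hθ.le]
    have cS : ContinuousOn (fun φ => S r φ) (Icc 0 θ) := by
      have h1 := (hua.dphi.add hur).continuousOnWedge θ
      have h2 := (hua.dphi.dphi.add hur.dphi).continuousOnWedge θ
      have h3 := hua.continuousOnWedge θ
      have h4 := hua.dphi.continuousOnWedge θ
      exact ContinuousOnWedge.slice_phi (((ha.cont_phi.mul h1).add (ha.cont.mul h2)).sub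
        ((hr.cont_phi.mul h3).add (hr.cont.mul h4))) hr0'
    have cE : ContinuousOn (fun φ => qa r φ * (dphi u.ang r φ + u.rad r φ) - qr r φ * u.ang r φ)
        (Icc 0 θ) :=
      ContinuousOnWedge.slice_phi ((ha.cont.mul ((hua.dphi.add hur).continuousOnWedge θ)).sub
        (hr.cont.mul (hua.continuousOnWedge θ))) hr0'
    rw [intervalIntegral.integral_eq_sub_of_hasDerivAt_of_le hθ.le cE (fun φ hφ => ?_)
      (by rw [← uIcc_of_le hθ.le] at cS; exact cS.intervalIntegrable)]
    · simp [h0 r hr0', h1 r hr0', ht r hr0']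
    · exact (((ha.deriv_phi r hr0' φ hφ).mul ((hua.dphi.hasDerivAt_dphi r φ).add
        (hur.hasDerivAt_dphi r φ))).sub ((hr.deriv_phi r hr0' φ hφ).mul
        (hua.hasDerivAt_dphi r φ))).congr_deriv (by simp only [hS, Pi.add_apply])
  -- the remaining pieces
  have hur2 := hur.dphi.dphi
  set b₁ : ℝ → ℝ → ℝ := fun r φ => pr r φ * dphi u.rad r φ + qr r φ * dphi (dphi u.rad) r φ with hb₁
  set T : ℝ → ℝ → ℝ := fun r φ => (r⁻¹ * r⁻¹) * b₁ r φ with hT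
  have iT : WedgeIntegrable θ T := by
    have := (WedgeIntegrable.mul_nice (cii.mul hr.cont_phi) hur.dphi).add
      (WedgeIntegrable.mul_nice (cii.mul hr.cont) hur2)
    refine this.congr (Filter.Eventually.of_forall fun p => ?_)
    simp only [hT, hb₁]; ring
  have eT : intWedge θ (fun r φ => (r ^ 2)⁻¹ *
        dphi (fun r' φ' => dphi u.rad r' φ' * q.rad r' φ') r φ) = intWedge θ T := by
    refine intWedge_congr hθ fun r hr0 φ hφ => ?_
    have : dphi (fun r' φ' => dphi u.rad r' φ' * q.rad r' φ') r φ = b₁ r φ := by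
      refine ((hur.dphi.hasDerivAt_dphi r φ).mul (dphir r hr0 φ hφ)).deriv.trans ?_
      rw [hqr r hr0 φ hφ]
      ring
    rw [this, hT]
    ring
  set Lr : ℝ → ℝ → ℝ := fun r φ =>
      rdr (rdr u.rad) r φ + dphi (dphi u.rad) r φ - 2 * dphi u.ang r φ - u.rad r φ with hLr
  set La : ℝ → ℝ → ℝ := fun r φ =>
      rdr (rdr u.ang) r φ + dphi (dphi u.ang) r φ + 2 * dphi u.rad r φ - u.ang r φ with hLa
  have nLr : Nice Lr := ((hur.rdr.rdr.add hur.dphi.dphi).sub (hua.dphi.const_mul 2)).sub hur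
  have nLa : Nice La := ((hua.rdr.rdr.add hua.dphi.dphi).add (hur.dphi.const_mul 2)).sub hua
  set D : ℝ → ℝ → ℝ := fun r φ => (r⁻¹ * r⁻¹) * qr r φ * Lr r φ + (r⁻¹ * r⁻¹) * qa r φ * La r φ
    with hD
  have iD : WedgeIntegrable θ D :=
    (WedgeIntegrable.mul_nice (cii.mul hr.cont) nLr).add
      (WedgeIntegrable.mul_nice (cii.mul ha.cont) nLa)
  have eD : intWedge θ (fun r φ => q.dot u.laplace r φ) = intWedge θ D := by
    refine intWedge_congr hθ fun r hr0 φ hφ => ?_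
    simp only [PolarField.dot, PolarField.laplace, hqr r hr0 φ hφ, hqa r hr0 φ hφ, hD, hLr, hLa]
    ring
  -- Pointwise, ∇q:∇u is a radial divergence R, an angular divergence S', the term T = r⁻²∂_φ(q_r
  -- ∂_φ u_r), minus q·Δu. S' integrates to zero since q_φ and u_φ vanish on the rays; T need not,
  -- and is exactly the term that the forms subtract.
  have eG : intWedge θ (fun r φ => q.gradDot u r φ)
      = intWedge θ (fun r φ => (R r φ + S' r φ) + (T r φ - D r φ)) := by
    refine intWedge_congr hθ fun r hr0 φ hφ => ?_
    have e1 : dphi q.rad r φ = pr r φ := (dphir r hr0 φ hφ).deriv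
    have e2 : dphi q.ang r φ = pa r φ := (dphia r hr0 φ hφ).deriv
    simp only [PolarField.gradDot, rdr, drr r hr0 φ hφ, dra r hr0 φ hφ, e1, e2, hqr r hr0 φ hφ,
      hqa r hr0 φ hφ, hR, hS', hS, hT, hb₁, hD, hLr, hLa]
    have := hr0.ne'
    field_simp
    ring
  rw [eG, eT, eD, intWedge_add hθ (iR.add iS') (iT.sub iD), intWedge_add hθ iR iS',
    intWedge_sub hθ iT iD, zR, zS]
  ring

end Wedge

end

noncomputable section

namespace Wedge

open PolarField

/-! ### Test fields -/

namespace Nice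

variable {f g : ℝ → ℝ → ℝ} {θ : ℝ}

/-- By continuity. The divergence condition is assumed only inside the wedge but is used on the rays
as well. -/
theorem eq_on_Icc (hf : Nice f) (hg : Nice g) (hθ : 0 < θ) {r : ℝ}
    (h : ∀ φ ∈ Ioo 0 θ, f r φ = g r φ) : ∀ φ ∈ Icc 0 θ, f r φ = g r φ := by
  have h1 : Continuous fun φ => f r φ := hf.continuous.comp (f := fun φ : ℝ => (r, φ)) (by fun_prop)
  have h2 : Continuous fun φ => g r φ := hg.continuous.comp (f := fun φ : ℝ => (r, φ)) (by fun_prop)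
  have := Set.EqOn.closure (fun φ hφ => h φ hφ : EqOn (fun φ => f r φ) (fun φ => g r φ) (Ioo 0 θ))
    h1 h2
  rw [closure_Ioo hθ.ne] at this
  exact this

theorem dphi_eq_on_Ioo {r : ℝ} (h : ∀ φ ∈ Ioo 0 θ, f r φ = g r φ) :
    ∀ φ ∈ Ioo 0 θ, Wedge.dphi f r φ = Wedge.dphi g r φ := by
  intro φ hφ
  refine Filter.EventuallyEq.deriv_eq ?_
  filter_upwards [Ioo_mem_nhds hφ.1 hφ.2] with s hs using h s hs

theorem dphi_add (hf : Nice f) (hg : Nice g) :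
    Wedge.dphi (fun r φ => f r φ + g r φ) = fun r φ => Wedge.dphi f r φ + Wedge.dphi g r φ := by
  ext r φ; exact ((hf.hasDerivAt_dphi r φ).add (hg.hasDerivAt_dphi r φ)).deriv

theorem dphi_sub (hf : Nice f) (hg : Nice g) :
    Wedge.dphi (fun r φ => f r φ - g r φ) = fun r φ => Wedge.dphi f r φ - Wedge.dphi g r φ := by
  ext r φ; exact ((hf.hasDerivAt_dphi r φ).sub (hg.hasDerivAt_dphi r φ)).deriv

theorem dphi_smul (hf : Nice f) (m : ℝ → ℝ) :
    Wedge.dphi (fun r φ => m r * f r φ) = fun r φ => m r * Wedge.dphi f r φ := by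
  ext r φ; exact ((hf.hasDerivAt_dphi r φ).const_mul (m r)).deriv

theorem rdr_add (hf : Nice f) (hg : Nice g) :
    Wedge.rdr (fun r φ => f r φ + g r φ) = fun r φ => Wedge.rdr f r φ + Wedge.rdr g r φ := by
  ext r φ
  have : Wedge.dr (fun r φ => f r φ + g r φ) r φ = Wedge.dr f r φ + Wedge.dr g r φ :=
    ((hf.hasDerivAt_dr r φ).add (hg.hasDerivAt_dr r φ)).deriv
  simp only [Wedge.rdr, this]; ring

theorem rdr_sub (hf : Nice f) (hg : Nice g) :
    Wedge.rdr (fun r φ => f r φ - g r φ) = fun r φ => Wedge.rdr f r φ - Wedge.rdr g r φ := by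
  ext r φ
  have : Wedge.dr (fun r φ => f r φ - g r φ) r φ = Wedge.dr f r φ - Wedge.dr g r φ :=
    ((hf.hasDerivAt_dr r φ).sub (hg.hasDerivAt_dr r φ)).deriv
  simp only [Wedge.rdr, this]; ring

theorem mellinHat_eq_zero {z : ℂ} {φ : ℝ} (h : ∀ r, 0 < r → f r φ = 0) : mellinHat f z φ = 0 := by
  rw [mellinHat_congr (g := fun _ _ => 0) h, mellinHat_eq_integral]
  simp

theorem rdr_eq_zero {φ : ℝ} (h : ∀ r, 0 < r → f r φ = 0) : ∀ r, 0 < r → Wedge.rdr f r φ = 0 := by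
  intro r hr
  have : (fun s => f s φ) =ᶠ[nhds r] fun _ => 0 := by
    filter_upwards [eventually_gt_nhds hr] with s hs using h s hs
  simp [Wedge.rdr, Wedge.dr, this.deriv_eq]

end Nice

theorem NiceField.powMul {w : PolarField} (hw : NiceField w) (β : ℝ) : NiceField (w.powMul β) :=
  ⟨hw.rad.rpow_mul β, hw.ang.rpow_mul β⟩

theorem NiceField.eulerR {w : PolarField} (hw : NiceField w) : NiceField w.eulerR :=
  ⟨hw.rad.rdr, hw.ang.rdr⟩

/-- The radial component of `r² Δu`. -/
def lapRad (u : PolarField) (r φ : ℝ) : ℝ :=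
  rdr (rdr u.rad) r φ + dphi (dphi u.rad) r φ - 2 * dphi u.ang r φ - u.rad r φ

/-- The angular component of `r² Δu`. -/
def lapAng (u : PolarField) (r φ : ℝ) : ℝ :=
  rdr (rdr u.ang) r φ + dphi (dphi u.ang) r φ + 2 * dphi u.rad r φ - u.ang r φ

theorem NiceField.lapRad {w : PolarField} (hw : NiceField w) : Nice (lapRad w) :=
  ((hw.rad.rdr.rdr.add hw.rad.dphi.dphi).sub (hw.ang.dphi.const_mul 2)).sub hw.rad

theorem NiceField.lapAng {w : PolarField} (hw : NiceField w) : Nice (lapAng w) :=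
  ((hw.ang.rdr.rdr.add hw.ang.dphi.dphi).add (hw.rad.dphi.const_mul 2)).sub hw.ang

theorem NiceField.laplace {w : PolarField} (hw : NiceField w) : NiceField w.laplace :=
  ⟨hw.lapRad.inv_sq_mul, hw.lapAng.inv_sq_mul⟩

namespace IsTestField

variable {θ : ℝ} {u : PolarField}

theorem niceField (hu : IsTestField θ u) : NiceField u := by
  obtain ⟨a, b, ha, hab, h⟩ := hu.support
  exact ⟨⟨hu.smooth_rad, a, b, ha, hab, fun r φ hr => (h r φ hr).1⟩,
    ⟨hu.smooth_ang, a, b, ha, hab, fun r φ hr => (h r φ hr).2⟩⟩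

/-- Solenoidality trades angular derivatives of u_φ for radial derivatives of u_r, so the sources
and Neumann data below can be expressed by u_r alone. -/
theorem dphi_ang (hu : IsTestField θ u) (hθ : 0 < θ) {r : ℝ} (hr : 0 < r) :
    ∀ φ ∈ Icc 0 θ, dphi u.ang r φ = -(rdr u.rad r φ + u.rad r φ) := by
  have hn := hu.niceField
  refine hn.ang.dphi.eq_on_Icc (hn.rad.rdr.add hn.rad).neg hθ fun φ hφ => ?_
  have := hu.div_eq_zero r φ hr hφ
  rw [divergence, mul_eq_zero] at this
  have := this.resolve_left (inv_ne_zero hr.ne')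
  linarith

theorem dphi_dphi_ang (hu : IsTestField θ u) (hθ : 0 < θ) {r : ℝ} (hr : 0 < r) :
    ∀ φ ∈ Icc 0 θ, dphi (dphi u.ang) r φ = -(rdr (dphi u.rad) r φ + dphi u.rad r φ) := by
  have hn := hu.niceField
  have e : dphi (fun r φ => -(rdr u.rad r φ + u.rad r φ))
      = fun r φ => -(rdr (dphi u.rad) r φ + dphi u.rad r φ) := by
    have := (hn.rad.rdr.add hn.rad).dphi_smul (fun _ => -1)
    simp only [neg_one_mul] at this
    rw [this, hn.rad.rdr.dphi_add hn.rad, hn.rad.dphi_rdr]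
  refine hn.ang.dphi.dphi.eq_on_Icc (hn.rad.dphi.rdr.add hn.rad.dphi).neg hθ ?_
  have := Nice.dphi_eq_on_Ioo (r := r) (f := dphi u.ang)
    (g := fun r φ => -(rdr u.rad r φ + u.rad r φ)) (fun φ hφ => hu.dphi_ang hθ hr φ (Ioo_subset_Icc_self hφ))
  rwa [e] at this

theorem dphi_dphi_dphi_ang (hu : IsTestField θ u) (hθ : 0 < θ) {r : ℝ} (hr : 0 < r) :
    ∀ φ ∈ Icc 0 θ, dphi (dphi (dphi u.ang)) r φ
      = -(rdr (dphi (dphi u.rad)) r φ + dphi (dphi u.rad) r φ) := by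
  have hn := hu.niceField
  have e : dphi (fun r φ => -(rdr (dphi u.rad) r φ + dphi u.rad r φ))
      = fun r φ => -(rdr (dphi (dphi u.rad)) r φ + dphi (dphi u.rad) r φ) := by
    have := (hn.rad.dphi.rdr.add hn.rad.dphi).dphi_smul (fun _ => -1)
    simp only [neg_one_mul] at this
    rw [this, hn.rad.dphi.rdr.dphi_add hn.rad.dphi, hn.rad.dphi.dphi_rdr]
  refine hn.ang.dphi.dphi.dphi.eq_on_Icc (hn.rad.dphi.dphi.rdr.add hn.rad.dphi.dphi).neg hθ ?_
  have := Nice.dphi_eq_on_Ioo (r := r) (f := dphi (dphi u.ang))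
    (g := fun r φ => -(rdr (dphi u.rad) r φ + dphi u.rad r φ))
    (fun φ hφ => hu.dphi_dphi_ang hθ hr φ (Ioo_subset_Icc_self hφ))
  rwa [e] at this

/-- The operator r div commutes with r∂_r, and r∂_r acts along the rays. Hence (r∂_r)²v is again a
test field and the commutator formulas apply to B₂. -/
theorem eulerR (hu : IsTestField θ u) : IsTestField θ u.eulerR := by
  have hn := hu.niceField
  obtain ⟨a, b, ha, hab, h⟩ := hu.support
  refine ⟨hn.rad.rdr.smooth, hn.ang.rdr.smooth, ⟨a, b, ha, hab, fun r φ hr => ?_⟩, ?_, ?_⟩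
  · have h1 : ∀ᶠ s in nhds r, s ∉ Icc a b := isClosed_Icc.isOpen_compl.mem_nhds hr
    have e1 : (fun s => u.rad s φ) =ᶠ[nhds r] fun _ => 0 := h1.mono fun s hs => (h s φ hs).1
    have e2 : (fun s => u.ang s φ) =ᶠ[nhds r] fun _ => 0 := h1.mono fun s hs => (h s φ hs).2
    simp [PolarField.eulerR, rdr, dr, e1.deriv_eq, e2.deriv_eq]
  · intro r φ hr hφ
    have hz : ∀ s, 0 < s → (fun r φ => rdr u.rad r φ + u.rad r φ + dphi u.ang r φ) s φ = 0 := by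
      intro s hs
      have := hu.dphi_ang (hφ.1.trans hφ.2) hs φ (Ioo_subset_Icc_self hφ)
      simp only [this]; ring
    have h1 := Nice.rdr_eq_zero (f := fun r φ => rdr u.rad r φ + u.rad r φ + dphi u.ang r φ) hz r hr
    rw [(hn.rad.rdr.add hn.rad).rdr_add hn.ang.dphi, hn.rad.rdr.rdr_add hn.rad] at h1
    simp only [divergence, PolarField.eulerR, hn.ang.dphi_rdr]
    exact mul_eq_zero_of_right _ h1
  · exact fun r hr => ⟨Nice.rdr_eq_zero (fun s hs => (hu.tangential s hs).1) r hr,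
      Nice.rdr_eq_zero (fun s hs => (hu.tangential s hs).2) r hr⟩

theorem mellinHat_dphi_ang (hu : IsTestField θ u) (hθ : 0 < θ) (z : ℂ) {φ : ℝ}
    (hφ : φ ∈ Icc 0 θ) : mellinHat (dphi u.ang) z φ = -((z + 1) * mellinHat u.rad z φ) := by
  have hn := hu.niceField
  rw [Nice.mellinHat_congr (g := fun r φ => (-1 : ℝ) * (rdr u.rad r φ + u.rad r φ))
    fun r hr => by rw [hu.dphi_ang hθ hr φ hφ]; ring,
    Nice.mellinHat_const_mul (-1) (fun r φ => rdr u.rad r φ + u.rad r φ),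
    hn.rad.rdr.mellinHat_add hn.rad, hn.rad.mellinHat_rdr]
  push_cast; ring

theorem mellinHat_ang_zero (hu : IsTestField θ u) (z : ℂ) : mellinHat u.ang z 0 = 0 :=
  Nice.mellinHat_eq_zero fun r hr => (hu.tangential r hr).1

theorem mellinHat_ang_end (hu : IsTestField θ u) (z : ℂ) : mellinHat u.ang z θ = 0 :=
  Nice.mellinHat_eq_zero fun r hr => (hu.tangential r hr).2

/-- The Helmholtz projection leaves solenoidal fields invariant. -/
theorem potentialHat_eq_zero (hu : IsTestField θ u) (hθ : 0 < θ) (z : ℂ) (φ : ℝ) :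
    potentialHat θ u z φ = 0 := by
  have hn := hu.niceField
  rw [potentialHat, hu.mellinHat_ang_zero, hu.mellinHat_ang_end,
    intervalIntegral.integral_congr (g := fun _ => 0)]
  · simp
  · intro s hs
    rw [uIcc_of_le hθ.le] at hs
    -- The derivative of û_φ(z-1) equals -z û_r(z-1), which cancels the other half of the source.
    simp only [(hn.ang.hasDerivAt_mellinHat_snd (z - 1) s).deriv, hu.mellinHat_dphi_ang hθ _ hs]
    ring

theorem potentialGrad_rad (hu : IsTestField θ u) (hθ : 0 < θ) (γ r φ : ℝ) :
    (potentialGrad θ γ u).rad r φ = 0 := by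
  simp [potentialGrad, mellinHatInv, hu.potentialHat_eq_zero hθ]

theorem potentialGrad_ang (hu : IsTestField θ u) (hθ : 0 < θ) (γ r φ : ℝ) :
    (potentialGrad θ γ u).ang r φ = 0 := by
  simp [potentialGrad, mellinHatInv, hu.potentialHat_eq_zero hθ]

theorem helmholtz_eq (hu : IsTestField θ u) (hθ : 0 < θ) (γ : ℝ) : helmholtz θ γ u = u := by
  ext r φ
  · change u.rad r φ - (potentialGrad θ γ u).rad r φ = u.rad r φ
    rw [hu.potentialGrad_rad hθ, sub_zero]
  · change u.ang r φ - (potentialGrad θ γ u).ang r φ = u.ang r φ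
    rw [hu.potentialGrad_ang hθ, sub_zero]

/-- Since P u = u, the two terms r^β u cancel in the commutator, and only the gradient of the
potential of r^β u is left. -/
theorem commPow_rad (hu : IsTestField θ u) (hθ : 0 < θ) (γ β r φ : ℝ) :
    (commPow θ γ β u).rad r φ = -(potentialGrad θ γ (u.powMul β)).rad r φ := by
  rw [commPow, hu.helmholtz_eq hθ]
  change (u.powMul β).rad r φ - (potentialGrad θ γ (u.powMul β)).rad r φ - (u.powMul β).rad r φ = _
  ring

theorem commPow_ang (hu : IsTestField θ u) (hθ : 0 < θ) (γ β r φ : ℝ) :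
    (commPow θ γ β u).ang r φ = -(potentialGrad θ γ (u.powMul β)).ang r φ := by
  rw [commPow, hu.helmholtz_eq hθ]
  change (u.powMul β).ang r φ - (potentialGrad θ γ (u.powMul β)).ang r φ - (u.powMul β).ang r φ = _
  ring

theorem commLaplace_rad (hu : IsTestField θ u) (hθ : 0 < θ) (γ r φ : ℝ) :
    (commLaplace θ γ u).rad r φ = -(potentialGrad θ γ u.laplace).rad r φ := by
  rw [commLaplace, hu.helmholtz_eq hθ]
  change u.laplace.rad r φ - (potentialGrad θ γ u.laplace).rad r φ - u.laplace.rad r φ = _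
  ring

theorem commLaplace_ang (hu : IsTestField θ u) (hθ : 0 < θ) (γ r φ : ℝ) :
    (commLaplace θ γ u).ang r φ = -(potentialGrad θ γ u.laplace).ang r φ := by
  rw [commLaplace, hu.helmholtz_eq hθ]
  change u.laplace.ang r φ - (potentialGrad θ γ u.laplace).ang r φ - u.laplace.ang r φ = _
  ring

end IsTestField

/-! ### The commutator as a gradient -/

theorem LineSymbol.c1OnWedge {θ γ : ℝ} {F F' : ℂ → ℝ → ℂ} (hF : LineSymbol θ γ F)
    (hz : LineSymbol θ γ fun z φ => z * F z φ) (hF' : LineSymbol θ γ F')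
    (hd : ∀ t φ : ℝ, HasDerivAt (F ((γ : ℂ) + (t : ℂ) * Complex.I))
      (F' ((γ : ℂ) + (t : ℂ) * Complex.I) φ) φ) :
    C1OnWedge θ (fun r φ => -(mellinHatInv γ F r φ).re)
      (fun r φ => -(r⁻¹ * (mellinHatInv γ (fun z φ => z * F z φ) r φ).re))
      (fun r φ => -(mellinHatInv γ F' r φ).re) where
  cont := (Complex.continuous_re.comp_continuousOn hF.continuousOn_mellinHatInv).neg
  cont_r := (ContinuousOnWedge.mul continuousOnWedge_inv
    (Complex.continuous_re.comp_continuousOn hz.continuousOn_mellinHatInv)).neg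
  cont_phi := (Complex.continuous_re.comp_continuousOn hF'.continuousOn_mellinHatInv).neg
  deriv_r r hr φ hφ := by
    have := (hasDerivAt_re (hF.hasDerivAt_mellinHatInv_fst hz hr (Ioo_subset_Icc_self hφ))).neg
    rwa [← Complex.ofReal_inv, Complex.re_ofReal_mul] at this
  deriv_phi r hr φ hφ := (hasDerivAt_re (hF.hasDerivAt_mellinHatInv_snd hF' hd hr hφ)).neg

/-- The last two terms of the bilinear forms `B₁` and `B₂` combine to a pairing of the commutator
with the Laplacian. -/
theorem commPow_pairing {θ γ γ' β : ℝ} (hθ : 0 < θ) {u v : PolarField} (hu : IsTestField θ u)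
    (hv : IsTestField θ v) (hγ : |γ + 1| < π / θ) (hγ' : |γ' + 1| < π / θ) (hγ0 : γ' + 1 ≠ 0) :
    intWedge θ (fun r φ => (commPow θ γ β v).gradDot u r φ)
      - intWedge θ (fun r φ => (r ^ 2)⁻¹ *
        dphi (fun r' φ' => dphi u.rad r' φ' * (commPow θ γ β v).rad r' φ') r φ)
      = intWedge θ (fun r φ => (potentialGrad θ γ (v.powMul β)).dot u.laplace r φ) := by
  have hw : NiceField (v.powMul β) := hv.niceField.powMul β
  have hrad := LineSymbol.c1OnWedge (hw.lineSymbol_rad hθ hγ' hγ0) (hw.lineSymbol_mul_rad hθ hγ' hγ0)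
    (hw.lineSymbol_radDeriv hθ hγ' hγ0) (hw.hasDerivAt_gradRadHat hθ hγ' hγ0)
  have hang := LineSymbol.c1OnWedge (hw.lineSymbol_ang hθ hγ' hγ0) (hw.lineSymbol_mul_ang hθ hγ' hγ0)
    (hw.lineSymbol_angDeriv hθ hγ' hγ0) (hw.hasDerivAt_gradAngHat hθ hγ' hγ0)
  have hsin : ∀ t : ℝ, Complex.sin (((γ' : ℂ) + (t : ℂ) * Complex.I + 1) * θ) ≠ 0 := fun t =>
    sin_mul_ne_zero hθ (line_ne_zero (Or.inl hγ0)) (by rwa [line_re])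
  have key := intWedge_gradDot_sub_boundary (q := commPow θ γ β v) (u := u) hθ hrad hang
    (fun r hr φ hφ => by rw [hv.commPow_rad hθ, hw.potentialGrad_rad_eq hθ hγ hγ' hr hφ])
    (fun r hr φ hφ => by rw [hv.commPow_ang hθ, hw.potentialGrad_ang_eq hθ hγ hγ' hr hφ])
    (fun r _ => ?_) (fun r _ => ?_) hu.niceField.rad hu.niceField.ang hu.tangential
  · rw [key, ← neg_one_mul, ← intWedge_const_mul]
    congr 1
    ext r φ
    simp only [PolarField.dot, hv.commPow_rad hθ, hv.commPow_ang hθ]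
    ring
  -- The Neumann data of the potential are transforms of r^β v_φ, which vanishes on the rays; so the
  -- angular component of the commutator vanishes there.
  · have : ∀ t : ℝ, gradAngHat θ (v.powMul β) ((γ' : ℂ) + (t : ℂ) * Complex.I) 0 = 0 := by
      intro t
      rw [gradAngHat, NiceField.potDeriv_zero (hsin t)]
      exact Nice.mellinHat_eq_zero fun r hr => by
        simp [PolarField.powMul, (hv.tangential r hr).1]
    simp [mellinHatInv, this]
  · have : ∀ t : ℝ, gradAngHat θ (v.powMul β) ((γ' : ℂ) + (t : ℂ) * Complex.I) θ = 0 := by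
      intro t
      rw [gradAngHat, NiceField.potDeriv_end (hsin t)]
      exact Nice.mellinHat_eq_zero fun r hr => by
        simp [PolarField.powMul, (hv.tangential r hr).2]
    simp [mellinHatInv, this]

end Wedge

end

noncomputable section

namespace Wedge

open PolarField

/-! ### Pairings in Mellin variables -/

/-- The weighted scalar product `∫_Ω r^{-2α-2} f g dx`. -/
def wform (θ α : ℝ) (f g : ℝ → ℝ → ℝ) : ℝ :=
  intWedge θ fun r φ => r ^ (-2 * α - 2) * (f r φ * g r φ)

/-- The squared `L²` norm of a symbol on the strip `{Re z = γ} × (0, θ)`. -/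
def lineSq (θ γ : ℝ) (F : ℂ → ℝ → ℂ) : ℝ :=
  ∫ t : ℝ, ∫ φ in (0 : ℝ)..θ, ‖F ((γ : ℂ) + (t : ℂ) * Complex.I) φ‖ ^ 2

section Strip

variable {θ : ℝ} {E : Type*} [NormedAddCommGroup E] {H : ℝ → ℝ → E}

theorem integrable_strip (hc : Continuous fun p : ℝ × ℝ => H p.1 p.2)
    (hb : ∃ C : ℝ, ∀ t, ∀ φ ∈ Icc 0 θ, ‖H t φ‖ ≤ C * (1 + t ^ 2)⁻¹) :
    Integrable (fun p : ℝ × ℝ => H p.1 p.2)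
      ((volume : Measure ℝ).prod (volume.restrict (Ioc 0 θ))) := by
  obtain ⟨C, hC⟩ := hb
  have h1 : Integrable (fun p : ℝ × ℝ => C * (1 + p.1 ^ 2)⁻¹)
      ((volume : Measure ℝ).prod (volume.restrict (Ioc 0 θ))) :=
    (integrable_inv_one_add_sq.const_mul C).comp_fst _
  refine h1.mono' hc.aestronglyMeasurable ?_
  have : (volume : Measure ℝ).prod (volume.restrict (Ioc 0 θ))
      = ((volume : Measure ℝ).prod volume).restrict (univ ×ˢ Ioc 0 θ) := by
    rw [← Measure.prod_restrict, Measure.restrict_univ]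
  rw [this]
  filter_upwards [ae_restrict_mem (MeasurableSet.univ.prod measurableSet_Ioc)] with p hp
  exact hC p.1 p.2 (Ioc_subset_Icc_self hp.2)

end Strip

namespace LineSymbol

variable {θ γ : ℝ} {F : ℂ → ℝ → ℂ}

theorem integrable_sq (hF : LineSymbol θ γ F) :
    Integrable (fun p : ℝ × ℝ => ‖F ((γ : ℂ) + (p.1 : ℂ) * Complex.I) p.2‖ ^ 2)
      ((volume : Measure ℝ).prod (volume.restrict (Ioc 0 θ))) := by
  refine integrable_strip (H := fun t φ => ‖F ((γ : ℂ) + (t : ℂ) * Complex.I) φ‖ ^ 2)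
    (hF.continuous.norm.pow 2) ?_
  obtain ⟨C, hC⟩ := hF.bound
  refine ⟨C ^ 2, fun t φ hφ => ?_⟩
  have h1 := hC t φ hφ
  have h2 : (1 + t ^ 2)⁻¹ ≤ 1 := inv_le_one_of_one_le₀ (by nlinarith [sq_nonneg t])
  have h3 : 0 ≤ (1 + t ^ 2)⁻¹ := by positivity
  rw [norm_pow, norm_norm]
  calc ‖F ((γ : ℂ) + (t : ℂ) * Complex.I) φ‖ ^ 2 ≤ (C * (1 + t ^ 2)⁻¹) ^ 2 := by gcongr
    _ = C ^ 2 * ((1 + t ^ 2)⁻¹ * (1 + t ^ 2)⁻¹) := by ring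
    _ ≤ C ^ 2 * ((1 + t ^ 2)⁻¹ * 1) := by gcongr
    _ = _ := by ring

theorem integrable_slice_sq (hθ : 0 < θ) (hF : LineSymbol θ γ F) :
    Integrable fun t : ℝ => ∫ φ in (0 : ℝ)..θ, ‖F ((γ : ℂ) + (t : ℂ) * Complex.I) φ‖ ^ 2 := by
  simp_rw [intervalIntegral.integral_of_le hθ.le]
  exact hF.integrable_sq.integral_prod_left

theorem lineSq_eq (hθ : 0 < θ) (hF : LineSymbol θ γ F) :
    lineSq θ γ F = ∫ p : ℝ × ℝ, ‖F ((γ : ℂ) + (p.1 : ℂ) * Complex.I) p.2‖ ^ 2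
      ∂((volume : Measure ℝ).prod (volume.restrict (Ioc 0 θ))) := by
  simp_rw [lineSq, intervalIntegral.integral_of_le hθ.le]
  exact (integral_prod _ hF.integrable_sq).symm

theorem lineSq_eq_swap (hθ : 0 < θ) (hF : LineSymbol θ γ F) : lineSq θ γ F
    = ∫ φ in (0 : ℝ)..θ, ∫ t : ℝ, ‖F ((γ : ℂ) + (t : ℂ) * Complex.I) φ‖ ^ 2 := by
  rw [hF.lineSq_eq hθ, intervalIntegral.integral_of_le hθ.le]
  exact integral_prod_symm _ hF.integrable_sq

/-- Young's inequality with s kept free, so that the radial and angular components can be added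
before optimising in s. -/
theorem abs_pairing_le (hθ : 0 < θ) (hF : LineSymbol θ γ F) {α : ℝ} {G : ℂ → ℝ → ℂ}
    (hG : LineSymbol θ α G) {s : ℝ} (hs : 0 < s) :
    |∫ φ in (0 : ℝ)..θ, (∫ t : ℝ, F ((γ : ℂ) + (t : ℂ) * Complex.I) φ *
      (starRingEnd ℂ) (G ((α : ℂ) + (t : ℂ) * Complex.I) φ)).re|
      ≤ s / 2 * lineSq θ γ F + s⁻¹ / 2 * lineSq θ α G := by
  set μ := (volume : Measure ℝ).prod (volume.restrict (Ioc 0 θ)) with hμ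
  set K : ℝ → ℝ → ℂ := fun t φ => F ((γ : ℂ) + (t : ℂ) * Complex.I) φ *
      (starRingEnd ℂ) (G ((α : ℂ) + (t : ℂ) * Complex.I) φ) with hK
  have hbd : ∀ t φ, ‖K t φ‖ ≤ s / 2 * ‖F ((γ : ℂ) + (t : ℂ) * Complex.I) φ‖ ^ 2
      + s⁻¹ / 2 * ‖G ((α : ℂ) + (t : ℂ) * Complex.I) φ‖ ^ 2 := by
    intro t φ
    simp only [hK, norm_mul, RCLike.norm_conj]
    set x := ‖F ((γ : ℂ) + (t : ℂ) * Complex.I) φ‖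
    set y := ‖G ((α : ℂ) + (t : ℂ) * Complex.I) φ‖
    have : s / 2 * x ^ 2 + s⁻¹ / 2 * y ^ 2 - x * y = (s * x - y) ^ 2 / (2 * s) := by
      field_simp; ring
    have h2 : 0 ≤ (s * x - y) ^ 2 / (2 * s) := by positivity
    linarith
  have hR := (hF.integrable_sq.const_mul (s / 2)).add (hG.integrable_sq.const_mul (s⁻¹ / 2))
  have hKi : Integrable (fun p : ℝ × ℝ => K p.1 p.2) μ :=
    hR.mono' (hF.continuous.mul (Complex.continuous_conj.comp hG.continuous)).aestronglyMeasurable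
      (Filter.Eventually.of_forall fun p => hbd p.1 p.2)
  have e1 : ∫ φ in (0 : ℝ)..θ, (∫ t : ℝ, K t φ).re = (∫ p : ℝ × ℝ, K p.1 p.2 ∂μ).re := by
    rw [integral_prod_symm _ hKi, intervalIntegral.integral_of_le hθ.le]
    exact integral_re (𝕜 := ℂ) hKi.integral_prod_right
  rw [e1, hF.lineSq_eq hθ, hG.lineSq_eq hθ, ← MeasureTheory.integral_const_mul,
    ← MeasureTheory.integral_const_mul, ← integral_add (hF.integrable_sq.const_mul _)
    (hG.integrable_sq.const_mul _)]
  refine (Complex.abs_re_le_norm _).trans ((norm_integral_le_integral_norm _).trans ?_)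
  exact integral_mono hKi.norm hR fun p => hbd p.1 p.2

end LineSymbol

theorem Nice.lineSymbol_mellinHat {f : ℝ → ℝ → ℝ} (hf : Nice f) (θ α : ℝ) :
    LineSymbol θ α (mellinHat f) := by
  refine ⟨hf.continuous_mellinHat.comp (f := fun p : ℝ × ℝ =>
    ((α : ℂ) + (p.1 : ℂ) * Complex.I, p.2)) (by fun_prop), ?_⟩
  obtain ⟨C, -, hC⟩ := hf.mellinHat_decay |α| θ 2
  refine ⟨C, fun t φ hφ => ?_⟩
  have h1 := hC ((α : ℂ) + (t : ℂ) * Complex.I) (by simp) φ hφ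
  have h2 : |t| ≤ ‖(α : ℂ) + (t : ℂ) * Complex.I‖ := by
    simpa using Complex.abs_im_le_norm ((α : ℂ) + (t : ℂ) * Complex.I)
  have h3 : 1 + t ^ 2 ≤ (1 + ‖(α : ℂ) + (t : ℂ) * Complex.I‖) ^ 2 := by
    rw [← sq_abs t]
    nlinarith [abs_nonneg t]
  rw [← div_eq_mul_inv, le_div_iff₀ (by positivity)]
  exact (mul_le_mul_of_nonneg_left h3 (norm_nonneg _)).trans h1

theorem Nice.lineSq_mellinHat {f : ℝ → ℝ → ℝ} (hf : Nice f) {θ : ℝ} (hθ : 0 < θ) (α : ℝ) :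
    lineSq θ α (mellinHat f) = wform θ α f f := by
  rw [(hf.lineSymbol_mellinHat θ α).lineSq_eq_swap hθ, wform, intWedge]
  simp_rw [hf.integral_mellinHat_sq]
  refine intervalIntegral.integral_congr fun φ _ => ?_
  refine setIntegral_congr_fun measurableSet_Ioi fun r hr => ?_
  have hr' : (0 : ℝ) < r := hr
  have : r ^ (-2 * α - 1) = r ^ (-2 * α - 2) * r := by
    rw [← Real.rpow_add_one hr'.ne']; ring_nf
  simp only [this]; ring

/-- The exponents γ, κ and α must add up to zero because the remaining measure is dr/r. This
relation dictates to which line the symbol has to be shifted. -/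
theorem LineSymbol.intWedge_inv_mul {θ γ κ α : ℝ} {F : ℂ → ℝ → ℂ} (hF : LineSymbol θ γ F)
    (hθ : 0 < θ) {L : ℝ → ℝ → ℝ} (hL : Nice L) (hα : γ + κ = -α) :
    intWedge θ (fun r φ => (mellinHatInv γ F r φ).re * (r ^ κ * ((r ^ 2)⁻¹ * L r φ)))
      = ∫ φ in (0 : ℝ)..θ, (∫ t : ℝ, F ((γ : ℂ) + (t : ℂ) * Complex.I) φ *
          (starRingEnd ℂ) (mellinHat L ((α : ℂ) + (t : ℂ) * Complex.I) φ)).re := by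
  refine intervalIntegral.integral_congr fun φ hφ => ?_
  rw [uIcc_of_le hθ.le] at hφ
  simp only [← hF.integral_mellinHatInv_mul hL hα hφ]
  refine setIntegral_congr_fun measurableSet_Ioi fun r hr => ?_
  have hr' : (0 : ℝ) < r := hr
  have : r ^ κ = r ^ (κ - 1) * r := by
    rw [← Real.rpow_add_one hr'.ne']; ring_nf
  simp only [this]
  field_simp

/-- The optimal parameter is s = √B/√A. A and B are first enlarged by e > 0, so that vanishing ones
cause no trouble. -/
theorem sq_le_mul_of_forall {x A B : ℝ} (hA : 0 ≤ A) (hB : 0 ≤ B)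
    (h : ∀ s : ℝ, 0 < s → |x| ≤ s / 2 * A + s⁻¹ / 2 * B) : x ^ 2 ≤ A * B := by
  have key : ∀ e : ℝ, 0 < e → x ^ 2 ≤ (A + e) * (B + e) := by
    intro e he
    have h1 : 0 < A + e := by linarith
    have h2 : 0 < B + e := by linarith
    have hq := h (√(B + e) / √(A + e)) (by positivity)
    have e1 : √(A + e) * √(A + e) = A + e := Real.mul_self_sqrt h1.le
    have e2 : √(B + e) * √(B + e) = B + e := Real.mul_self_sqrt h2.le
    have p1 : 0 < √(A + e) := Real.sqrt_pos.2 h1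
    have p2 : 0 < √(B + e) := Real.sqrt_pos.2 h2
    have hle : |x| ≤ √(A + e) * √(B + e) := by
      refine hq.trans ?_
      calc √(B + e) / √(A + e) / 2 * A + (√(B + e) / √(A + e))⁻¹ / 2 * B
          ≤ √(B + e) / √(A + e) / 2 * (A + e) + (√(B + e) / √(A + e))⁻¹ / 2 * (B + e) := by
            gcongr <;> linarith
        _ = √(B + e) / √(A + e) / 2 * (√(A + e) * √(A + e))
            + (√(B + e) / √(A + e))⁻¹ / 2 * (√(B + e) * √(B + e)) := by rw [e1, e2]
        _ = √(A + e) * √(B + e) := by field_simp; ring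
    calc x ^ 2 = |x| ^ 2 := (sq_abs x).symm
      _ ≤ (√(A + e) * √(B + e)) ^ 2 := by gcongr
      _ = (√(A + e) * √(A + e)) * (√(B + e) * √(B + e)) := by ring
      _ = _ := by rw [e1, e2]
  have hlim : Filter.Tendsto (fun e : ℝ => (A + e) * (B + e)) (nhdsWithin 0 (Ioi 0))
      (nhds ((A + 0) * (B + 0))) :=
    ((continuous_const.add continuous_id).mul (continuous_const.add continuous_id)).continuousAt.tendsto.mono_left
      nhdsWithin_le_nhds
  have := ge_of_tendsto hlim (by filter_upwards [self_mem_nhdsWithin] with e he using key e he)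
  simpa using this

theorem lineSq_nonneg {θ : ℝ} (hθ : 0 < θ) (γ : ℝ) (F : ℂ → ℝ → ℂ) : 0 ≤ lineSq θ γ F :=
  integral_nonneg fun _ => intervalIntegral.integral_nonneg hθ.le fun _ _ => by positivity

theorem wform_self_nonneg {θ : ℝ} (hθ : 0 < θ) (α : ℝ) (f : ℝ → ℝ → ℝ) : 0 ≤ wform θ α f f :=
  intWedge_nonneg hθ fun _ hr _ _ => mul_nonneg (Real.rpow_nonneg hr.le _) (mul_self_nonneg _)

/-- Cauchy-Schwarz for the pairing of the gradient of a potential with `r^κ r⁻² L`. -/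
theorem NiceField.pairing_sq_le {θ γ γ' κ α : ℝ} {w l : PolarField} (hw : NiceField w)
    (hl : NiceField l) (hθ : 0 < θ) (hγ : |γ + 1| < π / θ) (hγ' : |γ' + 1| < π / θ)
    (hγ0 : γ' + 1 ≠ 0) (hα : γ' + κ = -α) :
    (intWedge θ fun r φ => r ^ κ * ((potentialGrad θ γ w).rad r φ * ((r ^ 2)⁻¹ * l.rad r φ)
        + (potentialGrad θ γ w).ang r φ * ((r ^ 2)⁻¹ * l.ang r φ))) ^ 2
      ≤ (lineSq θ γ' (gradRadHat θ w) + lineSq θ γ' (gradAngHat θ w))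
        * (wform θ α l.rad l.rad + wform θ α l.ang l.ang) := by
  have s1 := hw.lineSymbol_rad hθ hγ' hγ0
  have s2 := hw.lineSymbol_ang hθ hγ' hγ0
  have c1 : ContinuousOnWedge θ fun r φ => (mellinHatInv γ' (gradRadHat θ w) r φ).re :=
    Complex.continuous_re.comp_continuousOn s1.continuousOn_mellinHatInv
  have c2 : ContinuousOnWedge θ fun r φ => (mellinHatInv γ' (gradAngHat θ w) r φ).re :=
    Complex.continuous_re.comp_continuousOn s2.continuousOn_mellinHatInv
  rw [intWedge_congr hθ (g := fun r φ =>
    (mellinHatInv γ' (gradRadHat θ w) r φ).re * (r ^ κ * ((r ^ 2)⁻¹ * l.rad r φ))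
      + (mellinHatInv γ' (gradAngHat θ w) r φ).re * (r ^ κ * ((r ^ 2)⁻¹ * l.ang r φ)))
    fun r hr φ hφ => by
      rw [hw.potentialGrad_rad_eq hθ hγ hγ' hr hφ, hw.potentialGrad_ang_eq hθ hγ hγ' hr hφ]; ring,
    intWedge_add hθ (WedgeIntegrable.mul_nice c1 (hl.rad.inv_sq_mul.rpow_mul κ))
      (WedgeIntegrable.mul_nice c2 (hl.ang.inv_sq_mul.rpow_mul κ)),
    s1.intWedge_inv_mul hθ hl.rad hα, s2.intWedge_inv_mul hθ hl.ang hα]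
  refine sq_le_mul_of_forall (add_nonneg (lineSq_nonneg hθ _ _) (lineSq_nonneg hθ _ _))
    (add_nonneg (wform_self_nonneg hθ _ _) (wform_self_nonneg hθ _ _)) fun s hs => ?_
  have b1 := s1.abs_pairing_le hθ (hl.rad.lineSymbol_mellinHat θ α) hs
  have b2 := s2.abs_pairing_le hθ (hl.ang.lineSymbol_mellinHat θ α) hs
  rw [hl.rad.lineSq_mellinHat hθ] at b1
  rw [hl.ang.lineSq_mellinHat hθ] at b2
  refine (abs_add_le _ _).trans ((add_le_add b1 b2).trans (le_of_eq ?_))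
  ring

/-! ### The potentials of r^{-2α}u and of Δu for solenoidal u -/

section Bounds

variable {θ α δ : ℝ} {u : PolarField}

theorem lineSq_add_le {γ : ℝ} {F G : ℂ → ℝ → ℂ} (hθ : 0 < θ) (hF : LineSymbol θ γ F)
    (hG : LineSymbol θ γ G) {R : ℝ → ℝ} (hR : Integrable R)
    (h : ∀ t : ℝ, (∫ φ in (0 : ℝ)..θ, ‖F ((γ : ℂ) + (t : ℂ) * Complex.I) φ‖ ^ 2)
      + (∫ φ in (0 : ℝ)..θ, ‖G ((γ : ℂ) + (t : ℂ) * Complex.I) φ‖ ^ 2) ≤ R t) :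
    lineSq θ γ F + lineSq θ γ G ≤ ∫ t, R t := by
  rw [lineSq, lineSq, ← integral_add (hF.integrable_slice_sq hθ) (hG.integrable_slice_sq hθ)]
  exact integral_mono ((hF.integrable_slice_sq hθ).add (hG.integrable_slice_sq hθ)) hR h

theorem integral_gradRadHat_sq (w : PolarField) (z : ℂ) :
    ∫ φ in (0 : ℝ)..θ, ‖gradRadHat θ w z φ‖ ^ 2
      = ‖z + 1‖ ^ 2 * ∫ φ in (0 : ℝ)..θ, ‖pot θ w (z + 1) φ‖ ^ 2 := by
  simp only [gradRadHat, norm_mul, mul_pow, intervalIntegral.integral_const_mul]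

/-- The potential of `r^{-2α} v` for solenoidal `v`. -/
theorem IsTestField.lineSq_powMul_le (hu : IsTestField θ u) (hθ : 0 < θ) (hδ : 0 < δ) (hδ1 : δ ≤ 1)
    (hα : |1 - α| ≤ (1 - δ) * (π / θ)) (hlt : |-α + 1| < π / θ) (h0 : -α + 1 ≠ 0) (h1 : α + 1 ≠ 0) :
    lineSq θ (-α) (gradRadHat θ (u.powMul (-2 * α))) + lineSq θ (-α) (gradAngHat θ (u.powMul (-2 * α)))
      ≤ 4 / δ ^ 2 * θ ^ 2 * ((-2 * α) ^ 2 * wform θ α u.rad u.rad) := by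
  have hn := hu.niceField
  have hw := hn.powMul (-2 * α)
  have hli := hn.rad.lineSymbol_mellinHat θ α
  have d1 : lineSq θ α (mellinHat u.rad)
      = ∫ t : ℝ, ∫ φ in (0 : ℝ)..θ, ‖mellinHat u.rad ((α : ℂ) + (t : ℂ) * Complex.I) φ‖ ^ 2 := rfl
  rw [← hn.rad.lineSq_mellinHat hθ, d1, ← MeasureTheory.integral_const_mul,
    ← MeasureTheory.integral_const_mul]
  refine lineSq_add_le hθ (hw.lineSymbol_rad hθ hlt h0) (hw.lineSymbol_ang hθ hlt h0)
    (((hli.integrable_slice_sq hθ).const_mul _).const_mul _) fun t => ?_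
  set z : ℂ := ((-α : ℝ) : ℂ) + (t : ℂ) * Complex.I with hz
  set ζ : ℂ := (α : ℂ) + (t : ℂ) * Complex.I with hζ
  have hz0 : z + 1 ≠ 0 := line_ne_zero (Or.inl h0)
  have hs : Complex.sin ((z + 1) * θ) ≠ 0 := sin_mul_ne_zero hθ hz0 (by rwa [hz, line_re])
  have hre : |(z + 1).re| ≤ (1 - δ) * (π / θ) := by
    rw [hz, line_re, neg_add_eq_sub]; exact hα
  have hzζ : z - ((-2 * α : ℝ) : ℂ) = ζ := by simp only [hz, hζ]; push_cast; ring
  -- The source is (z+1)û_r(ζ) - (ζ+1)û_r(ζ) with ζ = z + 2α. The spectral parameter drops out and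
  -- only the small factor -2α survives.
  have hsrc : ∀ s ∈ Icc 0 θ, potSource (u.powMul (-2 * α)) (z + 1) s
      = ((-2 * α : ℝ) : ℂ) * mellinHat u.rad ζ s := by
    intro s hs
    have e1 : dphi (u.powMul (-2 * α)).ang = fun r φ => r ^ (-2 * α) * dphi u.ang r φ :=
      hn.ang.dphi_smul fun r => r ^ (-2 * α)
    rw [potSource, e1, add_sub_cancel_right]
    simp only [PolarField.powMul, Nice.mellinHat_rpow_mul, hzζ]
    rw [hu.mellinHat_dphi_ang hθ ζ hs, ← hzζ]
    ring
  -- û_φ vanishes at both ends, so -(ζ+1) times this integral is zero; ζ ≠ -1 because α ≠ -1.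
  have hmean : ∫ s in (0 : ℝ)..θ, mellinHat u.rad ζ s = 0 := by
    have h2 : ∫ s in (0 : ℝ)..θ, mellinHat (dphi u.ang) ζ s = 0 := by
      rw [intervalIntegral.integral_eq_sub_of_hasDerivAt
        (fun s _ => hn.ang.hasDerivAt_mellinHat_snd ζ s), hu.mellinHat_ang_zero,
        hu.mellinHat_ang_end, sub_zero]
      exact (hn.ang.dphi.continuous_mellinHat.comp (f := fun s : ℝ => (ζ, s))
        (by fun_prop)).intervalIntegrable _ _
    rw [intervalIntegral.integral_congr (g := fun s => (-(ζ + 1)) * mellinHat u.rad ζ s)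
      fun s hs => by
        rw [uIcc_of_le hθ.le] at hs
        simp only [hu.mellinHat_dphi_ang hθ ζ hs]; ring,
      intervalIntegral.integral_const_mul] at h2
    exact (mul_eq_zero.1 h2).resolve_left (neg_ne_zero.2 (line_ne_zero (Or.inl h1)))
  have hzero : ∀ s, (∀ r, 0 < r → u.ang r s = 0) →
      mellinHat (u.powMul (-2 * α)).ang (z + 1 - 1) s = 0 := fun s h =>
    Nice.mellinHat_eq_zero fun r hr => by simp [PolarField.powMul, h r hr]
  have key := (hw.helmholtzODE hz0 hs).gradient_le_source hθ hδ hδ1 hre hz0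
    (by rw [NiceField.potDeriv_zero hs, hzero 0 fun r hr => (hu.tangential r hr).1])
    (by rw [NiceField.potDeriv_end hs, hzero θ fun r hr => (hu.tangential r hr).2])
    (by
      rw [intervalIntegral.integral_congr (g := fun s => ((-2 * α : ℝ) : ℂ) * mellinHat u.rad ζ s)
        fun s hs => hsrc s (by rwa [uIcc_of_le hθ.le] at hs),
        intervalIntegral.integral_const_mul, hmean, mul_zero])
  have e2 : ∫ x in (0 : ℝ)..θ, ‖potSource (u.powMul (-2 * α)) (z + 1) x‖ ^ 2
      = (-2 * α) ^ 2 * ∫ x in (0 : ℝ)..θ, ‖mellinHat u.rad ζ x‖ ^ 2 := by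
    rw [← intervalIntegral.integral_const_mul]
    refine intervalIntegral.integral_congr fun s hs => ?_
    rw [uIcc_of_le hθ.le] at hs
    simp only [hsrc s hs, norm_mul, mul_pow, Complex.norm_real, Real.norm_eq_abs, sq_abs]
  rw [e2] at key
  rw [integral_gradRadHat_sq, add_comm]
  exact key

/-- The potential of `Δu` for solenoidal `u`. -/
theorem IsTestField.lineSq_laplace_le (hu : IsTestField θ u) (hθ : 0 < θ) (hδ : 0 < δ) (hδ1 : δ ≤ 1)
    (hα : |1 - α| ≤ (1 - δ) * (π / θ)) (hlt : |α - 2 + 1| < π / θ) (h0 : α - 2 + 1 ≠ 0) {η : ℝ}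
    (hη : 0 < η) :
    lineSq θ (α - 2) (gradRadHat θ u.laplace) + lineSq θ (α - 2) (gradAngHat θ u.laplace)
      ≤ η * wform θ α (dphi (dphi u.rad)) (dphi (dphi u.rad))
        + 2 * (32 / δ ^ 2 + (32 / δ ^ 2) ^ 2 / η) *
          (2 * wform θ α (rdr (dphi u.rad)) (rdr (dphi u.rad))
            + (2 + (θ ^ 2)⁻¹) * wform θ α (dphi u.rad) (dphi u.rad)) := by
  have hn := hu.niceField
  have hw := hn.laplace
  have nf := hn.rad.dphi
  have l1 := nf.dphi.lineSymbol_mellinHat θ α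
  have l2 := nf.rdr.lineSymbol_mellinHat θ α
  have l3 := nf.lineSymbol_mellinHat θ α
  set K : ℝ := 2 * (32 / δ ^ 2 + (32 / δ ^ 2) ^ 2 / η) with hK
  have hK0 : 0 ≤ K := by positivity
  have i1 := (l1.integrable_slice_sq hθ).const_mul η
  have i2 := (l2.integrable_slice_sq hθ).const_mul 2
  have i3 := (l3.integrable_slice_sq hθ).const_mul (2 + (θ ^ 2)⁻¹)
  have i23 := (i2.add i3).const_mul K
  simp only [Pi.add_apply] at i23
  have d (f : ℝ → ℝ → ℝ) : lineSq θ α (mellinHat f)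
      = ∫ t : ℝ, ∫ φ in (0 : ℝ)..θ, ‖mellinHat f ((α : ℂ) + (t : ℂ) * Complex.I) φ‖ ^ 2 := rfl
  rw [← nf.dphi.lineSq_mellinHat hθ, ← nf.rdr.lineSq_mellinHat hθ, ← nf.lineSq_mellinHat hθ,
    d, d, d, ← MeasureTheory.integral_const_mul,
    ← MeasureTheory.integral_const_mul, ← MeasureTheory.integral_const_mul, ← integral_add i2 i3,
    ← MeasureTheory.integral_const_mul, ← integral_add i1 i23]
  refine lineSq_add_le hθ (hw.lineSymbol_rad hθ hlt h0) (hw.lineSymbol_ang hθ hlt h0)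
    (i1.add i23) fun t => ?_
  set z : ℂ := ((α - 2 : ℝ) : ℂ) + (t : ℂ) * Complex.I with hz
  set ζ : ℂ := (α : ℂ) + (t : ℂ) * Complex.I with hζ
  have hz0 : z + 1 ≠ 0 := line_ne_zero (Or.inl h0)
  have hs : Complex.sin ((z + 1) * θ) ≠ 0 := sin_mul_ne_zero hθ hz0 (by rwa [hz, line_re])
  have hre : |(z + 1).re| ≤ (1 - δ) * (π / θ) := by
    rw [hz, line_re, show α - 2 + 1 = -(1 - α) by ring, abs_neg]; exact hα
  have hzζ : z + 2 = ζ := by simp only [hz, hζ]; push_cast; ring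
  have hzz : z + 1 = ζ - 1 := by rw [← hzζ]; ring
  have hrad : ∀ s ∈ Icc 0 θ, mellinHat u.laplace.rad z s
      = (ζ + 1) ^ 2 * mellinHat u.rad ζ s + mellinHat (dphi (dphi u.rad)) ζ s := by
    intro s hs
    change mellinHat (fun r φ => (r ^ 2)⁻¹ * lapRad u r φ) z s = _
    rw [Nice.mellinHat_inv_sq_mul, hzζ]
    have e1 := ((hn.rad.rdr.rdr.add hn.rad.dphi.dphi).sub (hn.ang.dphi.const_mul 2)).mellinHat_sub
      hn.rad ζ s
    have e2 := (hn.rad.rdr.rdr.add hn.rad.dphi.dphi).mellinHat_sub (hn.ang.dphi.const_mul 2) ζ s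
    have e3 := hn.rad.rdr.rdr.mellinHat_add hn.rad.dphi.dphi ζ s
    change mellinHat (fun _ _ => _) ζ s = _
    simp only [lapRad]
    rw [e1, e2, e3, hn.rad.rdr.mellinHat_rdr, hn.rad.mellinHat_rdr,
      Nice.mellinHat_const_mul 2 (dphi u.ang), hu.mellinHat_dphi_ang hθ ζ hs]
    push_cast; ring
  have hdd : ∀ s ∈ Icc 0 θ, mellinHat (dphi (dphi u.ang)) ζ s
      = -((ζ + 1) * mellinHat (dphi u.rad) ζ s) := by
    intro s hs
    rw [Nice.mellinHat_congr (g := fun r φ => (-1 : ℝ) * (rdr (dphi u.rad) r φ + dphi u.rad r φ))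
      fun r hr => by rw [hu.dphi_dphi_ang hθ hr s hs]; ring,
      Nice.mellinHat_const_mul (-1) (fun r φ => rdr (dphi u.rad) r φ + dphi u.rad r φ),
      nf.rdr.mellinHat_add nf, nf.mellinHat_rdr]
    push_cast; ring
  have hddd : ∀ s ∈ Icc 0 θ, mellinHat (dphi (dphi (dphi u.ang))) ζ s
      = -((ζ + 1) * mellinHat (dphi (dphi u.rad)) ζ s) := by
    intro s hs
    rw [Nice.mellinHat_congr
      (g := fun r φ => (-1 : ℝ) * (rdr (dphi (dphi u.rad)) r φ + dphi (dphi u.rad) r φ))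
      fun r hr => by rw [hu.dphi_dphi_dphi_ang hθ hr s hs]; ring,
      Nice.mellinHat_const_mul (-1) (fun r φ => rdr (dphi (dphi u.rad)) r φ + dphi (dphi u.rad) r φ),
      nf.dphi.rdr.mellinHat_add nf.dphi, nf.dphi.mellinHat_rdr]
    push_cast; ring
  have hdang : ∀ s ∈ Icc 0 θ, mellinHat (dphi u.laplace.ang) z s
      = -((ζ + 1) * (ζ ^ 2 - 1)) * mellinHat u.rad ζ s
        + (1 - ζ) * mellinHat (dphi (dphi u.rad)) ζ s := by
    intro s hs
    have e0 : dphi u.laplace.ang = fun r φ => (r ^ 2)⁻¹ * dphi (lapAng u) r φ :=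
      hn.lapAng.dphi_smul fun r => (r ^ 2)⁻¹
    have m1 := ((hn.ang.rdr.rdr.add hn.ang.dphi.dphi).add (nf.const_mul 2)).dphi_sub hn.ang
    have m2 := (hn.ang.rdr.rdr.add hn.ang.dphi.dphi).dphi_add (nf.const_mul 2)
    have m3 := hn.ang.rdr.rdr.dphi_add hn.ang.dphi.dphi
    have m4 := nf.dphi_smul fun _ => 2
    have e4 : dphi (lapAng u) = fun r φ => rdr (rdr (dphi u.ang)) r φ + dphi (dphi (dphi u.ang)) r φ
        + 2 * dphi (dphi u.rad) r φ - dphi u.ang r φ := by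
      rw [← hn.ang.dphi_rdr, ← hn.ang.rdr.dphi_rdr]
      rw [m2, m3, m4] at m1
      exact m1
    have na := hn.ang.dphi
    have e1 := ((na.rdr.rdr.add na.dphi.dphi).add (nf.dphi.const_mul 2)).mellinHat_sub na ζ s
    have e2 := (na.rdr.rdr.add na.dphi.dphi).mellinHat_add (nf.dphi.const_mul 2) ζ s
    have e3 := na.rdr.rdr.mellinHat_add na.dphi.dphi ζ s
    rw [e0, Nice.mellinHat_inv_sq_mul, hzζ, e4, e1, e2, e3, na.rdr.mellinHat_rdr, na.mellinHat_rdr,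
      Nice.mellinHat_const_mul 2 (dphi (dphi u.rad)), hu.mellinHat_dphi_ang hθ ζ hs, hddd s hs]
    push_cast; ring
  -- Δu is solenoidal, as div and Δ commute; only the normal component of Δu on the rays drives the
  -- potential.
  have hsrc : ∀ s ∈ Icc 0 θ, potSource u.laplace (z + 1) s = 0 := by
    intro s hs
    rw [potSource, add_sub_cancel_right, hrad s hs, hdang s hs, hzz]
    ring
  -- Where u_φ = 0, the angular component of r²Δu is ∂_φ²u_φ + 2∂_φ u_r. By solenoidality its
  -- transform is 1 - ζ = -(z+1) times that of ∂_φ u_r.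
  have hbdy : ∀ s ∈ Icc 0 θ, (∀ r, 0 < r → u.ang r s = 0) →
      mellinHat u.laplace.ang (z + 1 - 1) s = -(z + 1) * mellinHat (dphi u.rad) ζ s := by
    intro s hs h
    rw [add_sub_cancel_right]
    change mellinHat (fun r φ => (r ^ 2)⁻¹ * lapAng u r φ) z s = _
    rw [Nice.mellinHat_inv_sq_mul, hzζ]
    have e1 := ((hn.ang.rdr.rdr.add hn.ang.dphi.dphi).add (nf.const_mul 2)).mellinHat_sub hn.ang ζ s
    have e2 := (hn.ang.rdr.rdr.add hn.ang.dphi.dphi).mellinHat_add (nf.const_mul 2) ζ s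
    have e3 := hn.ang.rdr.rdr.mellinHat_add hn.ang.dphi.dphi ζ s
    change mellinHat (fun _ _ => _) ζ s = _
    simp only [lapAng]
    rw [e1, e2, e3, hn.ang.rdr.mellinHat_rdr, hn.ang.mellinHat_rdr, Nice.mellinHat_eq_zero h,
      Nice.mellinHat_const_mul 2 (dphi u.rad), hdd s hs, hzz]
    push_cast; ring
  have key := (hw.helmholtzODE hz0 hs).gradient_le_boundary hθ hδ hδ1 hre hz0 hsrc
    (f := mellinHat (dphi u.rad) ζ) (f' := mellinHat (dphi (dphi u.rad)) ζ)
    (fun s => nf.hasDerivAt_mellinHat_snd ζ s)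
    (nf.dphi.continuous_mellinHat.comp (f := fun s : ℝ => (ζ, s)) (by fun_prop))
    (by rw [NiceField.potDeriv_zero hs, hbdy 0 (left_mem_Icc.2 hθ.le)
      fun r hr => (hu.tangential r hr).1])
    (by rw [NiceField.potDeriv_end hs, hbdy θ (right_mem_Icc.2 hθ.le)
      fun r hr => (hu.tangential r hr).2]) hη
  have e2 : ∫ x in (0 : ℝ)..θ, ‖mellinHat (rdr (dphi u.rad)) ζ x‖ ^ 2
      = ‖ζ‖ ^ 2 * ∫ x in (0 : ℝ)..θ, ‖mellinHat (dphi u.rad) ζ x‖ ^ 2 := by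
    simp only [nf.mellinHat_rdr, norm_mul, mul_pow, intervalIntegral.integral_const_mul]
  have hnorm : ‖z + 1‖ ^ 2 ≤ 2 * ‖ζ‖ ^ 2 + 2 := by
    have := norm_sub_le ζ 1
    rw [← hzz, norm_one] at this
    nlinarith [norm_nonneg (z + 1), norm_nonneg ζ, sq_nonneg (‖ζ‖ - 1)]
  have hI : 0 ≤ ∫ x in (0 : ℝ)..θ, ‖mellinHat (dphi u.rad) ζ x‖ ^ 2 :=
    intervalIntegral.integral_nonneg hθ.le fun _ _ => by positivity
  rw [integral_gradRadHat_sq, add_comm]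
  refine key.trans ?_
  rw [← hK]
  simp only [e2]
  set I := ∫ x in (0 : ℝ)..θ, ‖mellinHat (dphi u.rad) ζ x‖ ^ 2
  have : K * (‖z + 1‖ ^ 2 + (θ ^ 2)⁻¹) * I ≤ K * (2 * ‖ζ‖ ^ 2 + 2 + (θ ^ 2)⁻¹) * I := by gcongr
  linarith

end Bounds

end Wedge

end

noncomputable section

namespace Wedge

open PolarField

/-! ### Weighted scalar products -/

/-- The weighted scalar product `∫_{∂Ω'} r^{-2α} f g ds`. -/
def rform (θ α : ℝ) (f g : ℝ → ℝ → ℝ) : ℝ :=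
  intRays θ fun r φ => r ^ (-2 * α) * (f r φ * g r φ)

/-- The weighted scalar product `∫_Ω r^{-2α-2} X · Y dx` of vector fields. -/
def vform (θ α : ℝ) (X Y : PolarField) : ℝ :=
  intWedge θ fun r φ => r ^ (-2 * α - 2) * X.dot Y r φ

theorem sq_le_mul_of_quadratic_nonneg {A B C : ℝ} (h : ∀ s : ℝ, 0 ≤ A + 2 * s * B + s ^ 2 * C) :
    B ^ 2 ≤ A * C := by
  have := discrim_le_zero (a := C) (b := 2 * B) (c := A) fun s => by
    have := h s
    nlinarith
  rw [discrim] at this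
  nlinarith

section Forms

variable {θ α : ℝ} {f g : ℝ → ℝ → ℝ} {X Y : PolarField}

theorem Nice.integrableOn_ray (hf : Nice f) (φ : ℝ) : IntegrableOn (fun r => f r φ) (Ioi 0) := by
  obtain ⟨a, b, -, -, h⟩ := hf.supp
  refine Integrable.integrableOn (Continuous.integrable_of_hasCompactSupport
    (hf.continuous.comp (f := fun r : ℝ => (r, φ)) (by fun_prop)) ?_)
  exact HasCompactSupport.intro (isCompact_Icc (a := a) (b := b)) fun r hr => h r φ hr

theorem intRays_add (hf : Nice f) (hg : Nice g) :
    intRays θ (fun r φ => f r φ + g r φ) = intRays θ f + intRays θ g := by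
  simp only [intRays]
  rw [integral_add (hf.integrableOn_ray 0) (hg.integrableOn_ray 0),
    integral_add (hf.integrableOn_ray θ) (hg.integrableOn_ray θ)]
  ring

theorem intRays_const_mul (θ c : ℝ) (f : ℝ → ℝ → ℝ) :
    intRays θ (fun r φ => c * f r φ) = c * intRays θ f := by
  simp only [intRays, MeasureTheory.integral_const_mul]
  ring

theorem intRays_nonneg (h : ∀ r φ, 0 < r → 0 ≤ f r φ) : 0 ≤ intRays θ f :=
  add_nonneg (setIntegral_nonneg measurableSet_Ioi fun r hr => h r 0 hr)
    (setIntegral_nonneg measurableSet_Ioi fun r hr => h r θ hr)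

theorem rform_self_nonneg (θ α : ℝ) (f : ℝ → ℝ → ℝ) : 0 ≤ rform θ α f f :=
  intRays_nonneg fun _ _ hr => mul_nonneg (Real.rpow_nonneg hr.le _) (mul_self_nonneg _)

theorem Nice.rform_add_smul (hf : Nice f) (hg : Nice g) (s : ℝ) :
    rform θ α (fun r φ => f r φ + s * g r φ) (fun r φ => f r φ + s * g r φ)
      = rform θ α f f + 2 * s * rform θ α f g + s ^ 2 * rform θ α g g := by
  have n1 := (hf.mul hf).rpow_mul (-2 * α)
  have n2 := (hf.mul hg).rpow_mul (-2 * α)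
  have n3 := (hg.mul hg).rpow_mul (-2 * α)
  rw [rform, rform, rform, rform, ← intRays_const_mul, ← intRays_const_mul,
    ← intRays_add n1 (n2.const_mul _), ← intRays_add (n1.add (n2.const_mul _)) (n3.const_mul _)]
  congr 1; ext r φ; ring

theorem Nice.rform_sq_le (hf : Nice f) (hg : Nice g) :
    rform θ α f g ^ 2 ≤ rform θ α f f * rform θ α g g :=
  sq_le_mul_of_quadratic_nonneg fun s => by
    rw [← hf.rform_add_smul hg]
    exact rform_self_nonneg _ _ _

theorem Nice.rform_add_right {h : ℝ → ℝ → ℝ} (hf : Nice f) (hg : Nice g) (hh : Nice h) (s : ℝ) :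
    rform θ α f (fun r φ => g r φ + s * h r φ) = rform θ α f g + s * rform θ α f h := by
  rw [rform, rform, rform, ← intRays_const_mul, ← intRays_add ((hf.mul hg).rpow_mul _)
    (((hf.mul hh).rpow_mul _).const_mul s)]
  congr 1; ext r φ; ring

/-- Integration by parts along the boundary rays. -/
theorem Nice.rform_rdr (hf : Nice f) :
    rform θ α (Wedge.rdr f) f = -((1 - 2 * α) / 2) * rform θ α f f := by
  have key : ∀ φ, ∫ r in Ioi (0 : ℝ), ((1 - 2 * α) * (r ^ (-2 * α) * (f r φ * f r φ))
      + 2 * (r ^ (-2 * α) * (Wedge.rdr f r φ * f r φ))) = 0 := by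
    intro φ
    obtain ⟨a, b, ha, hab, h⟩ := hf.supp
    refine integral_Ioi_deriv_eq_zero (F := fun r => r ^ (1 - 2 * α) * (f r φ * f r φ)) ha hab
      (fun r hr => by simp [h r φ hr]) (fun r hr => by simp [h r φ hr]) (fun r hr => ?_) ?_
    · refine ((Real.hasDerivAt_rpow_const (p := 1 - 2 * α) (Or.inl hr.ne')).mul
        ((hf.hasDerivAt_dr r φ).mul (hf.hasDerivAt_dr r φ))).congr_deriv ?_
      have e : r ^ (1 - 2 * α) = r ^ (-2 * α) * r := by
        rw [← Real.rpow_add_one hr.ne']; ring_nf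
      have e2 : (1 - 2 * α - 1) = -2 * α := by ring
      simp only [e, e2, Wedge.rdr, Pi.mul_apply]; ring
    · exact ((((hf.mul hf).rpow_mul (-2 * α)).const_mul (1 - 2 * α)).add
        (((hf.rdr.mul hf).rpow_mul (-2 * α)).const_mul 2)).continuous.comp
        (f := fun r : ℝ => (r, φ)) (by fun_prop) |>.continuousOn
  have n1 := (hf.mul hf).rpow_mul (-2 * α)
  have n2 := (hf.rdr.mul hf).rpow_mul (-2 * α)
  have : intRays θ (fun r φ => (1 - 2 * α) * (r ^ (-2 * α) * (f r φ * f r φ))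
      + 2 * (r ^ (-2 * α) * (Wedge.rdr f r φ * f r φ))) = 0 := by
    rw [intRays, key, key, add_zero]
  rw [intRays_add (n1.const_mul _) (n2.const_mul _), intRays_const_mul, intRays_const_mul] at this
  simp only [rform]
  linarith

theorem Nice.wedgeIntegrable_wform (hf : Nice f) (hg : Nice g) (θ α : ℝ) :
    WedgeIntegrable θ fun r φ => r ^ (-2 * α - 2) * (f r φ * g r φ) :=
  WedgeIntegrable.of_nice ((hf.mul hg).rpow_mul _)

theorem Nice.wform_add_smul (hθ : 0 < θ) (hf : Nice f) (hg : Nice g) (s : ℝ) :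
    wform θ α (fun r φ => f r φ + s * g r φ) (fun r φ => f r φ + s * g r φ)
      = wform θ α f f + 2 * s * wform θ α f g + s ^ 2 * wform θ α g g := by
  have n1 := hf.wedgeIntegrable_wform hf θ α
  have n2 := hf.wedgeIntegrable_wform hg θ α
  have n3 := hg.wedgeIntegrable_wform hg θ α
  rw [wform, wform, wform, wform, ← intWedge_const_mul, ← intWedge_const_mul,
    ← intWedge_add hθ n1 (n2.const_mul _),
    ← intWedge_add hθ (n1.add (n2.const_mul _)) (n3.const_mul _)]
  congr 1; ext r φ; ring

theorem Nice.wform_add_le (hθ : 0 < θ) (hf : Nice f) (hg : Nice g) {s : ℝ} (hs : 0 < s) :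
    wform θ α (fun r φ => f r φ + g r φ) (fun r φ => f r φ + g r φ)
      ≤ (1 + s) * wform θ α f f + (1 + s⁻¹) * wform θ α g g := by
  have h1 := hf.wform_add_smul (α := α) hθ hg 1
  have h2 := hf.wform_add_smul (α := α) hθ hg (-s⁻¹)
  have h3 := wform_self_nonneg hθ α (fun r φ => f r φ + -s⁻¹ * g r φ)
  rw [h2] at h3
  have h4 := mul_nonneg hs.le h3
  have e : s * (wform θ α f f + 2 * -s⁻¹ * wform θ α f g + (-s⁻¹) ^ 2 * wform θ α g g)
      = s * wform θ α f f - 2 * wform θ α f g + s⁻¹ * wform θ α g g := by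
    field_simp; ring
  simp only [one_mul] at h1
  linarith

theorem Nice.wform_add_le_two (hθ : 0 < θ) (hf : Nice f) (hg : Nice g) :
    wform θ α (fun r φ => f r φ + g r φ) (fun r φ => f r φ + g r φ)
      ≤ 2 * wform θ α f f + 2 * wform θ α g g := by
  have := hf.wform_add_le (α := α) hθ hg one_pos
  norm_num at this
  exact this

theorem wform_const_mul_self (θ α c : ℝ) (f : ℝ → ℝ → ℝ) :
    wform θ α (fun r φ => c * f r φ) (fun r φ => c * f r φ) = c ^ 2 * wform θ α f f := by
  rw [wform, wform, ← intWedge_const_mul]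
  congr 1; ext r φ; ring

theorem NiceField.vform_eq (hθ : 0 < θ) (hX : NiceField X) (hY : NiceField Y) :
    vform θ α X Y = wform θ α X.rad Y.rad + wform θ α X.ang Y.ang := by
  rw [vform, wform, wform, ← intWedge_add hθ (hX.rad.wedgeIntegrable_wform hY.rad θ α)
    (hX.ang.wedgeIntegrable_wform hY.ang θ α)]
  congr 1; ext r φ; simp only [PolarField.dot]; ring

theorem vform_self_nonneg (hθ : 0 < θ) (α : ℝ) (X : PolarField) : 0 ≤ vform θ α X X :=
  intWedge_nonneg hθ fun _ hr _ _ => mul_nonneg (Real.rpow_nonneg hr.le _)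
    (add_nonneg (mul_self_nonneg _) (mul_self_nonneg _))

theorem NiceField.vform_sq_le (hθ : 0 < θ) (hX : NiceField X) (hY : NiceField Y) :
    vform θ α X Y ^ 2 ≤ vform θ α X X * vform θ α Y Y := by
  rw [hX.vform_eq hθ hY, hX.vform_eq hθ hX, hY.vform_eq hθ hY]
  refine sq_le_mul_of_quadratic_nonneg fun s => ?_
  have h1 := hX.rad.wform_add_smul (α := α) hθ hY.rad s
  have h2 := hX.ang.wform_add_smul (α := α) hθ hY.ang s
  have h3 := wform_self_nonneg hθ α (fun r φ => X.rad r φ + s * Y.rad r φ)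
  have h4 := wform_self_nonneg hθ α (fun r φ => X.ang r φ + s * Y.ang r φ)
  linarith

theorem NiceField.wform_rad_le (hθ : 0 < θ) (hX : NiceField X) :
    wform θ α X.rad X.rad ≤ vform θ α X X := by
  rw [hX.vform_eq hθ hX]; linarith [wform_self_nonneg hθ α X.ang]

theorem NiceField.wform_ang_le (hθ : 0 < θ) (hX : NiceField X) :
    wform θ α X.ang X.ang ≤ vform θ α X X := by
  rw [hX.vform_eq hθ hX]; linarith [wform_self_nonneg hθ α X.rad]

/-- Inequalities between integrals over arcs carry over to weighted norms. -/
theorem Nice.wform_le_of_arc (hθ : 0 < θ) (hf : Nice f) (hg : Nice g) {c : ℝ}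
    (h : ∀ r, 0 < r → c * ∫ φ in (0 : ℝ)..θ, f r φ ^ 2 ≤ ∫ φ in (0 : ℝ)..θ, g r φ ^ 2) :
    c * wform θ α f f ≤ wform θ α g g := by
  have i1 := hf.wedgeIntegrable_wform hf θ α
  have i2 := hg.wedgeIntegrable_wform hg θ α
  rw [wform, wform, intWedge_eq_integral hθ i1, intWedge_eq_integral hθ i2, wedgeMeasure,
    integral_prod_symm _ i1, integral_prod_symm _ i2, ← MeasureTheory.integral_const_mul]
  refine setIntegral_mono_on (i1.integral_prod_right.const_mul c) i2.integral_prod_right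
    measurableSet_Ioi fun r hr => ?_
  have hr' : (0 : ℝ) < r := hr
  simp only [← intervalIntegral.integral_of_le hθ.le]
  have e : ∀ q : ℝ → ℝ → ℝ, ∫ φ in (0 : ℝ)..θ, r ^ (-2 * α - 2) * (q r φ * q r φ) * r
      = (r ^ (-2 * α - 2) * r) * ∫ φ in (0 : ℝ)..θ, q r φ ^ 2 := by
    intro q
    rw [← intervalIntegral.integral_const_mul]
    congr 1; ext φ; ring
  rw [e, e, mul_left_comm]
  have := h r hr'
  have h0 : 0 ≤ r ^ (-2 * α - 2) * r := by positivity
  gcongr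

end Forms

/-! ### Poincaré's inequality -/

section Poincare

variable {θ α ε : ℝ} {u : PolarField}

/-- The flux r ∫ u_r dφ through the arc of radius r does not depend on r, since u is solenoidal and
tangential on the rays. It is zero at r = 0. -/
theorem IsTestField.integral_rad_eq_zero (hu : IsTestField θ u) (hθ : 0 < θ) {r : ℝ} (hr : 0 < r) :
    ∫ φ in (0 : ℝ)..θ, u.rad r φ = 0 := by
  have hn := hu.niceField
  obtain ⟨a, b, ha, -, hs⟩ := (hn.rad.rdr.add hn.rad).supp
  have hd : ∀ s, HasDerivAt (fun s => ∫ φ in (0 : ℝ)..θ, s * u.rad s φ)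
      (∫ φ in (0 : ℝ)..θ, (rdr u.rad s φ + u.rad s φ)) s := fun s =>
    hasDerivAt_intervalIntegral_param (𝕜 := ℝ) (G := fun s φ => s * u.rad s φ)
      (G' := fun s φ => rdr u.rad s φ + u.rad s φ) 0 θ
      (continuous_fst.mul hn.rad.continuous) (hn.rad.rdr.add hn.rad).continuous (fun s φ =>
        ((hasDerivAt_id s).mul (hn.rad.hasDerivAt_dr s φ)).congr_deriv (by
          simp only [id_eq, one_mul, rdr]; ring)) s
  have hz : ∀ s, ∫ φ in (0 : ℝ)..θ, (rdr u.rad s φ + u.rad s φ) = 0 := by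
    intro s
    rcases lt_or_ge 0 s with h | h
    · have h1 : ∫ φ in (0 : ℝ)..θ, dphi u.ang s φ = 0 := by
        rw [intervalIntegral.integral_eq_sub_of_hasDerivAt
          (fun φ _ => hn.ang.hasDerivAt_dphi s φ), (hu.tangential s h).1, (hu.tangential s h).2,
          sub_zero]
        exact (hn.ang.dphi.continuous.comp (f := fun φ : ℝ => (s, φ))
          (by fun_prop)).intervalIntegrable _ _
      rw [intervalIntegral.integral_congr (g := fun φ => -(rdr u.rad s φ + u.rad s φ)) fun φ hφ => by
        rw [uIcc_of_le hθ.le] at hφ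
        exact hu.dphi_ang hθ h φ hφ, intervalIntegral.integral_neg] at h1
      linarith
    · rw [intervalIntegral.integral_congr (g := fun _ => 0) fun φ _ =>
        hs s φ fun hh => absurd hh.1 (not_le.2 (h.trans_lt ha))]
      simp
  have hconst := is_const_of_deriv_eq_zero (fun s => (hd s).differentiableAt)
    (fun s => (hd s).deriv.trans (hz s)) r 0
  simp only [zero_mul, intervalIntegral.integral_zero, intervalIntegral.integral_const_mul] at hconst
  exact (mul_eq_zero.1 hconst).resolve_left hr.ne'

theorem NiceField.partialPhi (hu : NiceField u) : NiceField u.partialPhi :=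
  ⟨hu.rad.dphi.sub hu.ang, hu.ang.dphi.add hu.rad⟩

/-- Poincaré's inequality for solenoidal tangential fields. -/
theorem IsTestField.poincare (hu : IsTestField θ u) (hθ : 0 < θ) (hε : 0 < ε)
    (hθε : θ ≤ (1 - ε) * π) (α : ℝ) :
    vform θ α u u ≤ 2 / ε ^ 2 * θ ^ 2 * vform θ α u.partialPhi u.partialPhi := by
  have hn := hu.niceField
  have hp := hn.partialPhi
  set k := π / θ with hk
  have hk0 : 0 < k := by positivity
  -- The opening angle enters here: θ ≤ (1-ε)π gives (1-ε)k ≥ 1.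
  have hk1 : ε * k ≤ k - 1 := by
    have : 1 ≤ (1 - ε) * k := by
      rw [hk, ← mul_div_assoc, le_div_iff₀ hθ, one_mul]; exact hθε
    linarith
  have hk2 : 0 < k - 1 := lt_of_lt_of_le (by positivity) hk1
  have w1 : k ^ 2 * wform θ α u.rad u.rad ≤ wform θ α (dphi u.rad) (dphi u.rad) :=
    hn.rad.wform_le_of_arc hθ hn.rad.dphi fun r hr =>
      wirtinger_mean_zero hθ (fun φ => hn.rad.hasDerivAt_dphi r φ)
        (hn.rad.dphi.continuous.comp (f := fun φ : ℝ => (r, φ)) (by fun_prop))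
        (hu.integral_rad_eq_zero hθ hr)
  have w2 : k ^ 2 * wform θ α u.ang u.ang ≤ wform θ α (dphi u.ang) (dphi u.ang) :=
    hn.ang.wform_le_of_arc hθ hn.ang.dphi fun r hr =>
      wirtinger_dirichlet hθ (fun φ => hn.ang.hasDerivAt_dphi r φ)
        (hn.ang.dphi.continuous.comp (f := fun φ : ℝ => (r, φ)) (by fun_prop))
        (hu.tangential r hr).1 (hu.tangential r hr).2
  have hs : 0 < (k - 1)⁻¹ := inv_pos.2 hk2
  -- With ∂_φ u_r = (∂_φ u)_r + u_φ and parameter (k-1)⁻¹, the term in u_φ gets coefficient k.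
  -- Against k² from Wirtinger this leaves k(k-1) > 0.
  have t1 := (hn.rad.dphi.sub hn.ang).wform_add_le (α := α) hθ hn.ang hs
  have t2 := (hn.ang.dphi.add hn.rad).wform_add_le (α := α) hθ (hn.rad.const_mul (-1)) hs
  rw [wform_const_mul_self] at t2
  simp only [sub_add_cancel, neg_one_mul, add_neg_cancel_right, inv_inv] at t1 t2
  rw [hp.vform_eq hθ hp, hn.vform_eq hθ hn]
  simp only [PolarField.partialPhi]
  set x := wform θ α u.rad u.rad
  set y := wform θ α u.ang u.ang
  set p := wform θ α (fun r φ => dphi u.rad r φ - u.ang r φ) fun r φ => dphi u.rad r φ - u.ang r φ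
  set q := wform θ α (fun r φ => dphi u.ang r φ + u.rad r φ) fun r φ => dphi u.ang r φ + u.rad r φ
  have hp0 : 0 ≤ p := wform_self_nonneg hθ _ _
  have hq0 : 0 ≤ q := wform_self_nonneg hθ _ _
  have aux : ∀ x y p d : ℝ, y ≤ x → k ^ 2 * x ≤ d → d ≤ (1 + (k - 1)⁻¹) * p + (1 + (k - 1)) * y →
      (k - 1) ^ 2 * x ≤ p := by
    intro x y p d hyx h1 h2
    have e : 1 + (k - 1)⁻¹ = k * (k - 1)⁻¹ := by field_simp; ring
    have h3 : k * (k - 1) * x ≤ k * (k - 1)⁻¹ * p := by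
      rw [← e]; nlinarith
    have h4 := mul_le_mul_of_nonneg_left h3 (mul_pos (inv_pos.2 hk0) hk2).le
    calc (k - 1) ^ 2 * x = k⁻¹ * (k - 1) * (k * (k - 1) * x) := by field_simp
      _ ≤ k⁻¹ * (k - 1) * (k * (k - 1)⁻¹ * p) := h4
      _ = p := by field_simp
  -- The larger of the two components absorbs the smaller one in its own inequality; this costs the
  -- factor 2.
  have main : (k - 1) ^ 2 * (x + y) ≤ 2 * (p + q) := by
    rcases le_total y x with h | h
    · have := aux x y p _ h w1 t1
      nlinarith [sq_nonneg (k - 1)]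
    · have := aux y x q _ h w2 (by linarith)
      nlinarith [sq_nonneg (k - 1)]
  have hxy : 0 ≤ x + y := add_nonneg (wform_self_nonneg hθ _ _) (wform_self_nonneg hθ _ _)
  have h5 : (ε * k) ^ 2 * (x + y) ≤ 2 * (p + q) := by
    refine le_trans ?_ main
    gcongr
  have h6 : 1 ≤ k * θ := by
    rw [hk, div_mul_cancel₀ _ hθ.ne']; linarith [Real.pi_gt_three]
  have h7 : ε ^ 2 * (x + y) ≤ θ ^ 2 * (2 * (p + q)) := by
    calc ε ^ 2 * (x + y) = 1 ^ 2 * (ε ^ 2 * (x + y)) := by ring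
      _ ≤ (k * θ) ^ 2 * (ε ^ 2 * (x + y)) := by gcongr
      _ = θ ^ 2 * ((ε * k) ^ 2 * (x + y)) := by ring
      _ ≤ θ ^ 2 * (2 * (p + q)) := by gcongr
  calc x + y = (ε ^ 2 * (x + y)) / ε ^ 2 := by field_simp
    _ ≤ (θ ^ 2 * (2 * (p + q))) / ε ^ 2 := by gcongr
    _ = _ := by ring

end Poincare

end Wedge

end

noncomputable section

namespace Wedge

open PolarField

/-! ### The bilinear forms in terms of weighted scalar products -/

/-- The pairing of the commutator `[P, r^{-2α}] v` with the Laplacian of `u`. -/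
def powPair (α θ γ : ℝ) (v u : PolarField) : ℝ :=
  intWedge θ fun r φ => (potentialGrad θ γ (v.powMul (-2 * α))).dot u.laplace r φ

/-- The pairing of the gradient of the potential of `Δu` with `Δv`. -/
def lapPair (α θ γ : ℝ) (u v : PolarField) : ℝ :=
  intWedge θ fun r φ => r ^ (-2 * α + 2) * (potentialGrad θ γ u.laplace).dot v.laplace r φ

/-- The field `r² Δu`. -/
def lap (u : PolarField) : PolarField := ⟨lapRad u, lapAng u⟩

section

variable {θ α γ ε : ℝ} {u v : PolarField}

theorem NiceField.lap (hu : NiceField u) : NiceField (lap u) := ⟨hu.lapRad, hu.lapAng⟩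

theorem NiceField.eulerR_partialPhi (hu : NiceField u) :
    u.partialPhi.eulerR = u.eulerR.partialPhi := by
  ext r φ
  · simp only [PolarField.eulerR, PolarField.partialPhi]
    rw [hu.rad.dphi.rdr_sub hu.ang, hu.rad.dphi_rdr]
  · simp only [PolarField.eulerR, PolarField.partialPhi]
    rw [hu.ang.dphi.rdr_add hu.rad, hu.ang.dphi_rdr]

theorem NiceField.lap_eq (hu : NiceField u) (r φ : ℝ) :
    (Wedge.lap u).rad r φ = u.eulerR.eulerR.rad r φ + u.partialPhi.partialPhi.rad r φ ∧
      (Wedge.lap u).ang r φ = u.eulerR.eulerR.ang r φ + u.partialPhi.partialPhi.ang r φ := by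
  simp only [Wedge.lap, Wedge.lapRad, Wedge.lapAng, PolarField.eulerR, PolarField.partialPhi]
  rw [hu.rad.dphi.dphi_sub hu.ang, hu.ang.dphi.dphi_add hu.rad]
  constructor <;> ring

theorem seminormSq_one (θ α : ℝ) (u : PolarField) :
    seminormSq θ 1 α u = vform θ α u.partialPhi u.partialPhi + vform θ α u.eulerR u.eulerR := by
  have e : -2 * α - 2 * ((1 : ℕ) : ℝ) = -2 * α - 2 := by push_cast; ring
  rw [seminormSq, e, Finset.Nat.sum_antidiagonal_succ, Finset.Nat.antidiagonal_zero,
    Finset.sum_singleton]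
  rfl

/-- The shift to α - 1 compensates the higher order: every volume term of the norm carries the same
weight r^{-2α-2}. -/
theorem seminormSq_two (hu : NiceField u) (θ α : ℝ) :
    seminormSq θ 2 (α - 1) u = vform θ α u.partialPhi.partialPhi u.partialPhi.partialPhi
      + (vform θ α u.eulerR.partialPhi u.eulerR.partialPhi
        + vform θ α u.eulerR.eulerR u.eulerR.eulerR) := by
  have e : -2 * (α - 1) - 2 * ((2 : ℕ) : ℝ) = -2 * α - 2 := by push_cast; ring
  rw [seminormSq, e, Finset.Nat.sum_antidiagonal_succ, Finset.Nat.sum_antidiagonal_succ,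
    Finset.Nat.antidiagonal_zero, Finset.sum_singleton, ← hu.eulerR_partialPhi]
  rfl

theorem rayNormSq_eq (θ α : ℝ) (f : ℝ → ℝ → ℝ) : rayNormSq θ α f = rform θ α f f := by
  simp only [rayNormSq, rform, sq_abs]
  simp only [sq]

theorem rpow_mul_inv_sq {r : ℝ} (hr : 0 < r) (α : ℝ) :
    r ^ (-2 * α) * (r⁻¹ * r⁻¹) = r ^ (-2 * α - 2) := by
  rw [Real.rpow_sub hr, div_eq_mul_inv, Real.rpow_two, sq, mul_inv]

theorem NiceField.intWedge_gradDot (hθ : 0 < θ) (hu : NiceField u) (hv : NiceField v) (α : ℝ) :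
    intWedge θ (fun r φ => r ^ (-2 * α) * v.gradDot u r φ)
      = vform θ α v.eulerR u.eulerR + vform θ α v.partialPhi u.partialPhi := by
  have h1 := (hv.eulerR.rad.wedgeIntegrable_wform hu.eulerR.rad θ α).add
    (hv.eulerR.ang.wedgeIntegrable_wform hu.eulerR.ang θ α)
  have h2 := (hv.partialPhi.rad.wedgeIntegrable_wform hu.partialPhi.rad θ α).add
    (hv.partialPhi.ang.wedgeIntegrable_wform hu.partialPhi.ang θ α)
  simp only [← mul_add] at h1 h2
  rw [vform, vform, ← intWedge_add (f := fun r φ => r ^ (-2 * α - 2) * v.eulerR.dot u.eulerR r φ)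
    (g := fun r φ => r ^ (-2 * α - 2) * v.partialPhi.dot u.partialPhi r φ) hθ h1 h2]
  refine intWedge_congr hθ fun r hr φ _ => ?_
  rw [← rpow_mul_inv_sq hr]
  simp only [gradDot, PolarField.dot, PolarField.eulerR, PolarField.partialPhi]
  ring

theorem intWedge_dot_partialR (hθ : 0 < θ) (α : ℝ) (v u : PolarField) :
    intWedge θ (fun r φ => r ^ (-2 * α - 1) * v.dot u.partialR r φ) = vform θ α v u.eulerR := by
  refine intWedge_congr hθ fun r hr φ _ => ?_
  have : r ^ (-2 * α - 1) = r ^ (-2 * α - 2) * r := by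
    rw [← Real.rpow_add_one hr.ne']; ring_nf
  simp only [PolarField.dot, PolarField.eulerR, PolarField.partialR, rdr, this]
  ring

theorem B1_eq (hθ : 0 < θ) (hu : IsTestField θ u) (hv : IsTestField θ v) (hγ : |γ + 1| < π / θ)
    (hα : |-α + 1| < π / θ) (hα0 : -α + 1 ≠ 0) :
    B1 α θ γ u v = rform θ α v.rad u.rad + vform θ α v.eulerR u.eulerR
      + vform θ α v.partialPhi u.partialPhi - 2 * α * vform θ α v u.eulerR
      + powPair α θ γ v u := by
  rw [powPair, ← commPow_pairing hθ hu hv hγ hα hα0, B1,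
    hu.niceField.intWedge_gradDot hθ hv.niceField, intWedge_dot_partialR hθ]
  simp only [rform, mul_assoc]
  ring

/-- The radial part of -2α ∫ r^{-2α} ∇(r∂_r v):∇u cancels against the term with (r∂_r)²v · ∂_r u, so
only the angular scalar product keeps a factor α. -/
theorem B2_eq (hθ : 0 < θ) (hu : IsTestField θ u) (hv : IsTestField θ v) (hγ : |γ + 1| < π / θ)
    (hα : |-α + 1| < π / θ) (hα0 : -α + 1 ≠ 0) :
    B2 α θ γ u v = rform θ α (rdr v.rad) (rdr u.rad)
      + (1 - 2 * α) * rform θ α (rdr v.rad) u.rad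
      + vform θ α v.eulerR.eulerR u.eulerR.eulerR
      + vform θ α v.eulerR.partialPhi u.eulerR.partialPhi
      - 2 * α * vform θ α v.eulerR.partialPhi u.partialPhi
      - powPair α θ γ v.eulerR.eulerR u := by
  have hnu := hu.niceField
  have hnv := hv.niceField
  rw [powPair, ← commPow_pairing hθ hu hv.eulerR.eulerR hγ hα hα0, B2,
    hnu.eulerR.intWedge_gradDot hθ hnv.eulerR, hnu.intWedge_gradDot hθ hnv.eulerR,
    intWedge_dot_partialR hθ, ← hnv.rad.rdr.rform_add_right hnu.rad.rdr hnu.rad]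
  have e : (-2 * α + 1) = 1 - 2 * α := by ring
  simp only [rform, mul_assoc, e]
  ring

theorem intWedge_laplace_dot (hθ : 0 < θ) (u v : PolarField) (α : ℝ) :
    intWedge θ (fun r φ => r ^ (-2 * α + 2) * u.laplace.dot v.laplace r φ)
      = vform θ α (Wedge.lap u) (Wedge.lap v) := by
  refine intWedge_congr hθ fun r hr φ _ => ?_
  have : r ^ (-2 * α + 2) = r ^ (-2 * α - 2) * (r ^ 2 * r ^ 2) := by
    rw [← Real.rpow_two, ← Real.rpow_add hr, ← Real.rpow_add hr]; ring_nf
  simp only [this, PolarField.dot, laplace, Wedge.lap, lapRad, lapAng]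
  field_simp

theorem B3_eq (hθ : 0 < θ) (hu : IsTestField θ u) :
    B3 α θ γ u v = vform θ α (lap u) (lap v) - lapPair α θ γ u v := by
  rw [B3, intWedge_laplace_dot hθ, lapPair, sub_eq_add_neg, ← neg_one_mul (intWedge θ _),
    ← intWedge_const_mul]
  congr 2
  ext r φ
  simp only [PolarField.dot, hu.commLaplace_rad hθ, hu.commLaplace_ang hθ]
  ring

/-! ### Bounds for the pairings -/

/-- No extra power of r occurs in the pairing (κ = 0), so the potential is taken on the line -α.
This gives the factor (|α|θ)², the source of all smallness in `powPair`. -/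
theorem powPair_sq_le (hθ : 0 < θ) (hu : NiceField u) (hv : IsTestField θ v)
    (hγ : |γ + 1| < π / θ) (hε : 0 < ε) (hε1 : ε ≤ 1) (hα : |1 - α| ≤ (1 - ε) * (π / θ))
    (hα0 : -α + 1 ≠ 0) (hα1 : α + 1 ≠ 0) :
    powPair α θ γ v u ^ 2
      ≤ 16 / ε ^ 2 * (|α| * θ) ^ 2 * wform θ α v.rad v.rad * vform θ α (lap u) (lap u) := by
  have hk : 0 < π / θ := by positivity
  have hlt : |-α + 1| < π / θ := by
    rw [neg_add_eq_sub]; refine hα.trans_lt ?_; nlinarith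
  have h1 := (hv.niceField.powMul (-2 * α)).pairing_sq_le (κ := 0) (α := α) hu.lap hθ hγ hlt hα0
    (add_zero _)
  have h2 := hv.lineSq_powMul_le hθ hε hε1 hα hlt hα0 hα1
  rw [← hu.lap.vform_eq hθ hu.lap] at h1
  have h0 := vform_self_nonneg hθ α (lap u)
  have e : powPair α θ γ v u = intWedge θ fun r φ => r ^ (0 : ℝ) *
      ((potentialGrad θ γ (v.powMul (-2 * α))).rad r φ * ((r ^ 2)⁻¹ * (lap u).rad r φ)
        + (potentialGrad θ γ (v.powMul (-2 * α))).ang r φ * ((r ^ 2)⁻¹ * (lap u).ang r φ)) := by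
    simp only [Real.rpow_zero, one_mul]
    rfl
  rw [e]
  refine h1.trans ((mul_le_mul_of_nonneg_right h2 h0).trans (le_of_eq ?_))
  rw [mul_pow |α|, sq_abs]
  ring

/-- The weight r^{-2α+2} requires the line α - 2, since (α-2) + (-2α+2) = -α. -/
theorem lapPair_sq_le (hθ : 0 < θ) (hu : IsTestField θ u) (hv : NiceField v)
    (hγ : |γ + 1| < π / θ) (hε : 0 < ε) (hε1 : ε ≤ 1) (hα : |1 - α| ≤ (1 - ε) * (π / θ))
    (hα0 : α - 2 + 1 ≠ 0) {η : ℝ} (hη : 0 < η) :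
    lapPair α θ γ u v ^ 2 ≤ (η * wform θ α (dphi (dphi u.rad)) (dphi (dphi u.rad))
        + 2 * (32 / ε ^ 2 + (32 / ε ^ 2) ^ 2 / η) *
          (2 * wform θ α (rdr (dphi u.rad)) (rdr (dphi u.rad))
            + (2 + (θ ^ 2)⁻¹) * wform θ α (dphi u.rad) (dphi u.rad)))
      * vform θ α (lap v) (lap v) := by
  have hk : 0 < π / θ := by positivity
  have hlt : |α - 2 + 1| < π / θ := by
    rw [show α - 2 + 1 = -(1 - α) by ring, abs_neg]; refine hα.trans_lt ?_; nlinarith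
  have h1 := hu.niceField.laplace.pairing_sq_le (κ := -2 * α + 2) (α := α) hv.lap hθ hγ hlt hα0
    (by ring)
  have h2 := hu.lineSq_laplace_le hθ hε hε1 hα hlt hα0 hη
  rw [← hv.lap.vform_eq hθ hv.lap] at h1
  exact h1.trans (mul_le_mul_of_nonneg_right h2 (vform_self_nonneg hθ α (lap v)))

/-! ### Components and vector derivatives -/

theorem NiceField.vform_lap_le (hθ : 0 < θ) (hu : NiceField u) (α : ℝ) :
    vform θ α (Wedge.lap u) (Wedge.lap u) ≤ 2 * vform θ α u.eulerR.eulerR u.eulerR.eulerR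
      + 2 * vform θ α u.partialPhi.partialPhi u.partialPhi.partialPhi := by
  have hE := hu.eulerR.eulerR
  have hP := hu.partialPhi.partialPhi
  rw [hu.lap.vform_eq hθ hu.lap, hE.vform_eq hθ hE, hP.vform_eq hθ hP]
  have h1 := hE.rad.wform_add_le_two (α := α) hθ hP.rad
  have h2 := hE.ang.wform_add_le_two (α := α) hθ hP.ang
  simp only [← (hu.lap_eq _ _).1] at h1
  simp only [← (hu.lap_eq _ _).2] at h2
  linarith

/-- From ∂_φ²u = r²Δu - (r∂_r)²u: the second angular derivative, absent from B₁ and B₂, is recovered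
from B₃. -/
theorem NiceField.vform_partialPhi_le (hθ : 0 < θ) (hu : NiceField u) (α : ℝ) :
    vform θ α u.partialPhi.partialPhi u.partialPhi.partialPhi
      ≤ 2 * vform θ α (Wedge.lap u) (Wedge.lap u)
        + 2 * vform θ α u.eulerR.eulerR u.eulerR.eulerR := by
  have hE := hu.eulerR.eulerR
  have hP := hu.partialPhi.partialPhi
  rw [hu.lap.vform_eq hθ hu.lap, hE.vform_eq hθ hE, hP.vform_eq hθ hP]
  have h1 := hu.lap.rad.wform_add_le_two (α := α) hθ (hE.rad.const_mul (-1))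
  have h2 := hu.lap.ang.wform_add_le_two (α := α) hθ (hE.ang.const_mul (-1))
  rw [wform_const_mul_self] at h1 h2
  simp only [(hu.lap_eq _ _).1, (hu.lap_eq _ _).2, neg_one_mul, add_neg_cancel_comm] at h1 h2
  have e1 : (Wedge.lap u).rad = fun r φ => u.eulerR.eulerR.rad r φ + u.partialPhi.partialPhi.rad r φ := by
    ext r φ; exact (hu.lap_eq r φ).1
  have e2 : (Wedge.lap u).ang = fun r φ => u.eulerR.eulerR.ang r φ + u.partialPhi.partialPhi.ang r φ := by
    ext r φ; exact (hu.lap_eq r φ).2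
  rw [e1] at h1 ⊢
  rw [e2] at h2 ⊢
  linarith

theorem NiceField.wform_dphi_rad_le (hθ : 0 < θ) (hu : NiceField u) (α : ℝ) :
    wform θ α (dphi u.rad) (dphi u.rad)
      ≤ 2 * vform θ α u.partialPhi u.partialPhi + 2 * vform θ α u u := by
  have hp := hu.partialPhi
  have h1 := hp.rad.wform_add_le_two (α := α) hθ hu.ang
  simp only [PolarField.partialPhi, sub_add_cancel] at h1
  have h2 := hp.wform_rad_le (α := α) hθ
  have h3 := hu.wform_ang_le (α := α) hθ
  simp only [PolarField.partialPhi] at h2 ⊢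
  linarith

theorem NiceField.wform_dphi_dphi_rad_le (hθ : 0 < θ) (hu : NiceField u) (α : ℝ) :
    wform θ α (dphi (dphi u.rad)) (dphi (dphi u.rad))
      ≤ 2 * vform θ α u.partialPhi.partialPhi u.partialPhi.partialPhi
        + 16 * vform θ α u.partialPhi u.partialPhi + 4 * vform θ α u u := by
  have hp := hu.partialPhi
  have hpp := hp.partialPhi
  have n1 := (hp.ang.const_mul 2).add (hu.rad.const_mul (-1))
  have h1 := hpp.rad.wform_add_le_two (α := α) hθ n1
  have h2 := (hp.ang.const_mul 2).wform_add_le_two (α := α) hθ (hu.rad.const_mul (-1))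
  rw [wform_const_mul_self, wform_const_mul_self] at h2
  have h3 := hpp.wform_rad_le (α := α) hθ
  have h4 := hp.wform_ang_le (α := α) hθ
  have h5 := hu.wform_rad_le (α := α) hθ
  have e : (fun r φ => u.partialPhi.partialPhi.rad r φ
      + (2 * u.partialPhi.ang r φ + -1 * u.rad r φ)) = dphi (dphi u.rad) := by
    ext r φ
    simp only [PolarField.partialPhi]
    rw [hu.rad.dphi.dphi_sub hu.ang]
    ring
  rw [e] at h1
  linarith

theorem NiceField.wform_rdr_dphi_rad_le (hθ : 0 < θ) (hu : NiceField u) (α : ℝ) :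
    wform θ α (rdr (dphi u.rad)) (rdr (dphi u.rad))
      ≤ 2 * vform θ α u.eulerR.partialPhi u.eulerR.partialPhi
        + 2 * vform θ α u.eulerR u.eulerR := by
  have he := hu.eulerR
  have hp := he.partialPhi
  have h1 := hp.rad.wform_add_le_two (α := α) hθ he.ang
  have h2 := hp.wform_rad_le (α := α) hθ
  have h3 := he.wform_ang_le (α := α) hθ
  simp only [PolarField.partialPhi, sub_add_cancel] at h1 h2 ⊢
  simp only [PolarField.eulerR, hu.rad.dphi_rdr] at h1 h2 h3 ⊢
  linarith

end

end Wedge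

end

noncomputable section

namespace Wedge

open PolarField

/-! ### Coercivity and boundedness -/

theorem normX_sq {θ : ℝ} (hθ : 0 < θ) {u : PolarField} (hu : NiceField u) (α : ℝ) :
    normX α θ u ^ 2 = rform θ α u.rad u.rad + |α| * θ ^ 3 * rform θ α (rdr u.rad) (rdr u.rad)
      + (vform θ α u.partialPhi u.partialPhi + vform θ α u.eulerR u.eulerR)
      + |α| * θ ^ 3 * (vform θ α u.partialPhi.partialPhi u.partialPhi.partialPhi
        + (vform θ α u.eulerR.partialPhi u.eulerR.partialPhi
          + vform θ α u.eulerR.eulerR u.eulerR.eulerR)) := by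
  have h1 := rform_self_nonneg θ α u.rad
  have h2 := rform_self_nonneg θ α (rdr u.rad)
  have h3 := vform_self_nonneg hθ α u.partialPhi
  have h4 := vform_self_nonneg hθ α u.eulerR
  have h5 := vform_self_nonneg hθ α u.partialPhi.partialPhi
  have h6 := vform_self_nonneg hθ α u.eulerR.partialPhi
  have h7 := vform_self_nonneg hθ α u.eulerR.eulerR
  rw [normX, rayNormSq_eq, rayNormSq_eq, seminormSq_one, seminormSq_two hu, Real.sq_sqrt (by positivity)]

/-- The constant in the bound for the potential of the Laplacian. -/
def lapConst (ε : ℝ) : ℝ :=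
  20 + 50 * (2 / ε) ^ 2
    + 2 * (32 / ε ^ 2 + (32 / ε ^ 2) ^ 2 / (1 / 8)) * (82 + 420 * (2 / ε) ^ 2)

theorem twenty_le_lapConst (ε : ℝ) : 20 ≤ lapConst ε := by
  have : 0 ≤ 50 * (2 / ε) ^ 2
    + 2 * (32 / ε ^ 2 + (32 / ε ^ 2) ^ 2 / (1 / 8)) * (82 + 420 * (2 / ε) ^ 2) := by positivity
  rw [lapConst]; linarith

section

variable {θ α γ ε : ℝ} {u v : PolarField}

theorem one_le_ten_mul (hθ : 0 < θ) (hθπ : θ ≤ π) : 1 ≤ 10 * (θ ^ 2)⁻¹ := by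
  have : θ ^ 2 ≤ 10 := by nlinarith [Real.pi_lt_d2]
  rw [← div_eq_mul_inv, le_div_iff₀ (by positivity)]; linarith

theorem IsTestField.poincare_sq (hu : IsTestField θ u) (hθ : 0 < θ) (hε : 0 < ε)
    (hθε : θ ≤ (1 - ε) * π) (α : ℝ) :
    vform θ α u u ≤ (2 / ε) ^ 2 * θ ^ 2 * vform θ α u.partialPhi u.partialPhi := by
  have h0 := vform_self_nonneg hθ α u.partialPhi
  refine (hu.poincare hθ hε hθε α).trans ?_
  have : 2 / ε ^ 2 ≤ (2 / ε) ^ 2 := by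
    rw [div_pow]; gcongr; norm_num
  gcongr

/-- η = 1/8 is chosen because ∂_φ²u_r costs twice ‖∂_φ²u‖², leaving 1/4. The undifferentiated terms
go into ∂_φ u by Poincaré, and bounded factors into 10θ⁻² since θ² ≤ 10. -/
theorem lapPair_sq_le' (hθ : 0 < θ) (hu : IsTestField θ u) (hv : NiceField v)
    (hγ : |γ + 1| < π / θ) (hε : 0 < ε) (hε1 : ε ≤ 1) (hθε : θ ≤ (1 - ε) * π)
    (hα : |1 - α| ≤ (1 - ε) * (π / θ)) (hα0 : α - 2 + 1 ≠ 0) :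
    lapPair α θ γ u v ^ 2 ≤ (vform θ α u.partialPhi.partialPhi u.partialPhi.partialPhi / 4
      + lapConst ε * (vform θ α u.eulerR.partialPhi u.eulerR.partialPhi
        + (θ ^ 2)⁻¹ * (vform θ α u.partialPhi u.partialPhi + vform θ α u.eulerR u.eulerR)))
      * vform θ α (lap v) (lap v) := by
  have hn := hu.niceField
  refine (lapPair_sq_le hθ hu hv hγ hε hε1 hα hα0 (η := 1 / 8) (by norm_num)).trans
    (mul_le_mul_of_nonneg_right ?_ (vform_self_nonneg hθ α _))
  have hx := hu.poincare_sq hθ hε hθε α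
  have h1 := hn.wform_dphi_rad_le hθ α
  have h2 := hn.wform_dphi_dphi_rad_le hθ α
  have h3 := hn.wform_rdr_dphi_rad_le hθ α
  have hd := vform_self_nonneg hθ α u.partialPhi
  have he := vform_self_nonneg hθ α u.eulerR
  have hM := vform_self_nonneg hθ α u.eulerR.partialPhi
  have hθπ : θ ≤ π := hθε.trans (by nlinarith [Real.pi_pos])
  have hw := one_le_ten_mul hθ hθπ
  have hθ2 : θ ^ 2 ≤ 10 := by nlinarith [Real.pi_lt_d2]
  rw [lapConst]
  set K := 2 * (32 / ε ^ 2 + (32 / ε ^ 2) ^ 2 / (1 / 8)) with hK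
  have hK0 : 0 ≤ K := by positivity
  set P := (2 / ε) ^ 2
  have hP0 : 0 ≤ P := by positivity
  set w := (θ ^ 2)⁻¹
  have hw0 : 0 ≤ w := by positivity
  set x := vform θ α u u
  set d := vform θ α u.partialPhi u.partialPhi
  set e := vform θ α u.eulerR u.eulerR
  set M := vform θ α u.eulerR.partialPhi u.eulerR.partialPhi
  set F := vform θ α u.partialPhi.partialPhi u.partialPhi.partialPhi
  have hx' : x ≤ 10 * P * d := by
    refine hx.trans ?_
    calc P * θ ^ 2 * d ≤ P * 10 * d := by gcongr
      _ = _ := by ring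
  have hwd : d ≤ 10 * (w * d) := by nlinarith
  have hwe : e ≤ 10 * (w * e) := by nlinarith
  have s1 : wform θ α (dphi (dphi u.rad)) (dphi (dphi u.rad)) / 8 ≤ F / 4 + (2 + 5 * P) * d := by
    linarith
  have s2 : (2 + 5 * P) * d ≤ (20 + 50 * P) * (w * d) := by nlinarith
  have s3 : 2 * wform θ α (rdr (dphi u.rad)) (rdr (dphi u.rad)) ≤ 4 * M + 40 * (w * e) := by
    linarith
  have s4 : (2 + w) * wform θ α (dphi u.rad) (dphi u.rad) ≤ (42 + 420 * P) * (w * d) := by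
    have r1 : wform θ α (dphi u.rad) (dphi u.rad) ≤ (2 + 20 * P) * d := by linarith
    have r2 : 0 ≤ (2 + 20 * P) * d := by positivity
    calc (2 + w) * wform θ α (dphi u.rad) (dphi u.rad) ≤ (2 + w) * ((2 + 20 * P) * d) := by gcongr
      _ ≤ (21 * w) * ((2 + 20 * P) * d) := by gcongr; linarith
      _ = _ := by ring
  have hwd0 : 0 ≤ w * d := by positivity
  have hwe0 : 0 ≤ w * e := by positivity
  have s5 : 2 * wform θ α (rdr (dphi u.rad)) (rdr (dphi u.rad))
      + (2 + w) * wform θ α (dphi u.rad) (dphi u.rad)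
      ≤ (82 + 420 * P) * (M + w * (d + e)) := by
    have : 0 ≤ P * M := by positivity
    have : 0 ≤ P * (w * e) := by positivity
    nlinarith
  have s6 : (20 + 50 * P) * (w * d) ≤ (20 + 50 * P) * (M + w * (d + e)) := by
    gcongr
    linarith
  have s7 := mul_le_mul_of_nonneg_left s5 hK0
  linarith

theorem powPair_sq_le' (hθ : 0 < θ) (hu : NiceField u) (hv : IsTestField θ v)
    (hγ : |γ + 1| < π / θ) (hε : 0 < ε) (hε1 : ε ≤ 1) (hα : |1 - α| ≤ (1 - ε) * (π / θ))
    (hα0 : -α + 1 ≠ 0) (hα1 : α + 1 ≠ 0) :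
    powPair α θ γ v u ^ 2 ≤ 4 * (2 / ε) ^ 2 * (|α| * θ) ^ 2 * vform θ α v v *
      (2 * vform θ α u.eulerR.eulerR u.eulerR.eulerR
        + 2 * vform θ α u.partialPhi.partialPhi u.partialPhi.partialPhi) := by
  have h1 := hv.niceField.wform_rad_le (α := α) hθ
  have h2 := hu.vform_lap_le hθ α
  have h3 := vform_self_nonneg hθ α (lap u)
  have h4 := vform_self_nonneg hθ α v
  refine (powPair_sq_le hθ hu hv hγ hε hε1 hα hα0 hα1).trans ?_
  have e : 16 / ε ^ 2 = 4 * (2 / ε) ^ 2 := by rw [div_pow]; ring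
  rw [e]
  gcongr

end

/-! ### Absorbing the error terms: real inequalities -/

theorem abs_le_of_sq_le_mul {T k A B : ℝ} (hk : 0 ≤ k) (hA : 0 ≤ A) (hB : 0 ≤ B)
    (h : T ^ 2 ≤ (2 * k) ^ 2 * (A * B)) : |T| ≤ k * (A + B) := by
  refine abs_le_of_sq_le_sq (h.trans ?_) (by positivity)
  nlinarith [mul_nonneg (sq_nonneg k) (sq_nonneg (A - B))]

/-- All uses of the smallness of τ = |α|θ are consequences of one bound, with p = 2/ε. -/
theorem smallness_aux {τ p s : ℝ} (hp : 2 ≤ p) (hs : 0 < s) (hs1 : s ≤ 1 / 1280) (hτ0 : 0 ≤ τ)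
    (hτ : τ ≤ s ^ 2 / (2 * p ^ 4)) :
    2 * p ^ 4 * τ ≤ s ^ 2 ∧ 32 * τ ≤ s ^ 2 ∧ 3 * p * τ ≤ s ∧ τ ≤ 1 / 1280 := by
  have hp4 : 16 ≤ p ^ 4 := by
    calc (16 : ℝ) = 2 ^ 4 := by norm_num
      _ ≤ p ^ 4 := by gcongr
  have hτp : 2 * p ^ 4 * τ ≤ s ^ 2 := by
    rw [le_div_iff₀ (by positivity)] at hτ; linarith
  have hs2 : s ^ 2 ≤ s * (1 / 1280) := by rw [sq]; gcongr
  have hτ32 : 32 * τ ≤ s ^ 2 := by linarith [mul_le_mul_of_nonneg_right hp4 hτ0]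
  have h1 : (2 : ℝ) ^ 3 ≤ p ^ 3 := by gcongr
  have h2 : 2 ^ 3 * (p * τ) ≤ p ^ 3 * (p * τ) := by gcongr
  have h3 : p ^ 3 * (p * τ) = p ^ 4 * τ := by ring
  exact ⟨hτp, hτ32, by linarith, by linarith⟩

/-- d, e, E, M, F stand for the squared norms of ∂_φu, r∂_r u, (r∂_r)²u, r∂_r∂_φu, ∂_φ²u, and l for
that of r²Δu. Half of l absorbs J, the rest yields F/4 - E/2. As 64s is the inverse of the constant
in J, the error costs only half of μM, and μθ⁻² = τ makes the part in d + e small. -/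
theorem coercivity_laplace_aux {τ μ θ s d e E M F l J : ℝ} (hθ : 0 < θ) (hs : 0 < s) (hμ : 0 ≤ μ)
    (hμτ : μ = τ * θ ^ 2) (hd : 0 ≤ d) (he : 0 ≤ e) (hM : 0 ≤ M) (hF : 0 ≤ F)
    (hl : 0 ≤ l) (hFl : F ≤ 2 * l + 2 * E)
    (hJ : J ^ 2 ≤ (F / 4 + 1 / (64 * s) * (M + (θ ^ 2)⁻¹ * (d + e))) * l) :
    8 * s * (μ * F) - 32 * s * (μ * E) - 1 / 2 * (μ * M) - 1 / 2 * (τ * (d + e))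
      ≤ 64 * s * (μ * (l - J)) := by
  have hμQ : 64 * s * (μ * (F / 4 + 1 / (64 * s) * (M + (θ ^ 2)⁻¹ * (d + e))))
      = 16 * s * (μ * F) + μ * M + τ * (d + e) := by
    rw [hμτ]; field_simp; ring
  have hQ0 : 0 ≤ F / 4 + 1 / (64 * s) * (M + (θ ^ 2)⁻¹ * (d + e)) := by positivity
  generalize F / 4 + 1 / (64 * s) * (M + (θ ^ 2)⁻¹ * (d + e)) = Q at *
  have hJ' : |J| ≤ 1 / 2 * (Q + l) :=
    abs_le_of_sq_le_mul (by norm_num) hQ0 hl (by linarith)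
  have h1 : (F / 4 - E / 2) - Q / 2 ≤ l - J := by linarith [le_abs_self J]
  have h2 : 64 * s * (μ * ((F / 4 - E / 2) - Q / 2)) ≤ 64 * s * (μ * (l - J)) := by gcongr
  have h3 : 64 * s * (μ * ((F / 4 - E / 2) - Q / 2))
      = 16 * s * (μ * F) - 32 * s * (μ * E) - 1 / 2 * (64 * s * (μ * Q)) := by ring
  rw [h3, hμQ] at h2
  linarith

/-- The errors of B₁. Poincaré contributes θ² to J², and τ²θ² = τμ: one factor τ remains for
smallness, while μ is the weight carried by the second derivatives. -/
theorem coercivity_lower_aux {α τ μ θ p s d e E F x T J : ℝ} (hs : 0 < s) (hp : 0 ≤ p)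
    (hτ0 : 0 ≤ τ) (hμ : 0 ≤ μ) (hμτ : μ = τ * θ ^ 2) (hατ : α ^ 2 * θ ^ 2 = τ ^ 2)
    (hτp : 2 * p ^ 4 * τ ≤ s ^ 2) (hd : 0 ≤ d) (he : 0 ≤ e) (hE : 0 ≤ E) (hF : 0 ≤ F)
    (hx : x ≤ p ^ 2 * θ ^ 2 * d) (hT : T ^ 2 ≤ x * e)
    (hJ : J ^ 2 ≤ 4 * p ^ 2 * τ ^ 2 * x * (2 * E + 2 * F)) :
    |2 * α * T| ≤ (p * τ) * (d + e) ∧ |J| ≤ s * (d + μ * (E + F)) := by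
  have hb : 0 ≤ μ * (E + F) := by positivity
  constructor
  · refine abs_le_of_sq_le_mul (by positivity) hd he ?_
    calc (2 * α * T) ^ 2 = 4 * α ^ 2 * T ^ 2 := by ring
      _ ≤ 4 * α ^ 2 * (x * e) := by gcongr
      _ ≤ 4 * α ^ 2 * (p ^ 2 * θ ^ 2 * d * e) := by gcongr
      _ = 4 * p ^ 2 * (α ^ 2 * θ ^ 2) * (d * e) := by ring
      _ = _ := by rw [hατ]; ring
  · refine abs_le_of_sq_le_mul hs.le hd hb ?_
    calc J ^ 2 ≤ 4 * p ^ 2 * τ ^ 2 * x * (2 * E + 2 * F) := hJ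
      _ ≤ 4 * p ^ 2 * τ ^ 2 * (p ^ 2 * θ ^ 2 * d) * (2 * E + 2 * F) := by gcongr
      _ = 4 * (2 * p ^ 4 * τ) * (d * (μ * (E + F))) := by rw [hμτ]; ring
      _ ≤ 4 * s ^ 2 * (d * (μ * (E + F))) := by gcongr
      _ = _ := by ring

/-- The errors of B₂. In the first one α² is compensated by μα² = τ³; in the second both factors are
second derivatives already, so the factor τ of the pairing suffices without Poincaré. -/
theorem coercivity_upper_aux {α τ μ p s d E M F T J : ℝ} (hs : 0 < s) (hp : 0 ≤ p)
    (hτ0 : 0 ≤ τ) (hτ1 : τ ≤ 1) (hμ : 0 ≤ μ) (hμα : μ * α ^ 2 = τ ^ 3)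
    (hτ32 : 32 * τ ≤ s ^ 2) (hpτ : 3 * p * τ ≤ s) (hd : 0 ≤ d) (hE : 0 ≤ E) (hM : 0 ≤ M)
    (hF : 0 ≤ F) (hT : T ^ 2 ≤ M * d)
    (hJ : J ^ 2 ≤ 4 * p ^ 2 * τ ^ 2 * E * (2 * E + 2 * F)) :
    |2 * α * (μ * T)| ≤ s * (d + μ * M) ∧ μ * J ≤ s * (μ * (E + F)) := by
  constructor
  · refine abs_le_of_sq_le_mul hs.le hd (by positivity) ?_
    have h3 : τ ^ 3 ≤ s ^ 2 := by
      calc τ ^ 3 = τ * (τ * τ) := by ring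
        _ ≤ τ * (1 * 1) := by gcongr
        _ ≤ s ^ 2 := by linarith
    calc (2 * α * (μ * T)) ^ 2 = 4 * (μ * α ^ 2) * (μ * T ^ 2) := by ring
      _ ≤ 4 * (μ * α ^ 2) * (μ * (M * d)) := by gcongr
      _ = 4 * τ ^ 3 * (d * (μ * M)) := by rw [hμα]; ring
      _ ≤ 4 * s ^ 2 * (d * (μ * M)) := by gcongr
      _ = _ := by ring
  · have hJ' : |J| ≤ 3 * p * τ * (E + F) := by
      refine abs_le_of_sq_le_sq ?_ (by positivity)
      calc J ^ 2 ≤ 4 * p ^ 2 * τ ^ 2 * E * (2 * E + 2 * F) := hJ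
        _ ≤ 4 * p ^ 2 * τ ^ 2 * (E + F) * (2 * E + 2 * F) := by gcongr; linarith
        _ = 8 * (p * τ * (E + F)) ^ 2 := by ring
        _ ≤ 9 * (p * τ * (E + F)) ^ 2 := by gcongr; norm_num
        _ = _ := by ring
    calc μ * J ≤ μ * (3 * p * τ * (E + F)) := by gcongr; exact (le_abs_self _).trans hJ'
      _ ≤ μ * (s * (E + F)) := by gcongr
      _ = _ := by ring

/-- On the diagonal the mixed ray term of B₂ integrates to a negative multiple of the ray norm of
u_r. Although α is unbounded for small θ, μ ≤ 10τ and μα² = τ³ keep it below what B₁ provides. -/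
theorem boundary_weight_le {α τ μ θ : ℝ} (hθ2 : θ ^ 2 ≤ 10) (hτ0 : 0 ≤ τ) (hτ1 : τ ≤ 1)
    (hμ : 0 ≤ μ) (hμτ : μ = τ * θ ^ 2) (hμα : μ * α ^ 2 = τ ^ 3) :
    μ * ((1 - 2 * α) ^ 2 / 2) ≤ 14 * τ := by
  have h1 : (1 - 2 * α) ^ 2 / 2 ≤ 1 + 4 * α ^ 2 := by nlinarith [sq_nonneg (1 + 2 * α)]
  calc μ * ((1 - 2 * α) ^ 2 / 2) ≤ μ * (1 + 4 * α ^ 2) := by gcongr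
    _ = τ * θ ^ 2 + 4 * (τ * (τ * τ)) := by
      rw [mul_add, mul_one, mul_left_comm, hμα, hμτ]; ring
    _ ≤ τ * 10 + 4 * (τ * (1 * 1)) := by gcongr
    _ = 14 * τ := by ring

theorem weight_relations (α : ℝ) (θ : ℝ) :
    |α| * θ ^ 3 = (|α| * θ) * θ ^ 2 ∧ α ^ 2 * θ ^ 2 = (|α| * θ) ^ 2 ∧
      |α| * θ ^ 3 * α ^ 2 = (|α| * θ) ^ 3 := by
  refine ⟨by ring, by rw [mul_pow, sq_abs], ?_⟩
  rw [← sq_abs α]; ring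

/-- The balance, with n₀, n₁ the ray norms, T₁, T₂ the scalar products with factor α and J₁, J₂, J₃
the pairings. The tightest term is F: B₃ gives 8s, J₁ and J₂ take s each, and 6s ≥ 4s remains. In E
the loss 32s of B₃ is paid by μB₂, since 32/1280 is small. -/
theorem coercivity_aux {α θ p s n₀ n₁ x d e E M F l T₁ T₂ J₁ J₂ J₃ : ℝ} (hθ : 0 < θ)
    (hθ2 : θ ^ 2 ≤ 10) (hp : 2 ≤ p) (hs : 0 < s) (hs1 : s ≤ 1 / 1280)
    (hτ : |α| * θ ≤ s ^ 2 / (2 * p ^ 4))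
    (hn₀ : 0 ≤ n₀) (hn₁ : 0 ≤ n₁) (hd : 0 ≤ d) (he : 0 ≤ e) (hE : 0 ≤ E) (hM : 0 ≤ M) (hF : 0 ≤ F)
    (hl : 0 ≤ l) (hx : x ≤ p ^ 2 * θ ^ 2 * d) (hFl : F ≤ 2 * l + 2 * E)
    (hT₁ : T₁ ^ 2 ≤ x * e) (hT₂ : T₂ ^ 2 ≤ M * d)
    (hJ₁ : J₁ ^ 2 ≤ 4 * p ^ 2 * (|α| * θ) ^ 2 * x * (2 * E + 2 * F))
    (hJ₂ : J₂ ^ 2 ≤ 4 * p ^ 2 * (|α| * θ) ^ 2 * E * (2 * E + 2 * F))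
    (hJ₃ : J₃ ^ 2 ≤ (F / 4 + 1 / (64 * s) * (M + (θ ^ 2)⁻¹ * (d + e))) * l) :
    4 * s * (n₀ + |α| * θ ^ 3 * n₁ + (d + e) + |α| * θ ^ 3 * (F + (M + E)))
      ≤ (n₀ + e + d - 2 * α * T₁ + J₁)
        + |α| * θ ^ 3 * (n₁ + (1 - 2 * α) * (-((1 - 2 * α) / 2) * n₀) + E + M - 2 * α * T₂ - J₂)
        + 64 * s * |α| * θ ^ 3 * (l - J₃) := by
  have hτ0 : 0 ≤ |α| * θ := by positivity
  have hμ0 : 0 ≤ |α| * θ ^ 3 := by positivity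
  obtain ⟨hμτ, hατ, hμα⟩ := weight_relations α θ
  rw [mul_assoc (64 * s) |α|, mul_assoc (64 * s) (|α| * θ ^ 3)]
  generalize |α| * θ ^ 3 = μ at *
  generalize |α| * θ = τ at *
  obtain ⟨hτp, hτ32, hpτ, hτ1⟩ := smallness_aux hp hs hs1 hτ0 hτ
  have hp0 : 0 ≤ p := by linarith
  obtain ⟨a1, a2⟩ := coercivity_lower_aux hs hp0 hτ0 hμ0 hμτ hατ hτp hd he hE hF hx hT₁ hJ₁
  obtain ⟨a3, a4⟩ := coercivity_upper_aux hs hp0 hτ0 (by linarith) hμ0 hμα hτ32 hpτ hd hE hM hF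
    hT₂ hJ₂
  have a5 := coercivity_laplace_aux hθ hs hμ0 hμτ hd he hM hF hl hFl hJ₃
  have a6 := mul_le_mul_of_nonneg_right
    (boundary_weight_le hθ2 hτ0 (by linarith) hμ0 hμτ hμα) hn₀
  have b1 := (abs_le.1 a1).2
  have b2 := (abs_le.1 a2).1
  have b3 := (abs_le.1 a3).2
  clear a1 a2 a3 hT₁ hT₂ hJ₁ hJ₂ hJ₃ hx hFl hμτ hατ hμα hτ hτp hτ32
  have hde : 0 ≤ d + e := add_nonneg hd he
  have hμE : 0 ≤ μ * E := by positivity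
  have hμM : 0 ≤ μ * M := by positivity
  have hμF : 0 ≤ s * (μ * F) := by positivity
  have hμn : 0 ≤ μ * n₁ := by positivity
  have c1 : τ * n₀ ≤ 1 / 1280 * n₀ := by gcongr
  have c2 : p * τ * (d + e) ≤ 1 / 1280 * (d + e) := by
    have : p * τ ≤ 1 / 1280 := by linarith [mul_nonneg hp0 hτ0]
    gcongr
  have c3 : τ * (d + e) ≤ 1 / 1280 * (d + e) := by gcongr
  have c4 : ∀ y : ℝ, 0 ≤ y → s * y ≤ 1 / 1280 * y := fun y hy => by gcongr
  have q1 := c4 d hd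
  have q2 := c4 e he
  have q3 := c4 _ hμE
  have q4 := c4 _ hμM
  have q5 := c4 _ hμn
  have q6 := c4 _ hn₀
  have e1 : μ * (n₁ + (1 - 2 * α) * (-((1 - 2 * α) / 2) * n₀) + E + M - 2 * α * T₂ - J₂)
      = μ * n₁ - μ * ((1 - 2 * α) ^ 2 / 2) * n₀ + μ * E + μ * M - 2 * α * (μ * T₂) - μ * J₂ := by
    ring
  rw [e1]
  generalize μ * ((1 - 2 * α) ^ 2 / 2) * n₀ = y₁ at *
  generalize 2 * α * (μ * T₂) = y₂ at *
  generalize μ * J₂ = y₃ at *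
  generalize 2 * α * T₁ = y₄ at *
  generalize 64 * s * (μ * (l - J₃)) = y₅ at *
  linarith

theorem boundedness_aux {T k U V a b : ℝ} (hk : 0 ≤ k) (hU : 0 ≤ U) (hV : 0 ≤ V) (ha : a ≤ U ^ 2)
    (hb : b ≤ V ^ 2) (ha0 : 0 ≤ a) (h : T ^ 2 ≤ k ^ 2 * (b * a)) : |T| ≤ k * (U * V) := by
  refine abs_le_of_sq_le_sq (h.trans ?_) (by positivity)
  calc k ^ 2 * (b * a) ≤ k ^ 2 * (V ^ 2 * U ^ 2) := by gcongr
    _ = (k * (U * V)) ^ 2 := by ring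

end Wedge

end

/-! ### Boundedness and coercivity of the forms -/

noncomputable section

namespace Wedge

open PolarField

section

variable {θ α γ ε : ℝ} {u v : PolarField}

theorem parts_le_normX_sq (hθ : 0 < θ) (hu : NiceField u) (α : ℝ) :
    rform θ α u.rad u.rad ≤ normX α θ u ^ 2 ∧
    |α| * θ ^ 3 * rform θ α (rdr u.rad) (rdr u.rad) ≤ normX α θ u ^ 2 ∧
    vform θ α u.partialPhi u.partialPhi ≤ normX α θ u ^ 2 ∧
    vform θ α u.eulerR u.eulerR ≤ normX α θ u ^ 2 ∧
    |α| * θ ^ 3 * vform θ α u.eulerR.eulerR u.eulerR.eulerR ≤ normX α θ u ^ 2 ∧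
    |α| * θ ^ 3 * vform θ α u.eulerR.partialPhi u.eulerR.partialPhi ≤ normX α θ u ^ 2 ∧
    |α| * θ ^ 3 * (vform θ α u.eulerR.eulerR u.eulerR.eulerR
      + vform θ α u.partialPhi.partialPhi u.partialPhi.partialPhi) ≤ normX α θ u ^ 2 ∧
    (vform θ α u.partialPhi u.partialPhi + vform θ α u.eulerR u.eulerR)
      + |α| * θ ^ 3 * vform θ α u.eulerR.partialPhi u.eulerR.partialPhi
      + |α| * θ ^ 3 * vform θ α u.partialPhi.partialPhi u.partialPhi.partialPhi
        ≤ normX α θ u ^ 2 := by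
  rw [normX_sq hθ hu α]
  have hμ : 0 ≤ |α| * θ ^ 3 := by positivity
  have h1 := rform_self_nonneg θ α u.rad
  have h2 := mul_nonneg hμ (rform_self_nonneg θ α (rdr u.rad))
  have h3 := vform_self_nonneg hθ α u.partialPhi
  have h4 := vform_self_nonneg hθ α u.eulerR
  have h5 := mul_nonneg hμ (vform_self_nonneg hθ α u.partialPhi.partialPhi)
  have h6 := mul_nonneg hμ (vform_self_nonneg hθ α u.eulerR.partialPhi)
  have h7 := mul_nonneg hμ (vform_self_nonneg hθ α u.eulerR.eulerR)
  refine ⟨?_, ?_, ?_, ?_, ?_, ?_, ?_, ?_⟩ <;> linarith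

theorem normX_nonneg (α θ : ℝ) (u : PolarField) : 0 ≤ normX α θ u := Real.sqrt_nonneg _

theorem abs_B1_le (hθ : 0 < θ) (hu : IsTestField θ u) (hv : IsTestField θ v)
    (hγ : |γ + 1| < π / θ) (hε : 0 < ε) (hε1 : ε ≤ 1) (hθε : θ ≤ (1 - ε) * π)
    (hα : |1 - α| ≤ (1 - ε) * (π / θ)) (hα0 : -α + 1 ≠ 0) (hα1 : α + 1 ≠ 0)
    (hτ1 : |α| * θ ≤ 1) :
    |B1 α θ γ u v| ≤ (3 + 2 * (2 / ε) + 3 * (2 / ε) ^ 2) * (normX α θ u * normX α θ v) := by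
  have hk : 0 < π / θ := by positivity
  have hlt : |-α + 1| < π / θ := by
    rw [neg_add_eq_sub]; refine hα.trans_lt ?_; nlinarith
  have hnu := hu.niceField
  have hnv := hv.niceField
  have hU := normX_nonneg α θ u
  have hV := normX_nonneg α θ v
  obtain ⟨u1, -, u3, u4, -, -, u7, -⟩ := parts_le_normX_sq hθ hnu α
  obtain ⟨v1, -, v3, v4, -, -, -, -⟩ := parts_le_normX_sq hθ hnv α
  obtain ⟨hμτ, hατ, -⟩ := weight_relations α θ
  have hτ0 : 0 ≤ |α| * θ := by positivity
  have hμ0 : 0 ≤ |α| * θ ^ 3 := by positivity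
  have nE := vform_self_nonneg hθ α u.eulerR.eulerR
  have nF := vform_self_nonneg hθ α u.partialPhi.partialPhi
  have ne := vform_self_nonneg hθ α u.eulerR
  have nd := vform_self_nonneg hθ α v.partialPhi
  have hx := hv.poincare_sq hθ hε hθε α
  set p := 2 / ε with hp
  have hp0 : 0 ≤ p := by positivity
  have t1 : |rform θ α v.rad u.rad| ≤ 1 * (normX α θ u * normX α θ v) :=
    boundedness_aux zero_le_one hU hV u1 v1 (rform_self_nonneg θ α u.rad)
      (by simpa using hnv.rad.rform_sq_le hnu.rad)
  have t2 : |vform θ α v.eulerR u.eulerR| ≤ 1 * (normX α θ u * normX α θ v) :=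
    boundedness_aux zero_le_one hU hV u4 v4 ne
      (by simpa using hnv.eulerR.vform_sq_le hθ hnu.eulerR)
  have t3 : |vform θ α v.partialPhi u.partialPhi| ≤ 1 * (normX α θ u * normX α θ v) :=
    boundedness_aux zero_le_one hU hV u3 v3 (vform_self_nonneg hθ α _)
      (by simpa using hnv.partialPhi.vform_sq_le hθ hnu.partialPhi)
  have t4 : |2 * α * vform θ α v u.eulerR| ≤ (2 * p) * (normX α θ u * normX α θ v) := by
    refine boundedness_aux (by positivity) hU hV u4 v3 ne ?_
    calc (2 * α * vform θ α v u.eulerR) ^ 2 = 4 * α ^ 2 * vform θ α v u.eulerR ^ 2 := by ring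
      _ ≤ 4 * α ^ 2 * (vform θ α v v * vform θ α u.eulerR u.eulerR) := by
        gcongr; exact hnv.vform_sq_le hθ hnu.eulerR
      _ ≤ 4 * α ^ 2 * ((p ^ 2 * θ ^ 2 * vform θ α v.partialPhi v.partialPhi)
          * vform θ α u.eulerR u.eulerR) := by gcongr
      _ = (α ^ 2 * θ ^ 2) * ((2 * p) ^ 2 * (vform θ α v.partialPhi v.partialPhi
          * vform θ α u.eulerR u.eulerR)) := by ring
      _ ≤ 1 * ((2 * p) ^ 2 * (vform θ α v.partialPhi v.partialPhi
          * vform θ α u.eulerR u.eulerR)) := by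
        gcongr; rw [hατ]; exact pow_le_one₀ hτ0 hτ1
      _ = _ := one_mul _
  -- Poincaré on v provides θ², and τ²θ² = τμ supplies the weight that the second derivatives of u
  -- need; 9 = 3² replaces 8.
  have t5 : |powPair α θ γ v u| ≤ (3 * p ^ 2) * (normX α θ u * normX α θ v) := by
    refine boundedness_aux (by positivity) hU hV u7 v3 (by positivity) ?_
    refine (powPair_sq_le' hθ hnu hv hγ hε hε1 hα hα0 hα1).trans ?_
    calc 4 * p ^ 2 * (|α| * θ) ^ 2 * vform θ α v v * (2 * vform θ α u.eulerR.eulerR u.eulerR.eulerR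
        + 2 * vform θ α u.partialPhi.partialPhi u.partialPhi.partialPhi)
        ≤ 4 * p ^ 2 * (|α| * θ) ^ 2 * (p ^ 2 * θ ^ 2 * vform θ α v.partialPhi v.partialPhi)
          * (2 * vform θ α u.eulerR.eulerR u.eulerR.eulerR
        + 2 * vform θ α u.partialPhi.partialPhi u.partialPhi.partialPhi) := by gcongr
      _ = (|α| * θ) * (8 * p ^ 4) * (vform θ α v.partialPhi v.partialPhi
          * (|α| * θ ^ 3 * (vform θ α u.eulerR.eulerR u.eulerR.eulerR
        + vform θ α u.partialPhi.partialPhi u.partialPhi.partialPhi))) := by ring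
      _ ≤ 1 * (9 * p ^ 4) * (vform θ α v.partialPhi v.partialPhi
          * (|α| * θ ^ 3 * (vform θ α u.eulerR.eulerR u.eulerR.eulerR
        + vform θ α u.partialPhi.partialPhi u.partialPhi.partialPhi))) := by
        gcongr; norm_num
      _ = _ := by ring
  rw [B1_eq hθ hu hv hγ hlt hα0]
  generalize normX α θ u * normX α θ v = W at *
  rw [abs_le] at *
  constructor <;> linarith [t1.1, t1.2, t2.1, t2.2, t3.1, t3.2, t4.1, t4.2, t5.1, t5.2]

theorem abs_B2_le (hθ : 0 < θ) (hu : IsTestField θ u) (hv : IsTestField θ v)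
    (hγ : |γ + 1| < π / θ) (hε : 0 < ε) (hε1 : ε ≤ 1) (hθε : θ ≤ (1 - ε) * π)
    (hα : |1 - α| ≤ (1 - ε) * (π / θ)) (hα0 : -α + 1 ≠ 0) (hα1 : α + 1 ≠ 0)
    (hτ1 : |α| * θ ≤ 1) :
    |α| * θ ^ 3 * |B2 α θ γ u v| ≤ (11 + 3 * (2 / ε)) * (normX α θ u * normX α θ v) := by
  have hk : 0 < π / θ := by positivity
  have hlt : |-α + 1| < π / θ := by
    rw [neg_add_eq_sub]; refine hα.trans_lt ?_; nlinarith
  have hnu := hu.niceField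
  have hnv := hv.niceField
  have hU := normX_nonneg α θ u
  have hV := normX_nonneg α θ v
  obtain ⟨u1, u2, u3, -, u5, u6, u7, -⟩ := parts_le_normX_sq hθ hnu α
  obtain ⟨-, v2, -, -, v5, v6, -, -⟩ := parts_le_normX_sq hθ hnv α
  obtain ⟨hμτ, -, hμα⟩ := weight_relations α θ
  have hτ0 : 0 ≤ |α| * θ := by positivity
  have hμ0 : 0 ≤ |α| * θ ^ 3 := by positivity
  have hθ2 : θ ^ 2 ≤ 10 := by
    have : θ ≤ π := hθε.trans (by nlinarith [Real.pi_pos])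
    nlinarith [Real.pi_lt_d2]
  have hbw := boundary_weight_le hθ2 hτ0 hτ1 hμ0 hμτ hμα
  have nE := vform_self_nonneg hθ α u.eulerR.eulerR
  have nF := vform_self_nonneg hθ α u.partialPhi.partialPhi
  have nM := vform_self_nonneg hθ α u.eulerR.partialPhi
  have nd := vform_self_nonneg hθ α u.partialPhi
  have nEv := vform_self_nonneg hθ α v.eulerR.eulerR
  have nMv := vform_self_nonneg hθ α v.eulerR.partialPhi
  have r0 := rform_self_nonneg θ α u.rad
  have r1 := rform_self_nonneg θ α (rdr u.rad)
  have r1v := rform_self_nonneg θ α (rdr v.rad)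
  set p := 2 / ε with hp
  have hp0 : 0 ≤ p := by positivity
  rw [B2_eq hθ hu hv hγ hlt hα0, ← abs_of_nonneg hμ0, ← abs_mul]
  have hJ := powPair_sq_le' hθ hnu hv.eulerR.eulerR hγ hε hε1 hα hα0 hα1
  rw [← hp] at hJ
  have s1 := hnv.rad.rdr.rform_sq_le (θ := θ) (α := α) hnu.rad.rdr
  have s2 := hnv.rad.rdr.rform_sq_le (θ := θ) (α := α) hnu.rad
  have s3 := hnv.eulerR.eulerR.vform_sq_le (α := α) hθ hnu.eulerR.eulerR
  have s4 := hnv.eulerR.partialPhi.vform_sq_le (α := α) hθ hnu.eulerR.partialPhi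
  have s5 := hnv.eulerR.partialPhi.vform_sq_le (α := α) hθ hnu.partialPhi
  generalize |α| * θ ^ 3 = μ at *
  generalize |α| * θ = τ at *
  have t1 : |μ * rform θ α (rdr v.rad) (rdr u.rad)| ≤ 1 * (normX α θ u * normX α θ v) := by
    refine boundedness_aux zero_le_one hU hV u2 v2 (by positivity) ?_
    calc _ = μ ^ 2 * rform θ α (rdr v.rad) (rdr u.rad) ^ 2 := by ring
      _ ≤ μ ^ 2 * (rform θ α (rdr v.rad) (rdr v.rad) * rform θ α (rdr u.rad) (rdr u.rad)) := by
        gcongr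
      _ = _ := by ring
  -- One factor μ goes with r∂_r v_r, the other tames (1-2α)²: together they are at most 28τ ≤ 6².
  have t2 : |μ * ((1 - 2 * α) * rform θ α (rdr v.rad) u.rad)|
      ≤ 6 * (normX α θ u * normX α θ v) := by
    refine boundedness_aux (by norm_num) hU hV u1 v2 r0 ?_
    calc _ = μ * (2 * (μ * ((1 - 2 * α) ^ 2 / 2))) * rform θ α (rdr v.rad) u.rad ^ 2 := by ring
      _ ≤ μ * (2 * (14 * τ)) * (rform θ α (rdr v.rad) (rdr v.rad) * rform θ α u.rad u.rad) := by
        gcongr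
      _ ≤ μ * (2 * (14 * 1)) * (rform θ α (rdr v.rad) (rdr v.rad) * rform θ α u.rad u.rad) := by
        gcongr
      _ = 28 * (μ * rform θ α (rdr v.rad) (rdr v.rad) * rform θ α u.rad u.rad) := by ring
      _ ≤ 6 ^ 2 * (μ * rform θ α (rdr v.rad) (rdr v.rad) * rform θ α u.rad u.rad) := by
        gcongr; norm_num
  have t3 : |μ * vform θ α v.eulerR.eulerR u.eulerR.eulerR|
      ≤ 1 * (normX α θ u * normX α θ v) := by
    refine boundedness_aux zero_le_one hU hV u5 v5 (by positivity) ?_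
    calc _ = μ ^ 2 * vform θ α v.eulerR.eulerR u.eulerR.eulerR ^ 2 := by ring
      _ ≤ μ ^ 2 * (vform θ α v.eulerR.eulerR v.eulerR.eulerR
          * vform θ α u.eulerR.eulerR u.eulerR.eulerR) := by gcongr
      _ = _ := by ring
  have t4 : |μ * vform θ α v.eulerR.partialPhi u.eulerR.partialPhi|
      ≤ 1 * (normX α θ u * normX α θ v) := by
    refine boundedness_aux zero_le_one hU hV u6 v6 (by positivity) ?_
    calc _ = μ ^ 2 * vform θ α v.eulerR.partialPhi u.eulerR.partialPhi ^ 2 := by ring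
      _ ≤ μ ^ 2 * (vform θ α v.eulerR.partialPhi v.eulerR.partialPhi
          * vform θ α u.eulerR.partialPhi u.eulerR.partialPhi) := by gcongr
      _ = _ := by ring
  have t5 : |μ * (2 * α * vform θ α v.eulerR.partialPhi u.partialPhi)|
      ≤ 2 * (normX α θ u * normX α θ v) := by
    refine boundedness_aux (by norm_num) hU hV u3 v6 nd ?_
    calc _ = 4 * (μ * α ^ 2) * μ * vform θ α v.eulerR.partialPhi u.partialPhi ^ 2 := by ring
      _ ≤ 4 * 1 * μ * (vform θ α v.eulerR.partialPhi v.eulerR.partialPhi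
          * vform θ α u.partialPhi u.partialPhi) := by
        gcongr; rw [hμα]; exact pow_le_one₀ hτ0 hτ1
      _ = _ := by ring
  have t6 : |μ * powPair α θ γ v.eulerR.eulerR u| ≤ (3 * p) * (normX α θ u * normX α θ v) := by
    refine boundedness_aux (by positivity) hU hV u7 v5 (by positivity) ?_
    calc _ = μ ^ 2 * powPair α θ γ v.eulerR.eulerR u ^ 2 := by ring
      _ ≤ μ ^ 2 * (4 * p ^ 2 * τ ^ 2 * vform θ α v.eulerR.eulerR v.eulerR.eulerR *
        (2 * vform θ α u.eulerR.eulerR u.eulerR.eulerR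
        + 2 * vform θ α u.partialPhi.partialPhi u.partialPhi.partialPhi)) := by gcongr
      _ = (τ ^ 2 * 8) * p ^ 2 * (μ * vform θ α v.eulerR.eulerR v.eulerR.eulerR *
        (μ * (vform θ α u.eulerR.eulerR u.eulerR.eulerR
        + vform θ α u.partialPhi.partialPhi u.partialPhi.partialPhi))) := by ring
      _ ≤ (1 * 9) * p ^ 2 * (μ * vform θ α v.eulerR.eulerR v.eulerR.eulerR *
        (μ * (vform θ α u.eulerR.eulerR u.eulerR.eulerR
        + vform θ α u.partialPhi.partialPhi u.partialPhi.partialPhi))) := by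
        gcongr
        · exact pow_le_one₀ hτ0 hτ1
        · norm_num
      _ = _ := by ring
  clear s1 s2 s3 s4 s5 hJ hbw u1 u2 u3 u5 u6 u7 v2 v5 v6
  generalize normX α θ u * normX α θ v = W at *
  rw [mul_sub, mul_sub, mul_add, mul_add, mul_add, abs_le]
  rw [abs_le] at t1 t2 t3 t4 t5 t6
  constructor <;> linarith [t1.1, t1.2, t2.1, t2.2, t3.1, t3.2, t4.1, t4.2, t5.1, t5.2, t6.1, t6.2]

theorem abs_B3_le (hθ : 0 < θ) (hu : IsTestField θ u) (hv : IsTestField θ v)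
    (hγ : |γ + 1| < π / θ) (hε : 0 < ε) (hε1 : ε ≤ 1) (hθε : θ ≤ (1 - ε) * π)
    (hα : |1 - α| ≤ (1 - ε) * (π / θ)) (hα0 : α - 2 + 1 ≠ 0) (hτ1 : |α| * θ ≤ 1) :
    |α| * θ ^ 3 * |B3 α θ γ u v| ≤ (2 + 2 * lapConst ε) * (normX α θ u * normX α θ v) := by
  have hnu := hu.niceField
  have hnv := hv.niceField
  have hU := normX_nonneg α θ u
  have hV := normX_nonneg α θ v
  obtain ⟨-, -, -, -, -, -, u7, u8⟩ := parts_le_normX_sq hθ hnu α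
  obtain ⟨-, -, -, -, -, -, v7, -⟩ := parts_le_normX_sq hθ hnv α
  obtain ⟨hμτ, -, -⟩ := weight_relations α θ
  have hμ0 : 0 ≤ |α| * θ ^ 3 := by positivity
  have hτ0 : 0 ≤ |α| * θ := by positivity
  rw [B3_eq hθ hu, ← abs_of_nonneg hμ0, ← abs_mul, mul_sub]
  have s1 := hnv.lap.vform_sq_le (α := α) hθ hnu.lap
  have s2 := lapPair_sq_le' hθ hu hnv hγ hε hε1 hθε hα hα0
  have lu := hnu.vform_lap_le hθ α
  have lv := hnv.vform_lap_le hθ α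
  have lu0 := vform_self_nonneg hθ α (lap u)
  have lv0 := vform_self_nonneg hθ α (lap v)
  have nd := vform_self_nonneg hθ α u.partialPhi
  have ne := vform_self_nonneg hθ α u.eulerR
  have nF := vform_self_nonneg hθ α u.partialPhi.partialPhi
  have nM := vform_self_nonneg hθ α u.eulerR.partialPhi
  have hK := twenty_le_lapConst ε
  have hcomm : vform θ α (lap u) (lap v) = vform θ α (lap v) (lap u) := by
    simp only [vform, PolarField.dot, mul_comm]
  rw [hcomm]
  generalize lapConst ε = K at *
  generalize |α| * θ ^ 3 = μ at *
  generalize |α| * θ = τ at *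
  have lu' : μ * vform θ α (lap u) (lap u) / 2 ≤ normX α θ u ^ 2 := by
    have := mul_le_mul_of_nonneg_left lu hμ0; linarith
  have lv' : μ * vform θ α (lap v) (lap v) / 2 ≤ normX α θ v ^ 2 := by
    have := mul_le_mul_of_nonneg_left lv hμ0; linarith
  have t1 : |μ * vform θ α (lap v) (lap u)| ≤ 2 * (normX α θ u * normX α θ v) := by
    refine boundedness_aux zero_le_two hU hV lu' lv' (by positivity) ?_
    calc _ = μ ^ 2 * vform θ α (lap v) (lap u) ^ 2 := by ring
      _ ≤ μ ^ 2 * (vform θ α (lap v) (lap v) * vform θ α (lap u) (lap u)) := by gcongr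
      _ = _ := by ring
  have t2 : |μ * lapPair α θ γ u v| ≤ (2 * K) * (normX α θ u * normX α θ v) := by
    set Y := (vform θ α u.partialPhi u.partialPhi + vform θ α u.eulerR u.eulerR)
      + μ * vform θ α u.eulerR.partialPhi u.eulerR.partialPhi
      + μ * vform θ α u.partialPhi.partialPhi u.partialPhi.partialPhi with hY
    have hY0 : 0 ≤ Y := by positivity
    set Q := vform θ α u.partialPhi.partialPhi u.partialPhi.partialPhi / 4
      + K * (vform θ α u.eulerR.partialPhi u.eulerR.partialPhi
        + (θ ^ 2)⁻¹ * (vform θ α u.partialPhi u.partialPhi + vform θ α u.eulerR u.eulerR)) with hQ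
    have hμQ : μ * Q ≤ K * Y := by
      have e : μ * Q = μ * vform θ α u.partialPhi.partialPhi u.partialPhi.partialPhi / 4
          + K * (μ * vform θ α u.eulerR.partialPhi u.eulerR.partialPhi)
          + K * (τ * (vform θ α u.partialPhi u.partialPhi + vform θ α u.eulerR u.eulerR)) := by
        rw [hQ, hμτ]; field_simp; ring
      have h1 : K * (τ * (vform θ α u.partialPhi u.partialPhi + vform θ α u.eulerR u.eulerR))
          ≤ K * (1 * (vform θ α u.partialPhi u.partialPhi + vform θ α u.eulerR u.eulerR)) := by
        gcongr
      have h2 : 1 * (μ * vform θ α u.partialPhi.partialPhi u.partialPhi.partialPhi)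
          ≤ K * (μ * vform θ α u.partialPhi.partialPhi u.partialPhi.partialPhi) := by
        gcongr; linarith
      have h3 : 0 ≤ μ * vform θ α u.partialPhi.partialPhi u.partialPhi.partialPhi := by positivity
      rw [e, hY]
      linarith
    refine boundedness_aux (by linarith) hU hV u8 lv' hY0 ?_
    calc _ = μ ^ 2 * lapPair α θ γ u v ^ 2 := by ring
      _ ≤ μ ^ 2 * (Q * vform θ α (lap v) (lap v)) := by gcongr
      _ = 2 * (μ * Q) * (μ * vform θ α (lap v) (lap v) / 2) := by ring
      _ ≤ 2 * (K * Y) * (μ * vform θ α (lap v) (lap v) / 2) := by gcongr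
      _ = (2 * K) * (μ * vform θ α (lap v) (lap v) / 2 * Y) := by ring
      _ ≤ (2 * K) ^ 2 * (μ * vform θ α (lap v) (lap v) / 2 * Y) := by
        gcongr; nlinarith
  rw [abs_le] at *
  constructor <;> linarith [t1.1, t1.2, t2.1, t2.2]

theorem B_coercive (hθ : 0 < θ) (hu : IsTestField θ u) (hγ : |γ + 1| < π / θ) (hε : 0 < ε)
    (hε1 : ε ≤ 1) (hθε : θ ≤ (1 - ε) * π) (hα : |1 - α| ≤ (1 - ε) * (π / θ))
    (hα0 : -α + 1 ≠ 0) (hα1 : α + 1 ≠ 0) {s : ℝ} (hs : s = 1 / (64 * lapConst ε))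
    (hτ : |α| * θ ≤ s ^ 2 / (2 * (2 / ε) ^ 4)) :
    4 * s * normX α θ u ^ 2 ≤ B (64 * s) α θ γ u u := by
  have hk : 0 < π / θ := by positivity
  have hlt : |-α + 1| < π / θ := by
    rw [neg_add_eq_sub]; refine hα.trans_lt ?_; nlinarith
  have hn := hu.niceField
  have hθ2 : θ ^ 2 ≤ 10 := by
    have : θ ≤ π := hθε.trans (by nlinarith [Real.pi_pos])
    nlinarith [Real.pi_lt_d2]
  have hK := twenty_le_lapConst ε
  have hs0 : 0 < s := by rw [hs]; positivity
  have hs1 : s ≤ 1 / 1280 := by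
    rw [hs]; gcongr; linarith
  -- So c₃ = 64s is the inverse of the constant in the bound for `lapPair`.
  have hKs : lapConst ε = 1 / (64 * s) := by rw [hs]; field_simp
  have hJ₃ := lapPair_sq_le' hθ hu hn hγ hε hε1 hθε hα (by contrapose! hα0; linarith)
  rw [hKs] at hJ₃
  rw [normX_sq hθ hn α, B, B1_eq hθ hu hu hγ hlt hα0, B2_eq hθ hu hu hγ hlt hα0, B3_eq hθ hu,
    hn.rad.rform_rdr]
  exact coercivity_aux hθ hθ2 (by rw [le_div_iff₀ hε]; linarith) hs0 hs1 hτ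
    (rform_self_nonneg _ _ _) (rform_self_nonneg _ _ _) (vform_self_nonneg hθ α _)
    (vform_self_nonneg hθ α _) (vform_self_nonneg hθ α _) (vform_self_nonneg hθ α _)
    (vform_self_nonneg hθ α _) (vform_self_nonneg hθ α _) (hu.poincare_sq hθ hε hθε α)
    (hn.vform_partialPhi_le hθ α) (hn.vform_sq_le hθ hn.eulerR)
    (hn.eulerR.partialPhi.vform_sq_le hθ hn.partialPhi)
    (powPair_sq_le' hθ hn hu hγ hε hε1 hα hα0 hα1)
    (powPair_sq_le' hθ hn hu.eulerR.eulerR hγ hε hε1 hα hα0 hα1) hJ₃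

/-- The two lines used, Re z = -α and Re z = α - 2, satisfy |Re z + 1| = |1 - α|; the weight
interval keeps both at relative distance ε from the singularities at ±π/θ. -/
theorem abs_sub_le_of_mem_weightInterval (h : α ∈ weightInterval ε θ) :
    |1 - α| ≤ (1 - ε) * (π / θ) := by
  rw [abs_le]; constructor <;> linarith [h.1, h.2]

theorem abs_add_one_lt_of_mem (hθ : 0 < θ) (h : γ ∈ Ioo (-((π + θ) / θ)) ((π - θ) / θ)) :
    |γ + 1| < π / θ := by
  have e1 : (π + θ) / θ = π / θ + 1 := by field_simp
  have e2 : (π - θ) / θ = π / θ - 1 := by field_simp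
  rw [e1, e2] at h
  rw [abs_lt]; constructor <;> linarith [h.1, h.2]

end

end Wedge

end

/-! ### The proposition -/

theorem mainTheorem4 (ε : ℝ) (hε : ε ∈ Set.Ioo (0 : ℝ) 1) :
    ∃ c c₃ C₁ C₂ : ℝ, 0 < c ∧ 0 < c₃ ∧ 0 < C₁ ∧ 0 < C₂ ∧
      ∀ θ ∈ Set.Ioo (0 : ℝ) ((1 - ε) * Real.pi),
      ∀ α ∈ Wedge.weightInterval ε θ \ Set.range (Int.cast : ℤ → ℝ),
      |α * θ| < c →
      ∀ γ ∈ Set.Ioo (-((Real.pi + θ) / θ)) ((Real.pi - θ) / θ),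
        (∀ u : Wedge.PolarField, Wedge.IsTestField θ u →
          C₁ * Wedge.normX α θ u ^ 2 ≤ Wedge.B c₃ α θ γ u u) ∧
        (∀ u v : Wedge.PolarField, Wedge.IsTestField θ u → Wedge.IsTestField θ v →
          |Wedge.B c₃ α θ γ u v| ≤ C₂ * Wedge.normX α θ u * Wedge.normX α θ v) := by
  obtain ⟨hε0, hε1⟩ := hε
  have hK := Wedge.twenty_le_lapConst ε
  set s := 1 / (64 * Wedge.lapConst ε) with hs
  have hs0 : 0 < s := by rw [hs]; positivity
  have hs1 : s ≤ 1 / 1280 := by rw [hs]; gcongr; linarith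
  have hp : 2 ≤ 2 / ε := by rw [le_div_iff₀ hε0]; linarith
  -- The first three are c, c₃ = 1/`lapConst ε` and C₁ as required by `B_coercive`; C₂ is the sum of
  -- the bounds for the three forms. All depend on ε only.
  refine ⟨s ^ 2 / (2 * (2 / ε) ^ 4), 64 * s, 4 * s,
    (3 + 2 * (2 / ε) + 3 * (2 / ε) ^ 2) + (11 + 3 * (2 / ε))
      + 64 * s * (2 + 2 * Wedge.lapConst ε), by positivity, by positivity, by positivity,
    by positivity, fun θ hθ α hα hαθ γ hγ => ?_⟩
  have hθ0 : 0 < θ := hθ.1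
  rw [abs_mul, abs_of_pos hθ0] at hαθ
  obtain ⟨-, -, -, hτ1⟩ := Wedge.smallness_aux hp hs0 hs1 (by positivity) hαθ.le
  have hτ : |α| * θ ≤ 1 := by linarith
  have h1 := Wedge.abs_sub_le_of_mem_weightInterval hα.1
  have h2 := Wedge.abs_add_one_lt_of_mem hθ0 hγ
  -- Of the excluded integers only 1 and -1 matter: α = 1 would put the lines through the singular
  -- point, and α = -1 would spoil the mean zero property of the source.
  have hα0 : -α + 1 ≠ 0 := fun h => hα.2 ⟨1, by push_cast; linarith⟩
  have hα1 : α + 1 ≠ 0 := fun h => hα.2 ⟨-1, by push_cast; linarith⟩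
  have hα2 : α - 2 + 1 ≠ 0 := fun h => hα.2 ⟨1, by push_cast; linarith⟩
  refine ⟨fun u hu => Wedge.B_coercive hθ0 hu h2 hε0 hε1.le hθ.2.le h1 hα0 hα1 hs hαθ.le,
    fun u v hu hv => ?_⟩
  have b1 := Wedge.abs_B1_le hθ0 hu hv h2 hε0 hε1.le hθ.2.le h1 hα0 hα1 hτ
  have b2 := Wedge.abs_B2_le hθ0 hu hv h2 hε0 hε1.le hθ.2.le h1 hα0 hα1 hτ
  have b3 := Wedge.abs_B3_le hθ0 hu hv h2 hε0 hε1.le hθ.2.le h1 hα2 hτ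
  have hμ : 0 ≤ |α| * θ ^ 3 := by positivity
  calc |Wedge.B (64 * s) α θ γ u v|
      ≤ |Wedge.B1 α θ γ u v| + |α| * θ ^ 3 * |Wedge.B2 α θ γ u v|
        + 64 * s * (|α| * θ ^ 3 * |Wedge.B3 α θ γ u v|) := by
        rw [Wedge.B, mul_assoc (64 * s) |α|, mul_assoc (64 * s) (|α| * θ ^ 3)]
        refine (abs_add_le _ _).trans (add_le_add ((abs_add_le _ _).trans (le_of_eq ?_))
          (le_of_eq ?_))
        · rw [abs_mul (|α| * θ ^ 3), abs_of_nonneg hμ]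
        · rw [abs_mul (64 * s), abs_mul (|α| * θ ^ 3), abs_of_nonneg hμ,
            abs_of_pos (by positivity : 0 < 64 * s)]
    _ ≤ (3 + 2 * (2 / ε) + 3 * (2 / ε) ^ 2) * (Wedge.normX α θ u * Wedge.normX α θ v)
        + (11 + 3 * (2 / ε)) * (Wedge.normX α θ u * Wedge.normX α θ v)
        + 64 * s * ((2 + 2 * Wedge.lapConst ε) * (Wedge.normX α θ u * Wedge.normX α θ v)) := by
        gcongr
    _ = _ := by ring
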